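/- Let $\mathfrak h$ be a complex Hilbert space (inner product linear in the second argument), $\Gamma$ an anti-unitary involution on $\mathfrak h$, i.e. an antilinear map with $\Gamma^2=1$ and $\langle\Gamma f,\Gamma h\rangle=\langle h,f\rangle$, and $P$ a basis projection, i.e. an orthogonal projection with $P+\Gamma P\Gamma=1$; put $\mathfrak p=P\mathfrak h$. Let $\mathfrak q\subseteq\mathfrak h$ be a closed $\Gamma$-invariant subspace with orthogonal projection $Q$, such that $\mathfrak p$ and $\mathfrak q$ are in generic position: $\mathfrak p\cap\mathfrak q=\mathfrak p\cap\mathfrak q^\perp=\mathfrak p^\perp\cap\mathfrak q=\mathfrak p^\perp\cap\mathfrak q^\perp=\{0\}$. Let $\mathfrak F=\bigoplus_{n\ge0}\bigwedge^n\mathfrak p$ be the (Hilbert space) antisymmetric Fock space with vacuum $\Omega$ and $\langle p_1\wedge\dots\wedge p_n,p_1'\wedge\dots\wedge p_n'\rangle=\det(\langle p_i,p_j'\rangle)$, let $P_n$ be the orthogonal projection onto the $n$-particle subspace (the closed span of the vectors $p_1\wedge\dots\wedge p_n$), and identify $\mathfrak p=P_1\mathfrak F$. Let $c(p)^*$ and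 $c(p)$ be the creation and annihilation operators, $a(f)=c(P\Gamma f)^*+c(Pf)$ for $f\in\mathfrak h$, and $\mathcal M(\mathfrak q)=\{a(q)\mid q\in\mathfrak q\}''$. Let $S$ be the Tomita operator of $(\mathcal M(\mathfrak q),\Omega)$, i.e. the closure of $A\Omega\mapsto A^*\Omega$, $A\in\mathcal M(\mathfrak q)$; let $S^*$ be its adjoint, $\Delta=S^*S$, and $S=J\Delta^{1/2}$ the polar decomposition. Let $\alpha$, $\beta$ be the antilinear operators in $\mathfrak p$ with graphs $$\operatorname{gra}\beta=\{(Pq,P\Gamma q)\mid q\in\mathfrak q\},\qquad \operatorname{gra}\alpha=\{(Pq^\perp,-P\Gamma q^\perp)\mid q^\perp\in\mathfrak q^\perp\},$$ and $\Delta_{\mathfrak p}=\beta^*\beta$. For a closed subspace $\mathfrak r\subseteq\mathfrak h$ let $\mathcal D_n(\mathfrak r)=P_n\operatorname{span}\{a(r_1)\cdots a(r_k)\Omega\mid k\ge0,\ r_1,\dots,r_k\in\mathfrak r\}$. An operator $A$ in $\mathfrak F$ is said to restrict to $P_n\mathfrak F$ if $P_n\operatorname{dom}A\subseteq\operatorname{dom}A$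 and $AP_nx=P_nAx$ for $x\in\operatorname{dom}A$; then $A\restriction P_n\mathfrak F$ has domain $\operatorname{dom}A\cap P_n\mathfrak F$. Then $S$ and $S^*$ are densely defined antilinear operators, $\Delta$ is a densely defined linear operator, the polar decomposition exists, and: 1. $S$ and $S^*$ restrict to $P_n\mathfrak F$ for every $n\ge0$; moreover $\mathcal D_n(\mathfrak q)\subseteq\operatorname{dom}S$, $\mathcal D_n(\mathfrak q^\perp)\subseteq\operatorname{dom}S^*$, and $$S\restriction P_n\mathfrak F=\overline{S\restriction\mathcal D_n(\mathfrak q)},\qquad S^*\restriction P_n\mathfrak F=\overline{S^*\restriction\mathcal D_n(\mathfrak q^\perp)}.$$ In particular $S\restriction\mathfrak p=\beta$ and $S^*\restriction\mathfrak p=\alpha$. 2. $\Delta$ restricts to $P_n\mathfrak F$ for every $n\ge0$. One has $\Delta\restriction\mathfrak p=\Delta_{\mathfrak p}$ and $\operatorname{dom}\Delta_{\mathfrak p}=PQ\mathfrak p$; for $p_1,\dots,p_n\in\operatorname{dom}\Delta_{\mathfrak p}$ the vector $p_1\wedge\dots\wedge p_n$ lies in $\operatorname{dom}\Delta$ and $$\Delta(p_1\wedge\dots\wedge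 p_n)=(\Delta_{\mathfrak p}p_1)\wedge\dots\wedge(\Delta_{\mathfrak p}p_n);$$ and $\Delta\restriction P_n\mathfrak F$ is the closure of its restriction to the linear span of these vectors $p_1\wedge\dots\wedge p_n$. 3. $J$ restricts to $P_n\mathfrak F$ for every $n\ge0$, in particular $J\mathfrak p\subseteq\mathfrak p$, and for all $p_1,\dots,p_n\in\mathfrak p$ $$J(p_1\wedge\dots\wedge p_n)=(Jp_n)\wedge\dots\wedge(Jp_1).$$ -/

import Mathlib

open scoped InnerProductSpace

noncomputable section

/-! ### The antisymmetric Fock space and its creation and annihilation operators -/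

namespace FermiFock

open ExteriorAlgebra

section

variable {E : Type*} [NormedAddCommGroup E] [InnerProductSpace ℂ E]

/-- Contraction on the algebraic exterior algebra: the linear map with
`contr p (p₁ ∧ … ∧ pₙ) = ∑ r, (-1)^(r-1) ⟪p, p_r⟫ p₁ ∧ … (omit p_r) … ∧ pₙ`. It is antilinear in
`p`; the inner product is linear in its second argument. -/
def contr (p : E) : ExteriorAlgebra ℂ E →ₗ[ℂ] ExteriorAlgebra ℂ E :=
  CliffordAlgebra.contractLeft (innerₛₗ ℂ p)

lemma contr_one (p : E) : contr p 1 = 0 := CliffordAlgebra.contractLeft_one (Q := (0 : QuadraticForm ℂ E)) (innerₛₗ ℂ p)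

lemma contr_algebraMap (p : E) (r : ℂ) : contr p (algebraMap ℂ _ r) = 0 :=
  CliffordAlgebra.contractLeft_algebraMap (Q := (0 : QuadraticForm ℂ E)) (innerₛₗ ℂ p) r

lemma contr_ι_mul (p q : E) (x : ExteriorAlgebra ℂ E) :
    contr p (ι ℂ q * x) = ⟪p, q⟫_ℂ • x - ι ℂ q * contr p x :=
  CliffordAlgebra.contractLeft_ι_mul (Q := (0 : QuadraticForm ℂ E)) (d := innerₛₗ ℂ p) q x

lemma contr_contr (p : E) (x : ExteriorAlgebra ℂ E) : contr p (contr p x) = 0 :=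
  CliffordAlgebra.contractLeft_contractLeft (Q := (0 : QuadraticForm ℂ E)) (innerₛₗ ℂ p) x

lemma contr_add (p q : E) : contr (p + q) = contr p + contr q := by
  simp [contr]

lemma contr_smul (c : ℂ) (p : E) : contr (c • p) = star c • contr p := by
  simp [contr]

/-- The opposite of the algebra of endomorphisms of the exterior algebra, with scalars acting through
complex conjugation. It serves to extend the antilinear map `p ↦ contr p` to a (conjugate-linear,
order-reversing) multiplicative map on the exterior algebra. -/
def ConjEnd (E : Type*) [NormedAddCommGroup E] [InnerProductSpace ℂ E] : Type _ :=
  (Module.End ℂ (ExteriorAlgebra ℂ E))ᵐᵒᵖ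

instance : Ring (ConjEnd E) := inferInstanceAs (Ring (Module.End ℂ (ExteriorAlgebra ℂ E))ᵐᵒᵖ)

instance : Algebra ℂ (ConjEnd E) :=
  letI : Algebra ℂ (ConjEnd E) :=
    inferInstanceAs (Algebra ℂ (Module.End ℂ (ExteriorAlgebra ℂ E))ᵐᵒᵖ)
  Algebra.compHom (ConjEnd E) (starRingEnd ℂ)

/-- An endomorphism as an element of `ConjEnd`. -/
def toConjEnd (f : Module.End ℂ (ExteriorAlgebra ℂ E)) : ConjEnd E := MulOpposite.op f

/-- An element of `ConjEnd` as an endomorphism. -/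
def ofConjEnd (f : ConjEnd E) : Module.End ℂ (ExteriorAlgebra ℂ E) := MulOpposite.unop f

lemma ofConjEnd_smul (c : ℂ) (f : ConjEnd E) : ofConjEnd (c • f) = star c • ofConjEnd f := rfl

/-- `p₁ ∧ … ∧ pₙ` is sent to the composition `contr pₙ ∘ … ∘ contr p₁`, antilinearly. -/
def multiContr : ExteriorAlgebra ℂ E →ₐ[ℂ] ConjEnd E :=
  ExteriorAlgebra.lift ℂ
    ⟨{ toFun := fun p => toConjEnd (contr p)
       map_add' := fun p q => by rw [contr_add]; rfl
       map_smul' := fun c p => by rw [contr_smul]; rfl },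
     fun p => congrArg MulOpposite.op (LinearMap.ext fun x => contr_contr p x)⟩

/-- The inner product of the exterior algebra: antilinear in `x`, with `form 1 y` the scalar part of
`y` and `form (p ∧ x) y = form x (contr p y)`; so
`form (p₁ ∧ … ∧ pₙ) (q₁ ∧ … ∧ qₘ)` is `det ⟪pᵢ, qⱼ⟫` if `m = n`, and `0` if `m ≠ n`. -/
def form (x y : ExteriorAlgebra ℂ E) : ℂ := algebraMapInv (ofConjEnd (multiContr x) y)

lemma form_add_left (x x' y : ExteriorAlgebra ℂ E) : form (x + x') y = form x y + form x' y := by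
  simp only [form, map_add]
  exact map_add (algebraMapInv (R := ℂ) (M := E)) _ _

lemma form_smul_left (c : ℂ) (x y : ExteriorAlgebra ℂ E) : form (c • x) y = star c * form x y := by
  simp only [form, map_smul, ofConjEnd_smul, LinearMap.smul_apply, smul_eq_mul]

lemma form_add_right (x y y' : ExteriorAlgebra ℂ E) : form x (y + y') = form x y + form x y' := by
  simp only [form, map_add]

lemma form_smul_right (c : ℂ) (x y : ExteriorAlgebra ℂ E) : form x (c • y) = c * form x y := by
  simp only [form, map_smul, smul_eq_mul]

lemma form_one_left (y : ExteriorAlgebra ℂ E) : form 1 y = algebraMapInv y := by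
  simp only [form, map_one]; rfl

lemma form_ι_mul_left (p : E) (x y : ExteriorAlgebra ℂ E) :
    form (ι ℂ p * x) y = form x (contr p y) := by
  have h : multiContr (ι ℂ p) = toConjEnd (contr p) := by
    unfold multiContr; erw [ExteriorAlgebra.lift_ι_apply]; rfl
  simp only [form, map_mul, h]; rfl


lemma ext_induction {C : ExteriorAlgebra ℂ E → Prop} (one : C 1)
    (smul : ∀ (c : ℂ) x, C x → C (c • x)) (add : ∀ x y, C x → C y → C (x + y))
    (mul : ∀ x p, C x → C (ι ℂ p * x)) (x : ExteriorAlgebra ℂ E) : C x :=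
  CliffordAlgebra.left_induction (Q := (0 : QuadraticForm ℂ E)) (P := C)
    (fun r => by rw [Algebra.algebraMap_eq_smul_one]; exact smul r 1 one) add mul x

lemma form_ι_mul_right (p : E) (x y : ExteriorAlgebra ℂ E) :
    form x (ι ℂ p * y) = form (contr p x) y := by
  induction x using ext_induction generalizing y with
  | one =>
    rw [contr_one, form_one_left, map_mul]
    have h0 : form (0 : ExteriorAlgebra ℂ E) y = 0 := by
      simpa using form_smul_left 0 (0 : ExteriorAlgebra ℂ E) y
    simp [h0, algebraMapInv]
  | smul c x h => simp only [map_smul, form_smul_left, h]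
  | add x x' h h' => simp only [map_add, form_add_left, h, h']
  | mul x q h =>
    have h1 : contr p (ι ℂ q * x) = ⟪p, q⟫_ℂ • x + (-1 : ℂ) • (ι ℂ q * contr p x) := by
      rw [contr_ι_mul, sub_eq_add_neg, neg_one_smul]
    have h2 : contr q (ι ℂ p * y) = ⟪q, p⟫_ℂ • y + (-1 : ℂ) • (ι ℂ p * contr q y) := by
      rw [contr_ι_mul, sub_eq_add_neg, neg_one_smul]
    rw [form_ι_mul_left, h1, h2, form_add_left, form_smul_left, form_smul_left, form_ι_mul_left,
      form_add_right, form_smul_right, form_smul_right, h]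
    simp

lemma form_conj (x y : ExteriorAlgebra ℂ E) : star (form y x) = form x y := by
  induction x using ext_induction generalizing y with
  | one =>
    rw [form_one_left]
    induction y using ext_induction with
    | one => simp [form_one_left]
    | smul c x h => simp [form_smul_left, h]
    | add x x' h h' => simp [form_add_left, h, h']
    | mul x p h =>
      rw [form_ι_mul_left, contr_one, map_mul]
      have h0 := form_smul_right 0 x 0
      simp only [zero_smul, zero_mul] at h0
      simp [h0, algebraMapInv]
  | smul c x h => rw [form_smul_right, form_smul_left, star_mul', h]
  | add x x' h h' => rw [form_add_right, form_add_left, star_add, h, h']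
  | mul x p h => rw [form_ι_mul_right, form_ι_mul_left, h]

/-- A consequence of the canonical anticommutation relations. -/
lemma form_car (p : E) (x y : ExteriorAlgebra ℂ E) :
    form (ι ℂ p * x) (ι ℂ p * y) + form (contr p x) (contr p y) = ⟪p, p⟫_ℂ * form x y := by
  have h1 : contr p (ι ℂ p * y) = ⟪p, p⟫_ℂ • y + (-1 : ℂ) • (ι ℂ p * contr p y) := by
    rw [contr_ι_mul, sub_eq_add_neg, neg_one_smul]
  rw [form_ι_mul_left, h1, form_add_right, form_smul_right, form_smul_right, form_ι_mul_right]
  ring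

/-- Elements obtained from `1` by linear combinations and left multiplication by vectors of `s`,
i.e. the elements of the subalgebra generated by `s`. -/
inductive Gen (s : Set E) : ExteriorAlgebra ℂ E → Prop
  | one : Gen s 1
  | add {x y} : Gen s x → Gen s y → Gen s (x + y)
  | smul (c : ℂ) {x} : Gen s x → Gen s (c • x)
  | mul {p x} : p ∈ s → Gen s x → Gen s (ι ℂ p * x)

lemma Gen.zero (s : Set E) : Gen s (0 : ExteriorAlgebra ℂ E) := by
  simpa using Gen.smul 0 (Gen.one (s := s))

lemma Gen.of_span {s t : Set E} (h : s ⊆ Submodule.span ℂ t) {x : ExteriorAlgebra ℂ E}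
    (hx : Gen s x) : Gen t x := by
  induction hx with
  | one => exact .one
  | add _ _ h1 h2 => exact .add h1 h2
  | smul c _ h1 => exact .smul c h1
  | @mul p x hp _ h1 =>
    have hpt := h hp
    clear hp
    induction hpt using Submodule.span_induction with
    | mem q hq => exact .mul hq h1
    | zero => simpa using Gen.zero t
    | add q q' _ _ hq hq' => rw [map_add, add_mul]; exact .add hq hq'
    | smul c q _ hq => rw [map_smul, smul_mul_assoc]; exact .smul c hq

lemma Gen.exists_finset (x : ExteriorAlgebra ℂ E) : ∃ s : Finset E, Gen (s : Set E) x := by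
  classical
  induction x using ext_induction with
  | one => exact ⟨∅, .one⟩
  | smul c x h => exact h.imp fun s hs => .smul c hs
  | add x y hx hy =>
    obtain ⟨s, hs⟩ := hx
    obtain ⟨t, ht⟩ := hy
    refine ⟨s ∪ t, .add (hs.of_span fun p hp => Submodule.subset_span ?_)
      (ht.of_span fun p hp => Submodule.subset_span ?_)⟩ <;> simp_all
  | mul x p hx =>
    obtain ⟨s, hs⟩ := hx
    refine ⟨insert p s, .mul (by simp) (hs.of_span fun q hq => Submodule.subset_span ?_)⟩
    simp_all

lemma Gen.exists_orthonormal (x : ExteriorAlgebra ℂ E) :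
    ∃ t : Finset E, Orthonormal ℂ ((↑) : t → E) ∧ Gen (t : Set E) x := by
  classical
  obtain ⟨s, hs⟩ := Gen.exists_finset x
  let W := Submodule.span ℂ (s : Set E)
  have : FiniteDimensional ℂ W := FiniteDimensional.span_finset ℂ s
  let b := stdOrthonormalBasis ℂ W
  let f : Fin (Module.finrank ℂ W) → E := fun i => (b i : E)
  have hf : Orthonormal ℂ f := b.orthonormal.comp_linearIsometry W.subtypeₗᵢ
  refine ⟨Finset.univ.image f, ?_, hs.of_span fun p hp => ?_⟩
  · have := hf.toSubtypeRange
    exact this.comp (fun p : ↥(Finset.univ.image f) => (⟨p, by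
      obtain ⟨i, _, hi⟩ := Finset.mem_image.mp p.2
      exact ⟨i, hi⟩⟩ : ↥(Set.range f))) fun p q h => Subtype.ext (by simpa using h)
  · have hp' : p ∈ W := Submodule.subset_span hp
    have h1 : ((∑ i, b.repr ⟨p, hp'⟩ i • b i : W) : E) = p := by rw [b.sum_repr]
    rw [← h1]
    simp only [Submodule.coe_sum, Submodule.coe_smul]
    exact Submodule.sum_mem _ fun i _ => Submodule.smul_mem _ _ (Submodule.subset_span (by simp [f]))

lemma Gen.contr_eq_zero {s : Set E} {v : E} (hv : ∀ p ∈ s, ⟪v, p⟫_ℂ = 0)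
    {x : ExteriorAlgebra ℂ E} (hx : Gen s x) : contr v x = 0 := by
  induction hx with
  | one => exact contr_one v
  | add _ _ h1 h2 => rw [map_add, h1, h2, add_zero]
  | smul c _ h1 => rw [map_smul, h1, smul_zero]
  | mul hp _ h1 => rw [contr_ι_mul, hv _ hp, h1, zero_smul, mul_zero, sub_zero]

lemma Gen.decomp {s : Set E} {v : E} {x : ExteriorAlgebra ℂ E} (hx : Gen (insert v s) x) :
    ∃ u w, Gen s u ∧ Gen s w ∧ x = u + ι ℂ v * w := by
  induction hx with
  | one => exact ⟨1, 0, .one, .zero s, by simp⟩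
  | add _ _ h1 h2 =>
    obtain ⟨u, w, hu, hw, rfl⟩ := h1
    obtain ⟨u', w', hu', hw', rfl⟩ := h2
    exact ⟨u + u', w + w', .add hu hu', .add hw hw', by rw [mul_add]; abel⟩
  | smul c _ h1 =>
    obtain ⟨u, w, hu, hw, rfl⟩ := h1
    exact ⟨c • u, c • w, .smul c hu, .smul c hw, by rw [smul_add, mul_smul_comm]⟩
  | @mul p x hp _ h1 =>
    obtain ⟨u, w, hu, hw, rfl⟩ := h1
    rcases hp with rfl | hp
    · exact ⟨0, u, .zero s, hu, by
        rw [mul_add, ← mul_assoc, ι_sq_zero, zero_mul, add_zero, zero_add]⟩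
    · refine ⟨ι ℂ p * u, (-1 : ℂ) • (ι ℂ p * w), .mul hp hu, .smul _ (.mul hp hw), ?_⟩
      have h := ι_add_mul_swap (R := ℂ) p v
      rw [mul_add, ← mul_assoc, eq_neg_of_add_eq_zero_left h, mul_smul_comm, neg_one_smul,
        neg_mul, mul_assoc]

lemma form_zero_right (x : ExteriorAlgebra ℂ E) : form x 0 = 0 := by
  simpa using form_smul_right 0 x 0

/-- Positive definiteness, for elements generated by a finite orthonormal family. -/
lemma form_self_pos_aux (t : Finset E) (ht : Orthonormal ℂ ((↑) : t → E))
    (x : ExteriorAlgebra ℂ E) (hx : Gen (t : Set E) x) :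
    0 ≤ (form x x).re ∧ (form x x = 0 → x = 0) := by
  classical
  induction t using Finset.induction_on generalizing x with
  | empty =>
    have hc : ∃ c : ℂ, x = c • 1 := by
      induction hx with
      | one => exact ⟨1, by simp⟩
      | add _ _ h1 h2 =>
        obtain ⟨c, rfl⟩ := h1
        obtain ⟨d, rfl⟩ := h2
        exact ⟨c + d, by rw [add_smul]⟩
      | smul c _ h1 =>
        obtain ⟨d, rfl⟩ := h1
        exact ⟨c * d, by rw [mul_smul]⟩
      | mul hp _ _ => simp at hp
    obtain ⟨c, rfl⟩ := hc
    have h : form (c • (1 : ExteriorAlgebra ℂ E)) (c • 1) = ((Complex.normSq c : ℝ) : ℂ) := by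
      rw [form_smul_left, form_smul_right, form_one_left, map_one, mul_one,
        Complex.normSq_eq_conj_mul_self]
      rfl
    rw [h, Complex.ofReal_re]
    refine ⟨Complex.normSq_nonneg c, fun h0 => ?_⟩
    rw [Complex.ofReal_eq_zero, Complex.normSq_eq_zero] at h0
    simp [h0]
  | insert v s hvs ih =>
    rw [Finset.coe_insert] at hx
    obtain ⟨u, w, hu, hw, rfl⟩ := hx.decomp
    have hs : Orthonormal ℂ ((↑) : s → E) :=
      ht.comp (fun p : s => (⟨p, Finset.mem_insert_of_mem p.2⟩ : ↥(insert v s)))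
        (fun p q h => Subtype.ext (by simpa using h))
    have hv : ∀ p ∈ (s : Set E), ⟪v, p⟫_ℂ = 0 := fun p hp =>
      ht.2 (i := ⟨v, Finset.mem_insert_self v s⟩) (j := ⟨p, Finset.mem_insert_of_mem hp⟩)
        (fun h => hvs (by rw [show v = p from congrArg Subtype.val h]; exact hp))
    have hvv : ⟪v, v⟫_ℂ = 1 := by
      have := ht.1 ⟨v, Finset.mem_insert_self v s⟩
      rw [inner_self_eq_norm_sq_to_K]; simp_all
    have hcu := Gen.contr_eq_zero hv hu
    have hcw := Gen.contr_eq_zero hv hw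
    have hww : form (ι ℂ v * w) (ι ℂ v * w) = form w w := by
      have := form_car v w w
      rwa [hcw, form_zero_right, add_zero, hvv, one_mul] at this
    have key : form (u + ι ℂ v * w) (u + ι ℂ v * w) = form u u + form w w := by
      rw [form_add_left, form_add_right, form_add_right, hww, form_ι_mul_left v w u, hcu,
        form_ι_mul_right v u w, hcu, form_zero_right, ← form_conj 0 w, form_zero_right]
      simp
    obtain ⟨hu0, hu1⟩ := ih hs u hu
    obtain ⟨hw0, hw1⟩ := ih hs w hw
    rw [key]
    refine ⟨by rw [Complex.add_re]; positivity, fun h => ?_⟩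
    have him : ∀ z : ExteriorAlgebra ℂ E, (form z z).im = 0 := fun z => by
      have := congrArg Complex.im (form_conj z z)
      simp at this
      linarith
    have hre : (form u u).re + (form w w).re = 0 := by rw [← Complex.add_re, h]; rfl
    rw [hu1 (Complex.ext (by simp; linarith) (him u)),
      hw1 (Complex.ext (by simp; linarith) (him w))]
    simp

/-- The form `form` is an inner product on the exterior algebra. -/
@[reducible]
def core : InnerProductSpace.Core ℂ (ExteriorAlgebra ℂ E) where
  inner x y := form x y
  conj_inner_symm x y := form_conj x y
  add_left := form_add_left
  smul_left x y c := form_smul_left c x y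
  re_inner_nonneg x := by
    obtain ⟨t, ht, hx⟩ := Gen.exists_orthonormal x
    exact (form_self_pos_aux t ht x hx).1
  definite x h := by
    obtain ⟨t, ht, hx⟩ := Gen.exists_orthonormal x
    exact (form_self_pos_aux t ht x hx).2 h

instance : NormedAddCommGroup (ExteriorAlgebra ℂ E) :=
  (core (E := E)).toNormedAddCommGroup

instance : InnerProductSpace ℂ (ExteriorAlgebra ℂ E) := InnerProductSpace.ofCore (core (E := E)).toCore

lemma inner_def (x y : ExteriorAlgebra ℂ E) : ⟪x, y⟫_ℂ = form x y := rfl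

lemma norm_car (p : E) (x : ExteriorAlgebra ℂ E) :
    ‖ι ℂ p * x‖ ^ 2 + ‖contr p x‖ ^ 2 = (‖p‖ * ‖x‖) ^ 2 := by
  have h := form_car p x x
  simp only [← inner_def, inner_self_eq_norm_sq_to_K] at h
  rw [mul_pow]
  exact_mod_cast h

lemma norm_ι_mul_le (p : E) (x : ExteriorAlgebra ℂ E) : ‖ι ℂ p * x‖ ≤ ‖p‖ * ‖x‖ :=
  le_of_sq_le_sq (by nlinarith [norm_car p x, sq_nonneg ‖contr p x‖]) (by positivity)

lemma norm_contr_le (p : E) (x : ExteriorAlgebra ℂ E) : ‖contr p x‖ ≤ ‖p‖ * ‖x‖ :=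
  le_of_sq_le_sq (by nlinarith [norm_car p x, sq_nonneg ‖ι ℂ p * x‖]) (by positivity)

end

/-- The antisymmetric Fock space over `E`: the Hilbert space completion of the algebraic exterior
algebra `⨁ₙ ⋀ⁿ E`, in which the inner product of `p₁ ∧ … ∧ pₙ` and `q₁ ∧ … ∧ qₙ` is
`det ⟪pᵢ, qⱼ⟫` and the different particle numbers are orthogonal. -/
abbrev Fock (E : Type*) [NormedAddCommGroup E] [InnerProductSpace ℂ E] : Type _ :=
  UniformSpace.Completion (ExteriorAlgebra ℂ E)

section

variable {E : Type*} [NormedAddCommGroup E] [InnerProductSpace ℂ E]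

/-- The `n`-particle vector `p₁ ∧ … ∧ pₙ`. -/
def wedge {n : ℕ} (p : Fin n → E) : Fock E :=
  ((ιMulti ℂ n p : ExteriorAlgebra ℂ E) : Fock E)

/-- The one-particle vector `p`. -/
def oneParticle (p : E) : Fock E := ((ι ℂ p : ExteriorAlgebra ℂ E) : Fock E)

/-- The Fock vacuum `Ω`. -/
def vacuum : Fock E := ((1 : ExteriorAlgebra ℂ E) : Fock E)

/-- The creation operator `c(p)^*`, the bounded extension of `x ↦ p ∧ x`. -/
def create (p : E) : Fock E →L[ℂ] Fock E :=
  ((LinearMap.mulLeft ℂ (ι ℂ p)).mkContinuous ‖p‖ (norm_ι_mul_le p)).completion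

/-- The annihilation operator `c(p)`, the bounded extension of the contraction with `p`. -/
def annihilate (p : E) : Fock E →L[ℂ] Fock E :=
  ((contr p).mkContinuous ‖p‖ (norm_contr_le p)).completion

/-- The `n`-particle subspace, the closure of the span of the vectors `p₁ ∧ … ∧ pₙ`. -/
def nParticle (E : Type*) [NormedAddCommGroup E] [InnerProductSpace ℂ E] (n : ℕ) :
    Submodule ℂ (Fock E) :=
  (Submodule.span ℂ (Set.range fun p : Fin n → E => wedge p)).topologicalClosure

instance (n : ℕ) : CompleteSpace (nParticle E n) := by
  unfold nParticle; infer_instance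

end

end FermiFock

/-! ### Unbounded (linear or antilinear) operators, given by their graphs -/

namespace OpGraph

section

variable {E F : Type*} [NormedAddCommGroup E] [InnerProductSpace ℂ E]
  [NormedAddCommGroup F] [InnerProductSpace ℂ F]

/-- `G` is the graph of a densely defined operator from `E` to `F` that is semilinear with respect to
`σ` (the identity for a linear, the complex conjugation for an antilinear operator). -/
structure IsDenselyDefined (σ : ℂ →+* ℂ) (G : Set (E × F)) : Prop where
  add_mem : ∀ {x y x' y'}, (x, y) ∈ G → (x', y') ∈ G → (x + x', y + y') ∈ G
  smul_mem : ∀ (c : ℂ) {x y}, (x, y) ∈ G → (c • x, σ c • y) ∈ G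
  unique : ∀ {x y y'}, (x, y) ∈ G → (x, y') ∈ G → y = y'
  dense : Dense {x | ∃ y, (x, y) ∈ G}

/-- The graph of the adjoint of an antilinear operator `A`:
`A^* y = z` iff `⟪A x, y⟫ = ⟪z, x⟫` for all `x` in the domain of `A`. -/
def antiAdjoint (G : Set (E × F)) : Set (F × E) :=
  {w | ∀ v ∈ G, ⟪v.2, w.1⟫_ℂ = ⟪w.2, v.1⟫_ℂ}

/-- The graph of the composition `B ∘ A`, with its natural domain, from the graphs of `A` and `B`. -/
def comp {G : Type*} (B : Set (F × G)) (A : Set (E × F)) : Set (E × G) :=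
  {w | ∃ y, (w.1, y) ∈ A ∧ (y, w.2) ∈ B}

/-- The graph of the restriction of an operator to those vectors of its domain that lie in `V`. -/
def restrict (G : Set (E × F)) (V : Set E) : Set (E × F) := {w | w ∈ G ∧ w.1 ∈ V}

/-- The operator `A` with graph `G` restricts to an operator in the closed subspace `V`: the
orthogonal projection `P_V` maps the domain of `A` into itself, and `A P_V x = P_V A x` for all `x` in
the domain. In particular `A` maps the vectors of its domain that lie in `V` to vectors in `V`. -/
def RestrictsTo (G : Set (E × E)) (V : Submodule ℂ E) [V.HasOrthogonalProjection] : Prop :=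
  ∀ x y, (x, y) ∈ G → (V.starProjection x, V.starProjection y) ∈ G

/-- `S = J R` is the polar decomposition of the antilinear operator with graph `S`. Here `R` is the
positive self-adjoint square root of `S^* S`, and `J` is an everywhere defined bounded antilinear
operator that is isometric on the closure of the range of `R` and vanishes on its orthogonal
complement. -/
structure IsPolarDecomposition (S : Set (E × E)) [CompleteSpace E]
    (J : E →L⋆[ℂ] E) (R : E →ₗ.[ℂ] E) : Prop where
  selfAdjoint : IsSelfAdjoint R
  nonneg : ∀ x : R.domain, 0 ≤ (⟪(x : E), R x⟫_ℂ).re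
  sq_eq : comp {w | w ∈ R.graph} {w | w ∈ R.graph} = comp (antiAdjoint S) S
  isometry : ∀ y ∈ closure (Set.range R), ‖J y‖ = ‖y‖
  vanish : ∀ y : E, (∀ x : R.domain, ⟪R x, y⟫_ℂ = 0) → J y = 0
  eq_comp : S = {w | ∃ x : R.domain, w = ((x : E), J (R x))}

end

end OpGraph

/-! ### The self-dual CAR algebra in the Fock representation, and its modular objects -/

namespace SelfDualCAR

open FermiFock OpGraph

variable {𝔥 : Type*} [NormedAddCommGroup 𝔥] [InnerProductSpace ℂ 𝔥]

/-- `Γ` is an anti-unitary involution. -/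
structure IsAntiunitaryInvolution (Γ : 𝔥 →ₗ⋆[ℂ] 𝔥) : Prop where
  involutive : ∀ f, Γ (Γ f) = f
  inner_map : ∀ f h, ⟪Γ f, Γ h⟫_ℂ = ⟪h, f⟫_ℂ

/-- The orthogonal projection `P` onto `𝔭` is a basis projection: `P + Γ P Γ = 1`. -/
def IsBasisProjection (Γ : 𝔥 →ₗ⋆[ℂ] 𝔥) (𝔭 : Submodule ℂ 𝔥) [𝔭.HasOrthogonalProjection] : Prop :=
  ∀ f, 𝔭.starProjection f + Γ (𝔭.starProjection (Γ f)) = f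

/-- Two closed subspaces are in generic position. -/
structure GenericPosition (𝔭 𝔮 : Submodule ℂ 𝔥) : Prop where
  inf_left : 𝔭 ⊓ 𝔮 = ⊥
  inf_right : 𝔭 ⊓ 𝔮ᗮ = ⊥
  inf_left' : 𝔭ᗮ ⊓ 𝔮 = ⊥
  inf_right' : 𝔭ᗮ ⊓ 𝔮ᗮ = ⊥

variable (Γ : 𝔥 →ₗ⋆[ℂ] 𝔥) (𝔭 𝔮 : Submodule ℂ 𝔥) [𝔭.HasOrthogonalProjection]

/-- `Pf`, as an element of `𝔭`. -/
abbrev proj (f : 𝔥) : 𝔭 := 𝔭.orthogonalProjectionOnto f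

/-- The generator `a(f) = c(PΓf)^* + c(Pf)` in the Fock representation given by `P`. -/
def a (f : 𝔥) : Fock 𝔭 →L[ℂ] Fock 𝔭 := create (proj 𝔭 (Γ f)) + annihilate (proj 𝔭 f)

/-- The von Neumann algebra `M(𝔮) = {a(q) | q ∈ 𝔮}''` on the Fock space. -/
def M : Set (Fock 𝔭 →L[ℂ] Fock 𝔭) :=
  Set.centralizer (Set.centralizer {A | ∃ q ∈ 𝔮, A = a Γ 𝔭 q})

/-- The graph of the Tomita operator `S` of `(M(𝔮), Ω)`, the closure of the antilinear operator
`A Ω ↦ A^* Ω`, `A ∈ M(𝔮)`. -/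
def tomita : Set (Fock 𝔭 × Fock 𝔭) :=
  closure {w | ∃ A ∈ M Γ 𝔭 𝔮, w = (A vacuum, ContinuousLinearMap.adjoint A vacuum)}

/-- The graph of `S^*`. -/
def tomitaAdj : Set (Fock 𝔭 × Fock 𝔭) := antiAdjoint (tomita Γ 𝔭 𝔮)

/-- The graph of the modular operator `Δ = S^* S`. -/
def modularOp : Set (Fock 𝔭 × Fock 𝔭) := comp (tomitaAdj Γ 𝔭 𝔮) (tomita Γ 𝔭 𝔮)

/-- The linear span of the vectors `a(r₁) ⋯ a(r_k) Ω` with `r₁, …, r_k ∈ 𝔯` and `k ≥ 0`. -/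
def finDomain (𝔯 : Submodule ℂ 𝔥) : Submodule ℂ (Fock 𝔭) :=
  Submodule.span ℂ {x | ∃ l : List 𝔥, (∀ r ∈ l, r ∈ 𝔯) ∧ x = (l.map (a Γ 𝔭)).prod vacuum}

/-- The image of `finDomain` under the orthogonal projection onto the `n`-particle subspace. -/
def finDomainN (𝔯 : Submodule ℂ 𝔥) (n : ℕ) : Set (Fock 𝔭) :=
  (nParticle 𝔭 n).starProjection '' finDomain Γ 𝔭 𝔯

/-- The graph of the antilinear operator `β` on `𝔭`, `β (Pq) = PΓq` for `q ∈ 𝔮`. -/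
def β : Set (𝔭 × 𝔭) := {w | ∃ q ∈ 𝔮, w = (proj 𝔭 q, proj 𝔭 (Γ q))}

/-- The graph of the antilinear operator `α` on `𝔭`, `α (Pq') = -PΓq'` for `q' ∈ 𝔮ᗮ`. -/
def α : Set (𝔭 × 𝔭) := {w | ∃ q ∈ 𝔮ᗮ, w = (proj 𝔭 q, -proj 𝔭 (Γ q))}

/-- The graph of `Δ_𝔭 = β^* β`. -/
def oneModular : Set (𝔭 × 𝔭) := comp (antiAdjoint (β Γ 𝔭 𝔮)) (β Γ 𝔭 𝔮)

/-- A set of pairs of vectors in `𝔭`, seen as a set of pairs of one-particle vectors in the Fock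
space. -/
def embed (G : Set (𝔭 × 𝔭)) : Set (Fock 𝔭 × Fock 𝔭) :=
  (fun w => (oneParticle w.1, oneParticle w.2)) '' G

end SelfDualCAR

end

/-! Everything is reduced to the one-particle space by an order-reversing second quantization. For
an antilinear relation G on 𝔭, `antiFock G` is the antilinear relation on the algebraic Fock space
generated by p₁ ∧ … ∧ pₙ ↦ pₙ' ∧ … ∧ p₁' with (pᵢ, pᵢ') in G. The central claim is that S is the
closure of `antiFock` of β and S^* the closure of `antiFock` of α (`tomita_eq`, `tomitaAdj_eq`).
Since these relations respect particle number, the restriction statements follow.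

Two inclusions are algebraic. A vector a(q₁)⋯a(q_k)Ω is not a wedge product but a Wick expansion.
The combinatorics is avoided by lifting to the exterior algebra of 𝔥, where left fields and right
fields commute. Applied to 1, right fields produce the reversed product, so pairing a left field of
f with a right field of Γf describes AΩ ↦ A^*Ω. Wick ordering shows that these pairings generate the
same relation as the wedge products (`antiRel_field`, `FieldRel.of_antiRel`). This puts `antiFock`
of β inside S. On 𝔮ᗮ, field monomials multiplied by powers of the parity commute with M(𝔮), which
puts `antiFock` of α, with its minus sign, inside S^*. Therefore the closure of `antiFock` of β lies
in S, and S lies in the adjoint of `antiFock` of α.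

The gap is closed by `Regularization.antiAdjoint_eq`: second quantization respects adjoints. Put D =
PQP and b = PΓQP on 𝔭. Then βD = b, α(1 - D) = b, b² = D - D² and bD = (1 - D)b. Generic position
makes b injective, so the cutoffs (D - D²)(D - D² + 1/(n+1))⁻¹ tend strongly to 1, while β and α
become bounded after composition with them. Second quantized cutoffs then approximate any pair of
the adjoint by pairs in the closure. Applying the cutoff twice shows in the same way that wedge
products of vectors in the domain of β^*β span a core of Δ on each particle number.

For J, the polar decomposition b = jk with k = (D - D²)^{1/2} gives an antiunitary involution j that
commutes with b and intertwines D with 1 - D. Hence jβj = α, and jβ is positive. These properties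
survive second quantization, so JS is positive and self-adjoint for the second quantized J, and S =
J(JS) is a polar decomposition. As S is injective, its polar decomposition is unique
(`IsPolarDecomposition.unique`). -/

noncomputable section

namespace FermiFock

open ExteriorAlgebra

/-! ### Contractions and order-reversing antilinear relations on an exterior algebra -/

section

variable {V W : Type*} [AddCommGroup V] [Module ℂ V] [AddCommGroup W] [Module ℂ W]

lemma left_induction {C : ExteriorAlgebra ℂ V → Prop} (one : C 1)
    (smul : ∀ (c : ℂ) x, C x → C (c • x)) (add : ∀ x y, C x → C y → C (x + y))
    (mul : ∀ p x, C x → C (ι ℂ p * x)) (x : ExteriorAlgebra ℂ V) : C x :=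
  CliffordAlgebra.left_induction (Q := (0 : QuadraticForm ℂ V)) (P := C)
    (fun r => by rw [Algebra.algebraMap_eq_smul_one]; exact smul r 1 one) add
    (fun x p => mul p x) x

/-- Contraction from the left with a functional. -/
def lcontr (d : Module.Dual ℂ V) : ExteriorAlgebra ℂ V →ₗ[ℂ] ExteriorAlgebra ℂ V :=
  CliffordAlgebra.contractLeft d

/-- Contraction from the right with a functional. -/
def rcontr (d : Module.Dual ℂ V) : ExteriorAlgebra ℂ V →ₗ[ℂ] ExteriorAlgebra ℂ V :=
  (CliffordAlgebra.contractRight (Q := (0 : QuadraticForm ℂ V))).flip d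

/-- The parity automorphism of the exterior algebra. -/
def parity : ExteriorAlgebra ℂ V →ₐ[ℂ] ExteriorAlgebra ℂ V :=
  ExteriorAlgebra.map (-LinearMap.id)

lemma lcontr_one (d : Module.Dual ℂ V) : lcontr d 1 = 0 :=
  CliffordAlgebra.contractLeft_one (Q := (0 : QuadraticForm ℂ V)) d

lemma rcontr_one (d : Module.Dual ℂ V) : rcontr d 1 = 0 :=
  CliffordAlgebra.contractRight_one (Q := (0 : QuadraticForm ℂ V)) d

lemma lcontr_ι_mul (d : Module.Dual ℂ V) (p : V) (x : ExteriorAlgebra ℂ V) :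
    lcontr d (ι ℂ p * x) = d p • x - ι ℂ p * lcontr d x :=
  CliffordAlgebra.contractLeft_ι_mul (Q := (0 : QuadraticForm ℂ V)) (d := d) p x

lemma rcontr_mul_ι (d : Module.Dual ℂ V) (p : V) (x : ExteriorAlgebra ℂ V) :
    rcontr d (x * ι ℂ p) = d p • x - rcontr d x * ι ℂ p :=
  CliffordAlgebra.contractRight_mul_ι (Q := (0 : QuadraticForm ℂ V)) (d := d) p x

lemma rcontr_smul (c : ℂ) (d : Module.Dual ℂ V) (x : ExteriorAlgebra ℂ V) :
    rcontr (c • d) x = c • rcontr d x := by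
  simp [rcontr]

lemma map_ι_mul (A : V →ₗ[ℂ] W) (p : V) (x : ExteriorAlgebra ℂ V) :
    map A (ι ℂ p * x) = ι ℂ (A p) * map A x := by
  rw [map_mul, map_apply_ι]

lemma parity_ι (p : V) : parity (ι ℂ p) = -ι ℂ p := by
  simp [parity, map_apply_ι]

lemma parity_ι_mul (p : V) (x : ExteriorAlgebra ℂ V) :
    parity (ι ℂ p * x) = -(ι ℂ p * parity x) := by
  rw [map_mul, parity_ι, neg_mul]

lemma lcontr_parity (d : Module.Dual ℂ V) (x : ExteriorAlgebra ℂ V) :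
    lcontr d (parity x) = -parity (lcontr d x) := by
  induction x using left_induction with
  | one => simp [lcontr_one]
  | smul c x h => simp only [map_smul, h, smul_neg]
  | add x y hx hy => simp only [map_add, hx, hy, neg_add]
  | mul p x h =>
    rw [parity_ι_mul, map_neg, lcontr_ι_mul, lcontr_ι_mul, map_sub, map_smul, parity_ι_mul, h]
    simp

lemma lcontr_mul_ι (d : Module.Dual ℂ V) (p : V) (x : ExteriorAlgebra ℂ V) :
    lcontr d (x * ι ℂ p) = lcontr d x * ι ℂ p + d p • parity x := by
  induction x using left_induction with
  | one =>
    have := lcontr_ι_mul d p 1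
    rw [mul_one, lcontr_one] at this
    simp [this, lcontr_one]
  | smul c x h => simp only [smul_mul_assoc, map_smul, h, smul_add, smul_comm c]
  | add x y hx hy => simp only [add_mul, map_add, hx, hy, smul_add]; abel
  | mul q x h =>
    rw [mul_assoc, lcontr_ι_mul, h, lcontr_ι_mul, parity_ι_mul, mul_add, sub_mul, smul_mul_assoc,
      mul_smul_comm, smul_neg, mul_assoc]
    abel

lemma rcontr_ι_mul (d : Module.Dual ℂ V) (p : V) (x : ExteriorAlgebra ℂ V) :
    rcontr d (ι ℂ p * x) = ι ℂ p * rcontr d x + d p • parity x := by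
  refine CliffordAlgebra.right_induction (Q := (0 : QuadraticForm ℂ V))
    (P := fun x => rcontr d (ι ℂ p * x) = ι ℂ p * rcontr d x + d p • parity x) ?_ ?_ ?_ x
  · intro r
    have h1 := rcontr_mul_ι d p (algebraMap ℂ _ r)
    have h2 : rcontr d (algebraMap ℂ _ r) = 0 := by
      rw [Algebra.algebraMap_eq_smul_one, map_smul, rcontr_one, smul_zero]
    change rcontr d (ι ℂ p * algebraMap ℂ (ExteriorAlgebra ℂ V) r) =
      ι ℂ p * rcontr d (algebraMap ℂ (ExteriorAlgebra ℂ V) r) +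
        d p • parity (algebraMap ℂ (ExteriorAlgebra ℂ V) r)
    rw [← Algebra.commutes, h1, h2, AlgHom.commutes]
    simp
  · intro x y hx hy
    simp only [mul_add, map_add, hx, hy, smul_add]; abel
  · intro x q h
    change rcontr d (ι ℂ p * (q * ι ℂ x)) =
      ι ℂ p * rcontr d (q * ι ℂ x) + d p • parity (q * ι ℂ x)
    rw [← mul_assoc, rcontr_mul_ι, h, rcontr_mul_ι, map_mul, parity_ι, mul_sub, add_mul,
      smul_mul_assoc, mul_smul_comm, mul_neg, smul_neg, mul_assoc]
    abel

/-- No sign appears: the parity term in `rcontr_ι_mul` anticommutes with the left contraction, and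
this compensates the sign of moving the contraction past p. -/
lemma rcontr_lcontr (d d' : Module.Dual ℂ V) (x : ExteriorAlgebra ℂ V) :
    rcontr d' (lcontr d x) = lcontr d (rcontr d' x) := by
  induction x using left_induction with
  | one => simp [lcontr_one, rcontr_one]
  | smul c x h => simp only [map_smul, h]
  | add x y hx hy => simp only [map_add, hx, hy]
  | mul p x h =>
    rw [lcontr_ι_mul, map_sub, map_smul, rcontr_ι_mul, rcontr_ι_mul, map_add, lcontr_ι_mul,
      map_smul, lcontr_parity, h, smul_neg]
    abel

/-- The antilinear relation sending `p₁ ∧ … ∧ pₙ` to `pₙ' ∧ … ∧ p₁'` for `(pᵢ, pᵢ')` in `G`. -/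
inductive AntiRel (G : Set (V × V)) : ExteriorAlgebra ℂ V → ExteriorAlgebra ℂ V → Prop
  | one : AntiRel G 1 1
  | add {x y x' y'} : AntiRel G x y → AntiRel G x' y' → AntiRel G (x + x') (y + y')
  | smul (c : ℂ) {x y} : AntiRel G x y → AntiRel G (c • x) (star c • y)
  | mul {p p' x y} : (p, p') ∈ G → AntiRel G x y → AntiRel G (ι ℂ p * x) (y * ι ℂ p')

namespace AntiRel

variable {G : Set (V × V)} {H : Set (W × W)}

lemma zero : AntiRel G 0 0 := by simpa using AntiRel.smul 0 (AntiRel.one (G := G))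

lemma neg {x y : ExteriorAlgebra ℂ V} (h : AntiRel G x y) : AntiRel G (-x) (-y) := by
  simpa using AntiRel.smul (-1) h

lemma sub {x y x' y' : ExteriorAlgebra ℂ V} (h : AntiRel G x y) (h' : AntiRel G x' y') :
    AntiRel G (x - x') (y - y') := by
  simpa [sub_eq_add_neg] using h.add h'.neg

lemma mul_right {p p' : V} (hp : (p, p') ∈ G) {x y : ExteriorAlgebra ℂ V} (h : AntiRel G x y) :
    AntiRel G (x * ι ℂ p) (ι ℂ p' * y) := by
  induction h with
  | one => simpa using AntiRel.mul hp (AntiRel.one (G := G))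
  | add _ _ h1 h2 => rw [add_mul, mul_add]; exact h1.add h2
  | smul c _ h => rw [smul_mul_assoc, mul_smul_comm]; exact h.smul c
  | mul hq _ h => simpa only [mul_assoc] using AntiRel.mul hq h

lemma swap {G' : Set (V × V)} (hG : ∀ p p', (p, p') ∈ G → (p', p) ∈ G')
    {x y : ExteriorAlgebra ℂ V} (h : AntiRel G x y) : AntiRel G' y x := by
  induction h with
  | one => exact .one
  | add _ _ h1 h2 => exact h1.add h2
  | smul c _ h => simpa using h.smul (star c)
  | mul hq _ h => exact h.mul_right (hG _ _ hq)

/-- Because the relation reverses products, a contraction at the left end of x corresponds to one at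
the right end of y. -/
lemma contr {d d' : Module.Dual ℂ V} (hd : ∀ p p', (p, p') ∈ G → star (d p) = d' p')
    {x y : ExteriorAlgebra ℂ V} (h : AntiRel G x y) : AntiRel G (lcontr d x) (rcontr d' y) := by
  induction h with
  | one => rw [lcontr_one, rcontr_one]; exact .zero
  | add _ _ h1 h2 => simp only [map_add]; exact h1.add h2
  | smul c _ h => simp only [map_smul]; exact h.smul c
  | mul hq h ih =>
    rw [lcontr_ι_mul, rcontr_mul_ι, ← hd _ _ hq]
    exact (h.smul _).sub (.mul hq ih)

lemma contr' {d d' : Module.Dual ℂ V} (hd : ∀ p p', (p, p') ∈ G → star (d p) = d' p')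
    {x y : ExteriorAlgebra ℂ V} (h : AntiRel G x y) : AntiRel G (rcontr d x) (lcontr d' y) := by
  have h1 : AntiRel {w : V × V | (w.2, w.1) ∈ G} y x := h.swap fun _ _ hp => hp
  exact (h1.contr (d := d') (d' := d) fun p p' hp => by rw [← hd _ _ hp, star_star]).swap
    fun _ _ hp => hp

lemma map {f g : V →ₗ[ℂ] W} (hf : ∀ p p', (p, p') ∈ G → (f p, g p') ∈ H)
    {x y : ExteriorAlgebra ℂ V} (h : AntiRel G x y) :
    AntiRel H (ExteriorAlgebra.map f x) (ExteriorAlgebra.map g y) := by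
  induction h with
  | one => simp only [map_one]; exact .one
  | add _ _ h1 h2 => simp only [map_add]; exact h1.add h2
  | smul c _ h => simp only [map_smul]; exact h.smul c
  | mul hq h ih => simp only [map_mul, map_apply_ι]; exact .mul (hf _ _ hq) ih

/-- Pairs are lifted generator by generator. This carries relations on the exterior algebra of 𝔭
back to that of 𝔥, where the left and right fields act. -/
lemma exists_of_map {f : V →ₗ[ℂ] W}
    (hf : ∀ p p', (p, p') ∈ H → ∃ q q', (q, q') ∈ G ∧ f q = p ∧ f q' = p')
    {x y : ExteriorAlgebra ℂ W} (h : AntiRel H x y) :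
    ∃ x' y', AntiRel G x' y' ∧ ExteriorAlgebra.map f x' = x ∧ ExteriorAlgebra.map f y' = y := by
  induction h with
  | one => exact ⟨1, 1, .one, map_one _, map_one _⟩
  | add _ _ h1 h2 =>
    obtain ⟨x, y, h, rfl, rfl⟩ := h1
    obtain ⟨x', y', h', rfl, rfl⟩ := h2
    exact ⟨_, _, h.add h', map_add _ _ _, map_add _ _ _⟩
  | smul c _ h =>
    obtain ⟨x, y, h, rfl, rfl⟩ := h
    exact ⟨_, _, h.smul c, map_smul _ _ _, map_smul _ _ _⟩
  | mul hq _ h =>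
    obtain ⟨x, y, h, rfl, rfl⟩ := h
    obtain ⟨q, q', hq', rfl, rfl⟩ := hf _ _ hq
    exact ⟨_, _, .mul hq' h, by rw [map_mul, map_apply_ι], by rw [map_mul, map_apply_ι]⟩

/-- To prove an additive and antilinear property of the pairs in `AntiRel G`, it suffices to consider
products of vectors. -/
lemma list_induction {N : ExteriorAlgebra ℂ V → ExteriorAlgebra ℂ V → Prop}
    (add : ∀ x y x' y', N x y → N x' y' → N (x + x') (y + y'))
    (smul : ∀ (c : ℂ) x y, N x y → N (c • x) (star c • y))
    (list : ∀ l : List (V × V), (∀ w ∈ l, w ∈ G) →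
      N (l.map fun w => ι ℂ w.1).prod (l.reverse.map fun w => ι ℂ w.2).prod)
    {x y : ExteriorAlgebra ℂ V} (h : AntiRel G x y) : N x y := by
  -- The relation is built by multiplication on one side, so the induction carries the factors
  -- already peeled off as a list.
  suffices ∀ l : List (V × V), (∀ w ∈ l, w ∈ G) →
      N ((l.map fun w => ι ℂ w.1).prod * x) (y * (l.reverse.map fun w => ι ℂ w.2).prod) by
    simpa using this [] (by simp)
  induction h with
  | one => intro l hl; simpa using list l hl
  | add _ _ h1 h2 => intro l hl; rw [mul_add, add_mul]; exact add _ _ _ _ (h1 l hl) (h2 l hl)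
  | smul c _ h =>
    intro l hl; rw [mul_smul_comm, smul_mul_assoc]; exact smul c _ _ (h l hl)
  | @mul p p' x y hq _ h =>
    intro l hl
    have := h (l ++ [(p, p')]) (by simpa [or_imp, forall_and] using ⟨fun a b => hl (a, b), hq⟩)
    simpa [mul_assoc] using this

lemma of_list (l : List (V × V)) (hl : ∀ w ∈ l, w ∈ G) :
    AntiRel G (l.map fun w => ι ℂ w.1).prod (l.reverse.map fun w => ι ℂ w.2).prod := by
  induction l with
  | nil => simpa using AntiRel.one (G := G)
  | cons w l ih =>
    simp only [List.mem_cons, forall_eq_or_imp] at hl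
    simpa using AntiRel.mul (p := w.1) (p' := w.2) hl.1 (ih hl.2)

end AntiRel

/-! ### Order-reversing antilinear maps. -/

/-- The opposite of the exterior algebra, with scalars acting through complex conjugation. -/
def ConjOp (V : Type*) [AddCommGroup V] [Module ℂ V] : Type _ := (ExteriorAlgebra ℂ V)ᵐᵒᵖ

instance : Ring (ConjOp V) := inferInstanceAs (Ring (ExteriorAlgebra ℂ V)ᵐᵒᵖ)

instance : Algebra ℂ (ConjOp V) :=
  letI : Algebra ℂ (ConjOp V) := inferInstanceAs (Algebra ℂ (ExteriorAlgebra ℂ V)ᵐᵒᵖ)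
  Algebra.compHom (ConjOp V) (starRingEnd ℂ)

/-- An element of the exterior algebra as an element of `ConjOp`. -/
def toConjOp (x : ExteriorAlgebra ℂ V) : ConjOp V := MulOpposite.op x

/-- An element of `ConjOp` as an element of the exterior algebra. -/
def ofConjOp (x : ConjOp V) : ExteriorAlgebra ℂ V := MulOpposite.unop x

/-- The antilinear map sending `p₁ ∧ … ∧ pₙ` to `b pₙ ∧ … ∧ b p₁`, as an algebra homomorphism. -/
def antiMapAux (b : V →ₗ⋆[ℂ] V) : ExteriorAlgebra ℂ V →ₐ[ℂ] ConjOp V :=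
  ExteriorAlgebra.lift ℂ
    ⟨{ toFun := fun p => toConjOp (ι ℂ (b p))
       map_add' := fun p q => by rw [map_add, map_add]; rfl
       map_smul' := fun c p => by rw [b.map_smulₛₗ, map_smul]; rfl },
     fun p => congrArg MulOpposite.op (ι_sq_zero (b p))⟩

/-- The antilinear map sending `p₁ ∧ … ∧ pₙ` to `b pₙ ∧ … ∧ b p₁`. -/
def antiMap (b : V →ₗ⋆[ℂ] V) : ExteriorAlgebra ℂ V →ₗ⋆[ℂ] ExteriorAlgebra ℂ V where
  toFun x := ofConjOp (antiMapAux b x)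
  map_add' x y := by rw [map_add]; rfl
  map_smul' c x := by rw [map_smul]; rfl

lemma antiMap_one (b : V →ₗ⋆[ℂ] V) : antiMap b 1 = 1 := by
  change ofConjOp (antiMapAux b 1) = 1
  rw [map_one]; rfl

lemma antiMap_ι_mul (b : V →ₗ⋆[ℂ] V) (p : V) (x : ExteriorAlgebra ℂ V) :
    antiMap b (ι ℂ p * x) = antiMap b x * ι ℂ (b p) := by
  change ofConjOp (antiMapAux b (ι ℂ p * x)) = _
  have h : antiMapAux b (ι ℂ p) = toConjOp (ι ℂ (b p)) := by
    unfold antiMapAux; erw [ExteriorAlgebra.lift_ι_apply]; rfl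
  rw [map_mul, h]; rfl

lemma AntiRel.of_antiMap {G : Set (W × W)} {f : V →ₗ[ℂ] W} {b : V →ₗ⋆[ℂ] V} {g : V →ₗ[ℂ] W}
    (h : ∀ p, (f p, g (b p)) ∈ G) (x : ExteriorAlgebra ℂ V) :
    AntiRel G (ExteriorAlgebra.map f x) (ExteriorAlgebra.map g (antiMap b x)) := by
  induction x using left_induction with
  | one => simp only [map_one, antiMap_one]; exact .one
  | smul c x hx => rw [LinearMap.map_smulₛₗ]; simp only [map_smul]; exact hx.smul c
  | add x y hx hy => simp only [map_add]; exact hx.add hy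
  | mul p x hx =>
    rw [map_ι_mul, antiMap_ι_mul, map_mul, map_apply_ι]
    exact .mul (h p) hx

lemma AntiRel.antiMap_eq {G : Set (V × V)} {b : V →ₗ⋆[ℂ] V} {f : V →ₗ[ℂ] V}
    (hb : ∀ p p', (p, p') ∈ G → b p = f p')
    {x y : ExteriorAlgebra ℂ V} (h : AntiRel G x y) : antiMap b x = ExteriorAlgebra.map f y := by
  induction h with
  | one => rw [antiMap_one, map_one]
  | add _ _ h1 h2 => rw [map_add, map_add, h1, h2]
  | smul c _ h => rw [LinearMap.map_smulₛₗ, map_smul, h]; rfl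
  | mul hq _ h => rw [antiMap_ι_mul, map_mul, map_apply_ι, h, hb _ _ hq]

lemma antiMap_mul_ι (b : V →ₗ⋆[ℂ] V) (p : V) (x : ExteriorAlgebra ℂ V) :
    antiMap b (x * ι ℂ p) = ι ℂ (b p) * antiMap b x := by
  induction x using left_induction with
  | one => simpa [antiMap_one] using antiMap_ι_mul b p 1
  | smul c x h => rw [smul_mul_assoc, LinearMap.map_smulₛₗ, LinearMap.map_smulₛₗ, h, mul_smul_comm]
  | add x y hx hy => rw [add_mul, map_add, map_add, hx, hy, mul_add]
  | mul q x h => rw [mul_assoc, antiMap_ι_mul, antiMap_ι_mul, h, mul_assoc]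

lemma antiMap_antiMap (b b' : V →ₗ⋆[ℂ] V) (f : V →ₗ[ℂ] V) (h : ∀ p, b' (b p) = f p)
    (x : ExteriorAlgebra ℂ V) : antiMap b' (antiMap b x) = map f x := by
  induction x using left_induction with
  | one => rw [antiMap_one, antiMap_one, map_one]
  | smul c x h => rw [LinearMap.map_smulₛₗ, LinearMap.map_smulₛₗ, h, map_smul]; simp
  | add x y hx hy => simp only [map_add, hx, hy]
  | mul p x hx => rw [antiMap_ι_mul, antiMap_mul_ι, map_ι_mul, hx, h]

lemma AntiRel.conj {G : Set (V × V)} {H : Set (V × V)} {j : V →ₗ⋆[ℂ] V}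
    (hj : ∀ p p', (p, p') ∈ G → (j p, j p') ∈ H)
    {x y : ExteriorAlgebra ℂ V} (h : AntiRel G x y) : AntiRel H (antiMap j x) (antiMap j y) := by
  induction h with
  | one => rw [antiMap_one]; exact .one
  | add _ _ h1 h2 => simp only [map_add]; exact h1.add h2
  | smul c _ h => simp only [LinearMap.map_smulₛₗ]; exact h.smul _
  | mul hq _ h => rw [antiMap_ι_mul, antiMap_mul_ι]; exact h.mul_right (hj _ _ hq)

end

end FermiFock

end

noncomputable section

namespace FermiFock

open ExteriorAlgebra

/-! ### Second quantization and the inner product -/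

section

variable {E : Type*} [NormedAddCommGroup E] [InnerProductSpace ℂ E]

lemma contr_eq_lcontr (p : E) : contr p = lcontr (innerₛₗ ℂ p) := rfl

/-- Only the one-particle part of y contributes to the scalar part of a contraction, and there the
two contractions agree. -/
lemma form_one_rcontr (d : Module.Dual ℂ E) (y : ExteriorAlgebra ℂ E) :
    form 1 (rcontr d y) = form 1 (lcontr d y) := by
  induction y using left_induction with
  | one => rw [rcontr_one, lcontr_one]
  | smul c x h => simp only [map_smul, form_smul_right, h]
  | add x y hx hy => simp only [map_add, form_add_right, hx, hy]
  | mul p x _ =>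
    have h1 : form 1 (parity x) = form 1 x := by
      clear * -
      induction x using left_induction with
      | one => rw [map_one]
      | smul c x h => simp only [map_smul, form_smul_right, h]
      | add x y hx hy => simp only [map_add, form_add_right, hx, hy]
      | mul p x _ =>
        rw [parity_ι_mul, ← neg_one_smul ℂ, form_smul_right, form_ι_mul_right, form_ι_mul_right,
          contr_one, ← form_conj 0, ← form_conj 0, form_zero_right, form_zero_right]
        simp
    have h0 : ∀ z : ExteriorAlgebra ℂ E, form 1 (ι ℂ p * z) = 0 := fun z => by
      rw [form_ι_mul_right, contr_one, ← form_conj, form_zero_right, star_zero]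
    rw [rcontr_ι_mul, lcontr_ι_mul, sub_eq_add_neg, ← neg_one_smul ℂ, form_add_right,
      form_add_right, form_smul_right, form_smul_right, form_smul_right, h0, h0, h1]
    ring

lemma form_mul_ι_left (p : E) (x y : ExteriorAlgebra ℂ E) :
    form (x * ι ℂ p) y = form x (rcontr (innerₛₗ ℂ p) y) := by
  induction x using left_induction generalizing y with
  | one =>
    rw [form_one_rcontr, ← contr_eq_lcontr, ← form_ι_mul_left, one_mul, mul_one]
  | smul c x h => simp only [smul_mul_assoc, form_smul_left, h]
  | add x x' h h' => simp only [add_mul, form_add_left, h, h']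
  | mul q x h =>
    rw [mul_assoc, form_ι_mul_left, h, form_ι_mul_left, contr_eq_lcontr, rcontr_lcontr]

/-- Formally adjoint antilinear relations have formally adjoint second quantizations. -/
lemma AntiRel.form_eq {G H : Set (E × E)}
    (hGH : ∀ p p' r r', (p, p') ∈ G → (r, r') ∈ H → ⟪p', r⟫_ℂ = ⟪r', p⟫_ℂ)
    {x y v w : ExteriorAlgebra ℂ E} (h : AntiRel G x y) (h' : AntiRel H v w) :
    form y v = form w x := by
  induction h generalizing v w with
  | one =>
    rw [← form_conj w 1]
    induction h' with
    | one => simp [form_one_left]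
    | add _ _ h1 h2 => rw [form_add_right, form_add_right, h1, h2, star_add]
    | smul c _ h => rw [form_smul_right, form_smul_right, h, star_mul', star_star]
    | @mul p p' x y _ _ _ =>
      have h0 : form (0 : ExteriorAlgebra ℂ E) x = 0 := by
        rw [← form_conj, form_zero_right, star_zero]
      rw [form_ι_mul_right, contr_one, h0, form_conj, form_mul_ι_left, rcontr_one, form_zero_right]
  | add _ _ h1 h2 => rw [form_add_left, form_add_right, h1 h', h2 h']
  | smul c _ h => rw [form_smul_left, form_smul_right, h h', star_star]
  | @mul p p' x y hp _ h =>
    -- Removing p' from the right end of one argument contracts v from the right; removing p from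
    -- the left end of the other contracts w from the left. The contracted pair is again related, so
    -- the induction hypothesis applies.
    rw [form_mul_ι_left, form_ι_mul_right, contr_eq_lcontr]
    refine h (h'.contr' fun r r' hr => ?_)
    change (starRingEnd ℂ) ⟪p', r⟫_ℂ = ⟪p, r'⟫_ℂ
    rw [inner_conj_symm, ← inner_conj_symm p r', ← hGH _ _ _ _ hp hr, inner_conj_symm]

lemma form_map {F : Type*} [NormedAddCommGroup F] [InnerProductSpace ℂ F]
    {A : E →ₗ[ℂ] F} {B : F →ₗ[ℂ] E} (hAB : ∀ p q, ⟪A p, q⟫_ℂ = ⟪p, B q⟫_ℂ)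
    (x : ExteriorAlgebra ℂ E) (y : ExteriorAlgebra ℂ F) :
    form (map A x) y = form x (map B y) := by
  have hc : ∀ (p : E) (y : ExteriorAlgebra ℂ F),
      contr p (map B y) = map B (contr (A p) y) := fun p y => by
    induction y using left_induction with
    | one => simp [contr_one]
    | smul c x h => simp only [map_smul, h]
    | add x y hx hy => simp only [map_add, hx, hy]
    | mul q y h => rw [map_ι_mul, contr_ι_mul, contr_ι_mul, map_sub, map_smul, map_ι_mul, h, hAB]
  induction x using left_induction generalizing y with
  | one =>
    rw [map_one]
    induction y using left_induction with
    | one => rw [map_one]; simp [form_one_left]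
    | smul c x h => simp only [map_smul, form_smul_right, h]
    | add x y hx hy => simp only [map_add, form_add_right, hx, hy]
    | mul q y _ =>
      have h0 : ∀ z : ExteriorAlgebra ℂ F, form 0 z = 0 := fun z => by
        rw [← form_conj, form_zero_right, star_zero]
      have h0' : ∀ z : ExteriorAlgebra ℂ E, form 0 z = 0 := fun z => by
        rw [← form_conj, form_zero_right, star_zero]
      rw [map_ι_mul, form_ι_mul_right, form_ι_mul_right, contr_one, contr_one, h0, h0']
  | smul c x h => simp only [map_smul, form_smul_left, h]
  | add x x' h h' => simp only [map_add, form_add_left, h, h']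
  | mul q x h => rw [map_ι_mul, form_ι_mul_left, form_ι_mul_left, hc, h]

/-- The bound is crude but depends on x only, so it holds uniformly for all powers of a contraction.
-/
lemma exists_norm_map_le (x : ExteriorAlgebra ℂ E) :
    ∃ C : ℝ, ∀ A : E →ₗ[ℂ] E, (∀ p, ‖A p‖ ≤ ‖p‖) → ‖map A x‖ ≤ C := by
  induction x using left_induction with
  | one => exact ⟨‖(1 : ExteriorAlgebra ℂ E)‖, fun A _ => by rw [map_one]⟩
  | smul c x h =>
    obtain ⟨C, h⟩ := h
    refine ⟨‖c‖ * C, fun A hA => ?_⟩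
    rw [map_smul, norm_smul]
    exact mul_le_mul_of_nonneg_left (h A hA) (norm_nonneg c)
  | add x y hx hy =>
    obtain ⟨C, hx⟩ := hx
    obtain ⟨D, hy⟩ := hy
    refine ⟨C + D, fun A hA => ?_⟩
    rw [map_add]
    exact (norm_add_le _ _).trans (add_le_add (hx A hA) (hy A hA))
  | mul p x h =>
    obtain ⟨C, h⟩ := h
    refine ⟨‖p‖ * C, fun A hA => ?_⟩
    rw [map_ι_mul]
    exact (norm_ι_mul_le _ _).trans
      (mul_le_mul (hA p) (h A hA) (norm_nonneg _) (norm_nonneg _))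

lemma norm_map_sq_le {A B : E →ₗ[ℂ] E} (hAB : ∀ p q, ⟪A p, q⟫_ℂ = ⟪p, B q⟫_ℂ)
    (x : ExteriorAlgebra ℂ E) : ‖map A x‖ ^ 2 ≤ ‖x‖ * ‖map (B ∘ₗ A) x‖ := by
  have h : ⟪map A x, map A x⟫_ℂ = ⟪x, map (B ∘ₗ A) x⟫_ℂ := by
    rw [inner_def, inner_def, form_map hAB, ← map_comp_map]; rfl
  have h1 := norm_inner_le_norm (𝕜 := ℂ) x (map (B ∘ₗ A) x)
  rw [← h, inner_self_eq_norm_sq_to_K] at h1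
  simpa using h1

/-- The second quantization of a self-adjoint contraction is a contraction. -/
lemma norm_map_le {A : E →ₗ[ℂ] E} (hA : ∀ p q, ⟪A p, q⟫_ℂ = ⟪p, A q⟫_ℂ)
    (hn : ∀ p, ‖A p‖ ≤ ‖p‖) (x : ExteriorAlgebra ℂ E) : ‖map A x‖ ≤ ‖x‖ := by
  obtain ⟨C, hC⟩ := exists_norm_map_le x
  have hpow : ∀ m : ℕ, (∀ p q, ⟪(A ^ m) p, q⟫_ℂ = ⟪p, (A ^ m) q⟫_ℂ) ∧
      ∀ p, ‖(A ^ m) p‖ ≤ ‖p‖ := fun m => by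
    induction m with
    | zero => simp
    | succ m ih =>
      refine ⟨fun p q => ?_, fun p => ?_⟩
      · rw [pow_succ, Module.End.mul_apply, ih.1, hA, ← Module.End.mul_apply, ← pow_succ', pow_succ]
      · rw [pow_succ, Module.End.mul_apply]; exact (ih.2 _).trans (hn p)
  by_contra! hlt
  have hx : 0 < ‖x‖ := by
    rcases (norm_nonneg x).eq_or_lt with h | h
    · rw [norm_eq_zero.mp h.symm, map_zero] at hlt; simp at hlt
    · exact h
  set r := ‖map A x‖ / ‖x‖ with hr
  have hr1 : 1 < r := by rwa [hr, one_lt_div hx]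
  -- Repeated squaring with `norm_map_sq_le`: a ratio r > 1 would make the norms of the second
  -- quantized powers of A at x grow without bound, against the uniform bound C.
  have key : ∀ k : ℕ, ‖x‖ * r ^ (2 ^ k) ≤ ‖map (A ^ (2 ^ k)) x‖ := fun k => by
    induction k with
    | zero => simp [hr, mul_div_cancel₀ _ hx.ne']
    | succ k ih =>
      have h1 := norm_map_sq_le (hpow (2 ^ k)).1 x
      rw [show (A ^ 2 ^ k) ∘ₗ (A ^ 2 ^ k) = A ^ 2 ^ (k + 1) by
        rw [← Module.End.mul_eq_comp, ← pow_add, pow_succ, mul_two]] at h1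
      have h2 : (‖x‖ * r ^ 2 ^ k) ^ 2 ≤ ‖map (A ^ 2 ^ k) x‖ ^ 2 :=
        pow_le_pow_left₀ (by positivity) ih 2
      have h3 := h2.trans h1
      rw [mul_pow, ← pow_mul, ← pow_succ, sq, mul_assoc] at h3
      exact le_of_mul_le_mul_left h3 hx
  obtain ⟨k, hk⟩ := pow_unbounded_of_one_lt (C / ‖x‖) hr1
  have h1 : r ^ k ≤ r ^ 2 ^ k := pow_le_pow_right₀ hr1.le Nat.lt_two_pow_self.le
  have h2 := (key k).trans (hC _ (hpow _).2)
  rw [div_lt_iff₀ hx] at hk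
  nlinarith

/-- The squared norm is ⟪Γ(b'b)x, x⟫, where Γ(b'b) is the second quantization of b'b, a self-adjoint
linear contraction, so `norm_map_le` applies. -/
lemma norm_antiMap_le {b b' : E →ₗ⋆[ℂ] E} (hb : ∀ p q, ⟪b p, q⟫_ℂ = ⟪b' q, p⟫_ℂ)
    (hn : ∀ p, ‖b p‖ ≤ ‖p‖) (hn' : ∀ p, ‖b' p‖ ≤ ‖p‖) (x : ExteriorAlgebra ℂ E) :
    ‖antiMap b x‖ ≤ ‖x‖ := by
  have h : ⟪antiMap b x, antiMap b x⟫_ℂ = ⟪map (b' ∘ₛₗ b) x, x⟫_ℂ := by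
    rw [inner_def, inner_def, ← antiMap_antiMap b b' (b' ∘ₛₗ b) (fun _ => rfl)]
    have h1 : ∀ (c : E →ₗ⋆[ℂ] E) (z : ExteriorAlgebra ℂ E),
        AntiRel {w : E × E | w.2 = c w.1} z (antiMap c z) := fun c z => by
      simpa using AntiRel.of_antiMap (G := {w : E × E | w.2 = c w.1}) (f := LinearMap.id)
        (g := LinearMap.id) (b := c) (fun _ => rfl) z
    refine (h1 b x).form_eq ?_ (h1 b' (antiMap b x))
    intro p p' r r' hp hr
    rw [show p' = b p from hp, show r' = b' r from hr, hb]
  have h1 := norm_inner_le_norm (𝕜 := ℂ) (map (b' ∘ₛₗ b) x) x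
  rw [← h, inner_self_eq_norm_sq_to_K] at h1
  have h2 : ‖map (b' ∘ₛₗ b) x‖ ≤ ‖x‖ := by
    refine norm_map_le (fun p q => ?_) (fun p => (hn' _).trans (hn p)) x
    rw [LinearMap.comp_apply, LinearMap.comp_apply, ← hb, ← inner_conj_symm p, ← hb,
      inner_conj_symm]
  have h3 : ‖antiMap b x‖ ^ 2 ≤ ‖map (b' ∘ₛₗ b) x‖ * ‖x‖ := by simpa using h1
  refine le_of_sq_le_sq (h3.trans ?_) (norm_nonneg _)
  rw [sq]
  exact mul_le_mul_of_nonneg_right h2 (norm_nonneg _)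

/-! ### The particle number grading of the Fock space -/

lemma list_span_induction {C : ExteriorAlgebra ℂ E → Prop}
    (add : ∀ x y, C x → C y → C (x + y)) (smul : ∀ (c : ℂ) x, C x → C (c • x))
    (list : ∀ l : List E, C (l.map (ι ℂ)).prod) (x : ExteriorAlgebra ℂ E) : C x := by
  suffices ∀ l : List E, C ((l.map (ι ℂ)).prod * x) by simpa using this []
  induction x using left_induction with
  | one => intro l; simpa using list l
  | smul c x h => intro l; rw [mul_smul_comm]; exact smul c _ (h l)
  | add x y hx hy => intro l; rw [mul_add]; exact add _ _ (hx l) (hy l)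
  | mul p x h => intro l; simpa [mul_assoc] using h (l ++ [p])

lemma map_smul_list (t : ℂ) (A : E →ₗ[ℂ] E) (l : List E) :
    map (t • A) (l.map (ι ℂ)).prod = t ^ l.length • map A (l.map (ι ℂ)).prod := by
  induction l with
  | nil => simp
  | cons p l ih =>
    rw [List.map_cons, List.prod_cons, map_ι_mul, map_ι_mul, ih, LinearMap.smul_apply, map_smul,
      smul_mul_smul_comm, List.length_cons, pow_succ']

lemma form_list_eq_zero {l m : List E} (h : l.length ≠ m.length) :
    form (l.map (ι ℂ)).prod (m.map (ι ℂ)).prod = 0 := by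
  -- The second quantization of the scalar 2 is symmetric and multiplies a product of m vectors by
  -- 2^m, so a nonzero inner product forces equal lengths.
  have h1 := form_map (A := (2 : ℂ) • (LinearMap.id : E →ₗ[ℂ] E)) (B := (2 : ℂ) • LinearMap.id)
    (fun p q => by simp [mul_comm]) (l.map (ι ℂ)).prod (m.map (ι ℂ)).prod
  rw [map_smul_list, map_smul_list, map_id, form_smul_left, form_smul_right] at h1
  by_contra h0
  have h2 := mul_right_cancel₀ h0 h1
  simp only [star_pow, star_ofNat] at h2
  exact h (Nat.pow_right_injective (le_refl 2) (by exact_mod_cast h2))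

lemma coe_list_mem_nParticle (l : List E) :
    (((l.map (ι ℂ)).prod : ExteriorAlgebra ℂ E) : Fock E) ∈ nParticle E l.length := by
  refine Submodule.le_topologicalClosure _ (Submodule.subset_span ⟨l.get, ?_⟩)
  change ((ιMulti ℂ l.length l.get : ExteriorAlgebra ℂ E) : Fock E) = _
  rw [ιMulti_apply]
  congr 2
  exact List.map_ofFn.symm.trans (by rw [List.ofFn_get])

lemma wedge_eq_list {n : ℕ} (p : Fin n → E) :
    wedge p = ((((List.ofFn p).map (ι ℂ)).prod : ExteriorAlgebra ℂ E) : Fock E) := by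
  rw [List.map_ofFn]
  change ((ιMulti ℂ n p : ExteriorAlgebra ℂ E) : Fock E) = _
  rw [ιMulti_apply]; rfl

lemma wedge_mem_nParticle {n : ℕ} (p : Fin n → E) : wedge p ∈ nParticle E n :=
  Submodule.le_topologicalClosure _ (Submodule.subset_span ⟨p, rfl⟩)

lemma isClosed_nParticle (n : ℕ) : IsClosed (nParticle E n : Set (Fock E)) :=
  Submodule.isClosed_topologicalClosure _

lemma nParticle_induction {n : ℕ} {C : Fock E → Prop} (hC : IsClosed {x | C x})
    (add : ∀ x y, C x → C y → C (x + y)) (smul : ∀ (c : ℂ) x, C x → C (c • x))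
    (wedge : ∀ p : Fin n → E, C (wedge p)) {x : Fock E} (hx : x ∈ nParticle E n) : C x := by
  have h0 : C 0 := by simpa using smul 0 _ (wedge 0)
  refine (closure_minimal (t := {x | C x}) ?_ hC) hx
  intro y hy
  refine Submodule.span_induction (p := fun y _ => C y) ?_ h0 (fun x y _ _ => add x y)
    (fun c x _ => smul c x) hy
  rintro _ ⟨p, rfl⟩
  exact wedge p

lemma inner_nParticle_eq_zero {n m : ℕ} (h : n ≠ m) {x y : Fock E} (hx : x ∈ nParticle E n)
    (hy : y ∈ nParticle E m) : ⟪x, y⟫_ℂ = 0 := by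
  refine nParticle_induction (C := fun x => ⟪x, y⟫_ℂ = 0)
    (isClosed_eq (by fun_prop) (by fun_prop)) (fun x y h h' => by rw [inner_add_left, h, h', add_zero])
    (fun c x h => by rw [inner_smul_left, h, mul_zero]) (fun p => ?_) hx
  refine nParticle_induction (C := fun y => ⟪_, y⟫_ℂ = 0)
    (isClosed_eq (by fun_prop) (by fun_prop)) (fun x y h h' => by rw [inner_add_right, h, h', add_zero])
    (fun c x h => by rw [inner_smul_right, h, mul_zero]) (fun q => ?_) hy
  rw [wedge_eq_list, wedge_eq_list, UniformSpace.Completion.inner_coe, inner_def]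
  exact form_list_eq_zero (by simpa using h)

lemma starProjection_nParticle_self {n : ℕ} {x : Fock E} (hx : x ∈ nParticle E n) :
    (nParticle E n).starProjection x = x :=
  Submodule.starProjection_eq_self_iff.mpr hx

lemma starProjection_nParticle_of_ne {n m : ℕ} (h : n ≠ m) {x : Fock E} (hx : x ∈ nParticle E m) :
    (nParticle E n).starProjection x = 0 :=
  (Submodule.starProjection_apply_eq_zero_iff _).mpr
    ((Submodule.mem_orthogonal _ _).mpr fun _ hy => inner_nParticle_eq_zero h hy hx)

lemma starProjection_nParticle_mem (n : ℕ) (x : Fock E) :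
    (nParticle E n).starProjection x ∈ nParticle E n :=
  Submodule.starProjection_apply_mem _ _

/-- Every vector is in the closed span of the products of one-particle vectors. -/
lemma fock_induction {C : Fock E → Prop} (hC : IsClosed {x | C x})
    (add : ∀ x y, C x → C y → C (x + y)) (smul : ∀ (c : ℂ) x, C x → C (c • x))
    (list : ∀ l : List E, C (((l.map (ι ℂ)).prod : ExteriorAlgebra ℂ E) : Fock E))
    (x : Fock E) : C x := by
  induction x using UniformSpace.Completion.induction_on with
  | hp => exact hC
  | ih x =>
    induction x using list_span_induction with
    | add x y hx hy => rw [UniformSpace.Completion.coe_add]; exact add _ _ hx hy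
    | smul c x hx => rw [UniformSpace.Completion.coe_smul]; exact smul _ _ hx
    | list l => exact list l

/-- Operators that preserve the `n`-particle subspaces commute with the projections onto them. -/
lemma starProjection_comm {σ : ℂ →+* ℂ} (T : Fock E →SL[σ] Fock E)
    (hT : ∀ n, ∀ x ∈ nParticle E n, T x ∈ nParticle E n) (n : ℕ) (x : Fock E) :
    (nParticle E n).starProjection (T x) = T ((nParticle E n).starProjection x) := by
  induction x using fock_induction with
  | hC => exact isClosed_eq (by fun_prop) (by fun_prop)
  | add x y hx hy => simp only [map_add, hx, hy]
  | smul c x hx => simp only [map_smulₛₗ, RingHom.id_apply, hx]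
  | list l =>
    have hl := coe_list_mem_nParticle l
    by_cases h : n = l.length
    · subst h
      rw [starProjection_nParticle_self hl, starProjection_nParticle_self (hT _ _ hl)]
    · rw [starProjection_nParticle_of_ne h hl, starProjection_nParticle_of_ne h (hT _ _ hl), map_zero]

lemma tendsto_of_dense {F : Type*} [NormedAddCommGroup F] [NormedSpace ℂ F] {T : ℕ → F →L[ℂ] F}
    (hT : ∀ n x, ‖T n x‖ ≤ ‖x‖) {D : Set F} (hD : Dense D)
    (h : ∀ x ∈ D, Filter.Tendsto (fun n => T n x) Filter.atTop (nhds x)) (x : F) :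
    Filter.Tendsto (fun n => T n x) Filter.atTop (nhds x) := by
  rw [Metric.tendsto_atTop]
  intro ε hε
  obtain ⟨y, hy, hxy⟩ := Metric.dense_iff.mp hD x (ε / 3) (by positivity)
  rw [Metric.mem_ball, dist_eq_norm, ] at hy
  obtain ⟨N, hN⟩ := Metric.tendsto_atTop.mp (h y hxy) (ε / 3) (by positivity)
  refine ⟨N, fun n hn => ?_⟩
  have h1 := hN n hn
  rw [dist_eq_norm] at h1 ⊢
  have h2 : T n x - x = (T n y - y) + (y - x) - T n (y - x) := by rw [map_sub]; abel
  have h3 := hT n (y - x)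
  rw [h2]
  calc _ ≤ ‖T n y - y‖ + ‖y - x‖ + ‖T n (y - x)‖ :=
        (norm_sub_le _ _).trans (add_le_add_left (norm_add_le _ _) _)
    _ < ε := by linarith

lemma tendsto_sum_starProjection (x : Fock E) :
    Filter.Tendsto (fun N => ∑ i ∈ Finset.range N, (nParticle E i).starProjection x)
      Filter.atTop (nhds x) := by
  let T : ℕ → Fock E →L[ℂ] Fock E := fun N => ∑ i ∈ Finset.range N, (nParticle E i).starProjection
  have hT : ∀ N y, T N y = ∑ i ∈ Finset.range N, (nParticle E i).starProjection y := fun N y => by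
    simp [T]
  have key := tendsto_of_dense (T := T) (fun N y => ?_) UniformSpace.Completion.denseRange_coe ?_ x
  · simpa only [hT] using key
  · have h1 : ⟪T N y, T N y⟫_ℂ = ⟪T N y, y⟫_ℂ := by
      rw [hT, sum_inner, sum_inner]
      refine Finset.sum_congr rfl fun i hi => ?_
      rw [inner_sum, Finset.sum_eq_single_of_mem i hi fun j _ hj => inner_nParticle_eq_zero hj.symm
        (starProjection_nParticle_mem i y) (starProjection_nParticle_mem j y),
        ← Submodule.inner_starProjection_left_eq_right,
        starProjection_nParticle_self (starProjection_nParticle_mem i y)]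
    have h2 := norm_inner_le_norm (𝕜 := ℂ) (T N y) y
    rw [← h1, inner_self_eq_norm_sq_to_K] at h2
    have h3 : ‖T N y‖ ^ 2 ≤ ‖T N y‖ * ‖y‖ := by simpa using h2
    by_contra! hlt
    nlinarith [norm_nonneg y]
  · rintro _ ⟨y, rfl⟩
    simp only [hT]
    induction y using list_span_induction with
    | add x y hx hy =>
      simp only [UniformSpace.Completion.coe_add, map_add, Finset.sum_add_distrib]; exact hx.add hy
    | smul c x hx =>
      simp only [UniformSpace.Completion.coe_smul, map_smul, ← Finset.smul_sum]
      exact hx.const_smul c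
    | list l =>
      have hl := coe_list_mem_nParticle l
      refine tendsto_atTop_of_eventually_const (i₀ := l.length + 1) fun N hN => ?_
      rw [Finset.sum_eq_single_of_mem l.length (Finset.mem_range.mpr (by omega))
        fun i _ hi => starProjection_nParticle_of_ne hi hl, starProjection_nParticle_self hl]

end

end FermiFock

end

noncomputable section

namespace OpGraph

/-! ### Graphs of unbounded operators -/

section

variable {E F : Type*} [NormedAddCommGroup E] [InnerProductSpace ℂ E]
  [NormedAddCommGroup F] [InnerProductSpace ℂ F]

/-- `G` is closed under addition and under the multiplication with scalars, where the scalars act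
on the second component through `σ`. -/
structure IsSemilinear (σ : ℂ →+* ℂ) (G : Set (E × F)) : Prop where
  add_mem : ∀ {x y x' y'}, (x, y) ∈ G → (x', y') ∈ G → (x + x', y + y') ∈ G
  smul_mem : ∀ (c : ℂ) {x y}, (x, y) ∈ G → (c • x, σ c • y) ∈ G

namespace IsSemilinear

variable {σ : ℂ →+* ℂ} {G : Set (E × F)}

lemma sub_mem (hG : IsSemilinear σ G) {x y x' y'} (h : (x, y) ∈ G) (h' : (x', y') ∈ G) :
    (x - x', y - y') ∈ G := by
  have := hG.add_mem h (hG.smul_mem (-1) h')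
  simpa [sub_eq_add_neg] using this

lemma zero_mem (hG : IsSemilinear σ G) (hne : G.Nonempty) : (0, 0) ∈ G := by
  obtain ⟨⟨x, y⟩, h⟩ := hne
  simpa using hG.smul_mem 0 h

lemma closure (hG : IsSemilinear (starRingEnd ℂ) G) : IsSemilinear (starRingEnd ℂ) (closure G) where
  add_mem {x y x' y'} h h' := by
    have := map_mem_closure₂ (f := fun a b : E × F => a + b) continuous_add h h'
      fun a ha b hb => hG.add_mem ha hb
    exact this
  smul_mem c {x y} h := by
    have := map_mem_closure (f := fun a : E × F => (c • a.1, starRingEnd ℂ c • a.2)) (by fun_prop) h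
      fun a ha => hG.smul_mem c ha
    exact this

end IsSemilinear

lemma isClosed_antiAdjoint (G : Set (E × F)) : IsClosed (antiAdjoint G) := by
  simp only [antiAdjoint, Set.ofPred_forall]
  exact isClosed_biInter fun v _ => isClosed_eq (by fun_prop) (by fun_prop)

lemma antiAdjoint_anti {G H : Set (E × F)} (h : G ⊆ H) : antiAdjoint H ⊆ antiAdjoint G :=
  fun _ hw v hv => hw v (h hv)

lemma antiAdjoint_closure (G : Set (E × F)) : antiAdjoint (closure G) = antiAdjoint G := by
  refine (antiAdjoint_anti subset_closure).antisymm fun w hw v hv => ?_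
  exact closure_minimal (s := G) (t := {v : E × F | ⟪v.2, w.1⟫_ℂ = ⟪w.2, v.1⟫_ℂ}) (fun v hv => hw v hv)
    (isClosed_eq (by fun_prop) (by fun_prop)) hv

lemma subset_antiAdjoint_comm {G : Set (E × F)} {H : Set (F × E)} (h : G ⊆ antiAdjoint H) :
    H ⊆ antiAdjoint G := fun w hw v hv => by
  exact (h hv w hw).symm

lemma isSemilinear_antiAdjoint (G : Set (E × F)) :
    IsSemilinear (starRingEnd ℂ) (antiAdjoint G) where
  add_mem {x y x' y'} h h' v hv := by
    rw [inner_add_right, inner_add_left, h v hv, h' v hv]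
  smul_mem c {x y} h v hv := by
    rw [inner_smul_right, inner_smul_left, h v hv, RingHomCompTriple.comp_apply]; rfl

/-- Closability: two values at the same vector differ by something orthogonal to the dense domain of
the formal adjoint. -/
lemma unique_of_subset_antiAdjoint {G : Set (E × F)} {H : Set (F × E)}
    (hG : IsSemilinear (starRingEnd ℂ) G) (h : G ⊆ antiAdjoint H)
    (hd : Dense {x | ∃ y, (x, y) ∈ H}) {x : E} {y y' : F} (h1 : (x, y) ∈ G) (h2 : (x, y') ∈ G) :
    y = y' := by
  have h3 := h (hG.sub_mem h1 h2)
  rw [sub_self] at h3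
  refine sub_eq_zero.mp (hd.eq_zero_of_inner_left ℂ fun v ⟨z, hz⟩ => ?_)
  rw [← h3 _ hz, inner_zero_right]

lemma RestrictsTo.closure {G : Set (E × E)} {V : Submodule ℂ E} [V.HasOrthogonalProjection]
    (h : RestrictsTo G V) : RestrictsTo (closure G) V := fun x y hxy =>
  map_mem_closure (f := fun a : E × E => (V.starProjection a.1, V.starProjection a.2)) (by fun_prop)
    hxy fun a ha => h _ _ ha

lemma RestrictsTo.antiAdjoint {G : Set (E × E)} {V : Submodule ℂ E} [V.HasOrthogonalProjection]
    (h : RestrictsTo G V) : RestrictsTo (antiAdjoint G) V := fun x y hxy v hv => by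
  have h1 := hxy _ (h _ _ hv)
  simp only at h1 ⊢
  rwa [← V.inner_starProjection_left_eq_right, V.inner_starProjection_left_eq_right y]

lemma RestrictsTo.comp {G H : Set (E × E)} {V : Submodule ℂ E} [V.HasOrthogonalProjection]
    (hG : RestrictsTo G V) (hH : RestrictsTo H V) : RestrictsTo (comp H G) V := by
  rintro x y ⟨z, hz, hz'⟩
  exact ⟨_, hG _ _ hz, hH _ _ hz'⟩

lemma isSemilinear_comp {G : Set (E × E)} {H : Set (E × E)} (hG : IsSemilinear (starRingEnd ℂ) G)
    (hH : IsSemilinear (starRingEnd ℂ) H) : IsSemilinear (RingHom.id ℂ) (comp H G) where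
  add_mem := by
    rintro x y x' y' ⟨z, h1, h2⟩ ⟨z', h1', h2'⟩
    exact ⟨z + z', hG.add_mem h1 h1', hH.add_mem h2 h2'⟩
  smul_mem := by
    rintro c x y ⟨z, h1, h2⟩
    refine ⟨starRingEnd ℂ c • z, hG.smul_mem c h1, ?_⟩
    simpa using hH.smul_mem (starRingEnd ℂ c) h2

/-- The operator `S^* S` is closed if `S` is closed. -/
lemma isClosed_comp_antiAdjoint [CompleteSpace E] {S : Set (E × E)} (hS : IsClosed S)
    (hl : IsSemilinear (starRingEnd ℂ) S) : IsClosed (OpGraph.comp (OpGraph.antiAdjoint S) S) := by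
  refine IsSeqClosed.isClosed fun w w₀ hw hlim => ?_
  choose z hz hz' using hw
  -- From ‖Sv‖² = ⟪S^*Sv, v⟫: convergence of v and S^*Sv makes the intermediate vectors Sv a Cauchy
  -- sequence.
  have key : ∀ m n, ‖z m - z n‖ ^ 2 ≤ ‖w m - w n‖ * ‖w m - w n‖ := fun m n => by
    have h1 := (isSemilinear_antiAdjoint S).sub_mem (hz' m) (hz' n) _ (hl.sub_mem (hz m) (hz n))
    have h2 := norm_inner_le_norm (𝕜 := ℂ) ((w m).2 - (w n).2) ((w m).1 - (w n).1)
    rw [← h1, inner_self_eq_norm_sq_to_K] at h2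
    have h3 : ‖z m - z n‖ ^ 2 ≤ ‖(w m).2 - (w n).2‖ * ‖(w m).1 - (w n).1‖ := by simpa using h2
    exact h3.trans (mul_le_mul (norm_snd_le (w m - w n)) (norm_fst_le (w m - w n))
      (norm_nonneg _) (norm_nonneg _))
  have hc : CauchySeq z := by
    rw [Metric.cauchySeq_iff]
    intro ε hε
    obtain ⟨N, hN⟩ := Metric.cauchySeq_iff.mp hlim.cauchySeq ε hε
    refine ⟨N, fun m hm n hn => ?_⟩
    have h1 := hN m hm n hn
    rw [dist_eq_norm] at h1 ⊢
    have h2 := key m n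
    rw [← sq] at h2
    exact (le_of_sq_le_sq h2 (norm_nonneg _)).trans_lt h1
  obtain ⟨z₀, hz₀⟩ := cauchySeq_tendsto_of_complete hc
  have h1 := (continuous_fst.tendsto _).comp hlim
  have h2 := (continuous_snd.tendsto _).comp hlim
  exact ⟨z₀, hS.mem_of_tendsto (h1.prodMk_nhds hz₀) (Filter.Eventually.of_forall hz),
    (isClosed_antiAdjoint S).mem_of_tendsto (hz₀.prodMk_nhds h2) (Filter.Eventually.of_forall hz')⟩

end

end OpGraph

namespace FermiFock

open ExteriorAlgebra OpGraph

/-! ### Second quantized operators on the Fock space -/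

section

variable {E : Type*} [NormedAddCommGroup E] [InnerProductSpace ℂ E]

/-- The extension of a contraction on the exterior algebra to the Fock space. -/
def fockExt {σ : ℂ →+* ℂ} (f : ExteriorAlgebra ℂ E →ₛₗ[σ] ExteriorAlgebra ℂ E) :
    Fock E →SL[σ] Fock E :=
  LinearMap.extendOfNorm
    ((UniformSpace.Completion.toComplL (𝕜 := ℂ) (E := ExteriorAlgebra ℂ E)).toLinearMap ∘ₛₗ f)
    (UniformSpace.Completion.toComplL (𝕜 := ℂ) (E := ExteriorAlgebra ℂ E)).toLinearMap

lemma fockExt_coe {σ : ℂ →+* ℂ} {f : ExteriorAlgebra ℂ E →ₛₗ[σ] ExteriorAlgebra ℂ E}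
    (hf : ∀ x, ‖f x‖ ≤ ‖x‖) (x : ExteriorAlgebra ℂ E) : fockExt f (x : Fock E) = (f x : Fock E) :=
  LinearMap.extendOfNorm_eq (f := _ ∘ₛₗ f) (e := _) UniformSpace.Completion.denseRange_coe
    ⟨1, fun x => by simpa using! hf x⟩ x

lemma norm_fockExt_le {σ : ℂ →+* ℂ} {f : ExteriorAlgebra ℂ E →ₛₗ[σ] ExteriorAlgebra ℂ E}
    (hf : ∀ x, ‖f x‖ ≤ ‖x‖) (x : Fock E) : ‖fockExt f x‖ ≤ ‖x‖ := by
  simpa using! LinearMap.norm_extendOfNorm_apply_le (f := _ ∘ₛₗ f)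
    (e := (UniformSpace.Completion.toComplL (𝕜 := ℂ) (E := ExteriorAlgebra ℂ E)).toLinearMap)
    UniformSpace.Completion.denseRange_coe 1 (fun x => by simpa using! hf x) x

lemma eq_of_coe {f g : Fock E → Fock E} (hf : Continuous f) (hg : Continuous g)
    (h : ∀ x : ExteriorAlgebra ℂ E, f x = g x) (x : Fock E) : f x = g x :=
  congrFun (UniformSpace.Completion.denseRange_coe.equalizer hf hg (funext h)) x

lemma reverse_ofFn {α : Type*} {n : ℕ} (f : Fin n → α) :
    (List.ofFn f).reverse = List.ofFn fun i => f i.rev := by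
  refine List.ext_getElem (by simp) fun i h1 h2 => ?_
  simp only [List.getElem_reverse, List.getElem_ofFn, List.length_ofFn]
  congr 1
  ext
  simp only [Fin.val_rev]
  omega

lemma antiMap_ιMulti (b : E →ₗ⋆[ℂ] E) {n : ℕ} (p : Fin n → E) :
    antiMap b (ιMulti ℂ n p) = ιMulti ℂ n fun i => b (p i.rev) := by
  have h : ∀ l : List E, antiMap b (l.map (ι ℂ)).prod = ((l.map b).reverse.map (ι ℂ)).prod := by
    intro l
    induction l with
    | nil => simp [antiMap_one]
    | cons p l ih => rw [List.map_cons, List.prod_cons, antiMap_ι_mul, ih]; simp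
  have h' : ∀ q : Fin n → E, ιMulti ℂ n q = ((List.ofFn q).map (ι ℂ)).prod := fun q => by
    rw [ιMulti_apply, List.map_ofFn]; rfl
  rw [h', h, List.map_ofFn, reverse_ofFn, h']; rfl

/-- The second quantization of a self-adjoint contraction. -/
def fockMap (A : E →ₗ[ℂ] E) : Fock E →L[ℂ] Fock E := fockExt (map A).toLinearMap

/-- The order-reversing second quantization of an antilinear contraction. -/
def fockAntiMap (b : E →ₗ⋆[ℂ] E) : Fock E →L⋆[ℂ] Fock E := fockExt (antiMap b)

section

variable {A : E →ₗ[ℂ] E} {b : E →ₗ⋆[ℂ] E}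

lemma fockMap_coe (hA : ∀ x : ExteriorAlgebra ℂ E, ‖map A x‖ ≤ ‖x‖) (x : ExteriorAlgebra ℂ E) :
    fockMap A (x : Fock E) = (map A x : ExteriorAlgebra ℂ E) :=
  fockExt_coe (f := (map A).toLinearMap) (fun x => hA x) x

lemma norm_fockMap_le (hA : ∀ x : ExteriorAlgebra ℂ E, ‖map A x‖ ≤ ‖x‖) (x : Fock E) :
    ‖fockMap A x‖ ≤ ‖x‖ :=
  norm_fockExt_le (f := (map A).toLinearMap) (fun x => hA x) x

lemma fockMap_wedge (hA : ∀ x : ExteriorAlgebra ℂ E, ‖map A x‖ ≤ ‖x‖) {n : ℕ}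
    (p : Fin n → E) : fockMap A (wedge p) = wedge fun i => A (p i) := by
  refine (fockMap_coe hA (ιMulti ℂ n p)).trans ?_
  rw [map_apply_ιMulti]; rfl

lemma fockAntiMap_coe (hb : ∀ x : ExteriorAlgebra ℂ E, ‖antiMap b x‖ ≤ ‖x‖)
    (x : ExteriorAlgebra ℂ E) : fockAntiMap b (x : Fock E) = (antiMap b x : ExteriorAlgebra ℂ E) :=
  fockExt_coe hb x

lemma fockAntiMap_wedge (hb : ∀ x : ExteriorAlgebra ℂ E, ‖antiMap b x‖ ≤ ‖x‖)
    {n : ℕ} (p : Fin n → E) : fockAntiMap b (wedge p) = wedge fun i => b (p i.rev) := by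
  refine (fockAntiMap_coe hb (ιMulti ℂ n p)).trans ?_
  rw [antiMap_ιMulti]; rfl

end

lemma wedge_smul {n : ℕ} (t : ℂ) (p : Fin n → E) : (wedge fun i => t • p i) = t ^ n • wedge p := by
  change ((ιMulti ℂ n _ : ExteriorAlgebra ℂ E) : Fock E) = _
  have := (ιMulti ℂ n (M := E)).map_smul_univ (fun _ => t) p
  rw [Finset.prod_const, Finset.card_univ, Fintype.card_fin] at this
  rw [this, UniformSpace.Completion.coe_smul]; rfl

lemma mapsTo_nParticle {σ : ℂ →+* ℂ} {T : Fock E →SL[σ] Fock E} {n : ℕ}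
    (h : ∀ p : Fin n → E, T (wedge p) ∈ nParticle E n) {x : Fock E} (hx : x ∈ nParticle E n) :
    T x ∈ nParticle E n := by
  refine nParticle_induction (C := fun x => T x ∈ nParticle E n)
    ((isClosed_nParticle n).preimage (by fun_prop)) (fun x y hx hy => ?_) (fun c x hx => ?_) h hx
  · rw [map_add]; exact add_mem hx hy
  · rw [map_smulₛₗ]; exact Submodule.smul_mem _ _ hx

/-- The graph of the second quantization of an antilinear operator, on the algebraic Fock space. -/
def antiFock (G : Set (E × E)) : Set (Fock E × Fock E) :=
  {w | ∃ x y : ExteriorAlgebra ℂ E, AntiRel G x y ∧ w = ((x : Fock E), (y : Fock E))}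

lemma isSemilinear_antiFock (G : Set (E × E)) : IsSemilinear (starRingEnd ℂ) (antiFock G) where
  add_mem := by
    rintro _ _ _ _ ⟨x, y, h, he⟩ ⟨x', y', h', he'⟩
    simp only [Prod.mk.injEq] at he he'
    obtain ⟨rfl, rfl⟩ := he
    obtain ⟨rfl, rfl⟩ := he'
    exact ⟨_, _, h.add h', by simp [UniformSpace.Completion.coe_add]⟩
  smul_mem := by
    rintro c _ _ ⟨x, y, h, he⟩
    simp only [Prod.mk.injEq] at he
    obtain ⟨rfl, rfl⟩ := he
    exact ⟨_, _, h.smul c, by simp [UniformSpace.Completion.coe_smul]⟩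

lemma antiFock_nonempty (G : Set (E × E)) : (antiFock G).Nonempty := ⟨_, _, _, .one, rfl⟩

/-- Induction over the closed span of the products of one-particle vectors. -/
lemma antiFock_induction {G : Set (E × E)} {N : Fock E → Fock E → Prop}
    (add : ∀ x y x' y', N x y → N x' y' → N (x + x') (y + y'))
    (smul : ∀ (c : ℂ) x y, N x y → N (c • x) (star c • y))
    (wedge : ∀ (n : ℕ) (p p' : Fin n → E), (∀ i, (p i, p' i) ∈ G) →
      N (wedge p) (FermiFock.wedge fun i => p' i.rev))
    {x y : Fock E} (h : (x, y) ∈ antiFock G) : N x y := by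
  obtain ⟨x, y, h, he⟩ := h
  simp only [Prod.mk.injEq] at he
  obtain ⟨rfl, rfl⟩ := he
  refine h.list_induction (N := fun x y => N (x : Fock E) (y : Fock E)) ?_ ?_ ?_
  · intro x y x' y' h h'
    simp only [UniformSpace.Completion.coe_add]; exact add _ _ _ _ h h'
  · intro c x y h
    simp only [UniformSpace.Completion.coe_smul]; exact smul _ _ _ h
  · intro l hl
    have h1 := wedge l.length (fun i => (l.get i).1) (fun i => (l.get i).2)
      fun i => hl _ (List.get_mem _ _)
    rw [wedge_eq_list, wedge_eq_list, ← reverse_ofFn (fun i => (l.get i).2)] at h1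
    have h2 : ∀ f : E × E → E, (List.ofFn fun i => f (l.get i)) = l.map f := fun f => by
      exact List.map_ofFn.symm.trans (by rw [List.ofFn_get])
    rw [h2 Prod.fst, h2 Prod.snd] at h1
    simpa [Function.comp_def] using h1

lemma wedge_mem_antiFock {G : Set (E × E)} {n : ℕ} {p p' : Fin n → E} (h : ∀ i, (p i, p' i) ∈ G) :
    (wedge p, wedge fun i => p' i.rev) ∈ antiFock G := by
  have := AntiRel.of_list (List.ofFn fun i => (p i, p' i)) (by simpa [List.mem_ofFn] using h)
  refine ⟨_, _, this, ?_⟩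
  rw [wedge_eq_list, wedge_eq_list, ← reverse_ofFn]
  simp [List.map_ofFn, Function.comp_def, List.map_reverse]

lemma antiFock_restrictsTo (G : Set (E × E)) (n : ℕ) : RestrictsTo (antiFock G) (nParticle E n) := by
  intro x y h
  refine antiFock_induction (N := fun x y => ((nParticle E n).starProjection x,
    (nParticle E n).starProjection y) ∈ antiFock G) ?_ ?_ ?_ h
  · intro x y x' y' h h'
    simp only [map_add]; exact (isSemilinear_antiFock G).add_mem h h'
  · intro c x y h
    simp only [map_smul]; exact (isSemilinear_antiFock G).smul_mem c h
  · intro m p p' h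
    by_cases hnm : n = m
    · subst hnm
      rw [starProjection_nParticle_self (wedge_mem_nParticle _),
        starProjection_nParticle_self (wedge_mem_nParticle _)]
      exact wedge_mem_antiFock h
    · rw [starProjection_nParticle_of_ne hnm (wedge_mem_nParticle _),
        starProjection_nParticle_of_ne hnm (wedge_mem_nParticle _)]
      exact (isSemilinear_antiFock G).zero_mem (antiFock_nonempty G)

lemma antiFock_subset_antiAdjoint {G H : Set (E × E)} (h : G ⊆ antiAdjoint H) :
    antiFock G ⊆ antiAdjoint (antiFock H) := by
  rintro _ ⟨x, y, hxy, rfl⟩ _ ⟨v, w, hvw, rfl⟩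
  simp only [UniformSpace.Completion.inner_coe, inner_def]
  exact hvw.form_eq (fun p p' r r' hp hr => h hr _ hp) hxy

lemma norm_oneParticle (p : E) : ‖oneParticle p‖ = ‖p‖ := by
  have h : ⟪ι ℂ p, ι ℂ p⟫_ℂ = ⟪p, p⟫_ℂ := by
    have h1 := contr_ι_mul p p 1
    rw [contr_one, mul_one, mul_zero, sub_zero] at h1
    have h2 := form_ι_mul_left p 1 (ι ℂ p)
    rw [mul_one, h1, form_smul_right, form_one_left, map_one, mul_one] at h2
    rw [inner_def, h2]
  rw [inner_self_eq_norm_sq_to_K, inner_self_eq_norm_sq_to_K] at h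
  have h' : ‖ι ℂ p‖ ^ 2 = ‖p‖ ^ 2 := by exact_mod_cast h
  change ‖((ι ℂ p : ExteriorAlgebra ℂ E) : Fock E)‖ = _
  rw [UniformSpace.Completion.norm_coe]
  exact (sq_eq_sq₀ (norm_nonneg _) (norm_nonneg _)).mp h'

/-- The embedding of the one-particle space into the Fock space. -/
def oneParticleₗᵢ : E →ₗᵢ[ℂ] Fock E where
  toFun := oneParticle
  map_add' p q := by
    change ((ι ℂ (p + q) : ExteriorAlgebra ℂ E) : Fock E) = _
    rw [map_add, UniformSpace.Completion.coe_add]; rfl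
  map_smul' c p := by
    change ((ι ℂ (c • p) : ExteriorAlgebra ℂ E) : Fock E) = _
    rw [map_smul, UniformSpace.Completion.coe_smul]; rfl
  norm_map' := norm_oneParticle

lemma wedge_one (p : Fin 1 → E) : wedge p = oneParticle (p 0) := by
  rw [wedge_eq_list]; simp [oneParticle]

lemma oneParticle_mem (p : E) : oneParticle p ∈ nParticle E 1 := by
  simpa [wedge_one] using wedge_mem_nParticle (fun _ : Fin 1 => p)

lemma isClosed_image_oneParticle [CompleteSpace E] {G : Set (E × E)} (hG : IsClosed G) :
    IsClosed ((fun w : E × E => (oneParticle w.1, oneParticle w.2)) '' G) := by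
  have h : Isometry (oneParticle : E → Fock E) := (oneParticleₗᵢ (E := E)).isometry
  exact (h.prodMap h).isClosedEmbedding.isClosedMap _ hG

/-- The one-particle projection sends the algebraic relation into the embedded graph G, which is
closed because the embedding is isometric; hence passing to the closure adds nothing in degree one.
-/
lemma restrict_closure_antiFock_one [CompleteSpace E] {G : Set (E × E)} (hG : IsClosed G)
    (hl : IsSemilinear (starRingEnd ℂ) G) (hne : G.Nonempty)
    (hu : ∀ {x y y'}, (x, y) ∈ closure (antiFock G) → (x, y') ∈ closure (antiFock G) → y = y') :
    restrict (closure (antiFock G)) (nParticle E 1) =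
      (fun w : E × E => (oneParticle w.1, oneParticle w.2)) '' G := by
  have h1 : ∀ x y, (x, y) ∈ antiFock G → ((nParticle E 1).starProjection x,
      (nParticle E 1).starProjection y) ∈ (fun w : E × E => (oneParticle w.1, oneParticle w.2)) '' G := by
    intro x y h
    refine antiFock_induction (N := fun x y => ((nParticle E 1).starProjection x,
      (nParticle E 1).starProjection y) ∈ (fun w : E × E => (oneParticle w.1, oneParticle w.2)) '' G)
      ?_ ?_ ?_ h
    · rintro x y x' y' ⟨⟨p, p'⟩, hp, he⟩ ⟨⟨q, q'⟩, hq, he'⟩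
      simp only [Prod.mk.injEq] at he he'
      refine ⟨_, hl.add_mem hp hq, ?_⟩
      rw [map_add, map_add, ← he.1, ← he.2, ← he'.1, ← he'.2]
      exact Prod.ext (map_add oneParticleₗᵢ _ _) (map_add oneParticleₗᵢ _ _)
    · rintro c x y ⟨⟨p, p'⟩, hp, he⟩
      simp only [Prod.mk.injEq] at he
      refine ⟨_, hl.smul_mem c hp, ?_⟩
      rw [map_smul, map_smul, ← he.1, ← he.2]
      exact Prod.ext (map_smul oneParticleₗᵢ _ _) (map_smul oneParticleₗᵢ _ _)
    · intro m p p' h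
      by_cases hm : 1 = m
      · subst hm
        rw [starProjection_nParticle_self (wedge_mem_nParticle _),
          starProjection_nParticle_self (wedge_mem_nParticle _), wedge_one, wedge_one]
        exact ⟨_, h 0, rfl⟩
      · rw [starProjection_nParticle_of_ne hm (wedge_mem_nParticle _),
          starProjection_nParticle_of_ne hm (wedge_mem_nParticle _)]
        exact ⟨_, hl.zero_mem hne, Prod.ext (map_zero oneParticleₗᵢ) (map_zero oneParticleₗᵢ)⟩
  refine Set.Subset.antisymm ?_ ?_
  · rintro ⟨x, y⟩ ⟨hxy, hx⟩
    have h2 : ((nParticle E 1).starProjection x, (nParticle E 1).starProjection y) ∈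
        (fun w : E × E => (oneParticle w.1, oneParticle w.2)) '' G := by
      have := map_mem_closure (f := fun a : Fock E × Fock E => ((nParticle E 1).starProjection a.1,
        (nParticle E 1).starProjection a.2)) (by fun_prop) hxy fun a ha => h1 _ _ ha
      rwa [(isClosed_image_oneParticle hG).closure_eq] at this
    have h3 := (antiFock_restrictsTo G 1).closure _ _ hxy
    rw [starProjection_nParticle_self hx] at h2 h3
    rwa [← hu hxy h3] at h2
  · rintro _ ⟨⟨p, p'⟩, hp, rfl⟩
    refine ⟨subset_closure ?_, oneParticle_mem p⟩
    have := wedge_mem_antiFock (p := fun _ : Fin 1 => p) (p' := fun _ => p') fun _ => hp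
    simpa only [wedge_one] using this

/-- An approximation of an n-particle pair by algebraic pairs can be projected to n particles, and
the projected approximants have their first components in D. -/
lemma restrict_closure_antiFock {G : Set (E × E)} {n : ℕ} {D : Set (Fock E)}
    (hD : D ⊆ nParticle E n)
    (hD' : ∀ x y, (x, y) ∈ antiFock G → (nParticle E n).starProjection x ∈ D)
    (hu : ∀ {x y y'}, (x, y) ∈ closure (antiFock G) → (x, y') ∈ closure (antiFock G) → y = y') :
    restrict (closure (antiFock G)) (nParticle E n) =
      closure (restrict (closure (antiFock G)) D) := by
  refine Set.Subset.antisymm ?_ ?_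
  · rintro ⟨x, y⟩ ⟨hxy, hx⟩
    have h3 := (antiFock_restrictsTo G n).closure _ _ hxy
    rw [starProjection_nParticle_self hx] at h3
    have h4 := map_mem_closure (f := fun a : Fock E × Fock E => ((nParticle E n).starProjection a.1,
        (nParticle E n).starProjection a.2)) (by fun_prop) hxy
        (t := restrict (closure (antiFock G)) D) fun a ha =>
        ⟨subset_closure (antiFock_restrictsTo G n _ _ ha), hD' _ _ ha⟩
    simpa only [starProjection_nParticle_self hx, hu h3 hxy] using h4
  · refine closure_minimal (fun w hw => ⟨hw.1, hD hw.2⟩) ?_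
    exact isClosed_closure.inter ((isClosed_nParticle n).preimage continuous_fst)

end

end FermiFock

end

noncomputable section

namespace FermiFock

open ExteriorAlgebra OpGraph

/-! ### Regularized pairs of antilinear operators and their second quantization -/

section

variable {E : Type*} [NormedAddCommGroup E] [InnerProductSpace ℂ E]

/-- A pair of formally adjoint antilinear operators, with graphs `G` and `H`, together with
self-adjoint contractions `e n`, converging strongly to `1`, whose compositions `g n` and `h n` with
the two operators are everywhere defined, bounded, and adjoint to each other. -/
structure Regularization (G H : Set (E × E)) (e : ℕ → E →L[ℂ] E) (g h : ℕ → E →L⋆[ℂ] E) :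
    Prop where
  linear : IsSemilinear (starRingEnd ℂ) G
  linear' : IsSemilinear (starRingEnd ℂ) H
  adjoint : G ⊆ antiAdjoint H
  symm : ∀ n p q, ⟪e n p, q⟫_ℂ = ⟪p, e n q⟫_ℂ
  norm_le : ∀ n p, ‖e n p‖ ≤ ‖p‖
  tendsto : ∀ p, Filter.Tendsto (fun n => e n p) Filter.atTop (nhds p)
  mem : ∀ n p, (e n p, g n p) ∈ G
  mem' : ∀ n p, (e n p, h n p) ∈ H
  inner_eq : ∀ n p q, ⟪g n p, q⟫_ℂ = ⟪h n q, p⟫_ℂ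

namespace Regularization

variable {G H : Set (E × E)} {e : ℕ → E →L[ℂ] E} {g h : ℕ → E →L⋆[ℂ] E}

lemma swap (R : Regularization G H e g h) : Regularization H G e h g where
  linear := R.linear'
  linear' := R.linear
  adjoint := subset_antiAdjoint_comm R.adjoint
  symm := R.symm
  norm_le := R.norm_le
  tendsto := R.tendsto
  mem := R.mem'
  mem' := R.mem
  inner_eq n p q := (R.inner_eq n q p).symm

/-- Testing against q uses formal adjointness with the pair (e n q, h n q) of H. Thus the cutoff may
be placed before or after the operator with graph G. -/
lemma apply_eq (R : Regularization G H e g h) (n : ℕ) {p p' : E} (hp : (p, p') ∈ G) :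
    g n p = e n p' := by
  refine ext_inner_right ℂ fun q => ?_
  rw [R.inner_eq, R.symm]
  exact (R.adjoint hp _ (R.mem' n q))

lemma norm_map_le (R : Regularization G H e g h) (n : ℕ) (x : ExteriorAlgebra ℂ E) :
    ‖map (e n).toLinearMap x‖ ≤ ‖x‖ :=
  FermiFock.norm_map_le (R.symm n) (R.norm_le n) x

/-- The second quantized cutoffs are uniformly bounded, so strong convergence need only be checked
on the algebraic Fock space, one factor at a time. -/
lemma tendsto_map (R : Regularization G H e g h) (x : Fock E) :
    Filter.Tendsto (fun n => fockMap (e n).toLinearMap x) Filter.atTop (nhds x) := by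
  refine tendsto_of_dense (fun n => norm_fockMap_le (R.norm_map_le n))
    UniformSpace.Completion.denseRange_coe ?_ x
  rintro _ ⟨x, rfl⟩
  simp_rw [fun n => fockMap_coe (R.norm_map_le n) x]
  refine (UniformSpace.Completion.continuous_coe _).tendsto x |>.comp ?_
  induction x using left_induction with
  | one => simp only [map_one]; exact tendsto_const_nhds
  | smul c x hx => simp only [map_smul]; exact hx.const_smul c
  | add x y hx hy => simp only [map_add]; exact hx.add hy
  | mul p x hx =>
    simp only [map_ι_mul]
    rw [tendsto_iff_norm_sub_tendsto_zero] at hx ⊢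
    have hp := tendsto_iff_norm_sub_tendsto_zero.mp (R.tendsto p)
    have h1 : Filter.Tendsto (fun n => ‖p‖ * ‖map (e n).toLinearMap x - x‖ + ‖e n p - p‖ * ‖x‖)
        Filter.atTop (nhds 0) := by
      simpa using (hx.const_mul ‖p‖).add (hp.mul_const ‖x‖)
    refine squeeze_zero (fun _ => norm_nonneg _) (fun n => ?_) h1
    have h2 : ι ℂ (e n p) * map (e n).toLinearMap x - ι ℂ p * x =
        ι ℂ (e n p) * (map (e n).toLinearMap x - x) + ι ℂ (e n p - p) * x := by
      rw [map_sub, mul_sub, sub_mul]; abel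
    change ‖ι ℂ (e n p) * map (e n).toLinearMap x - ι ℂ p * x‖ ≤ _
    rw [h2]
    refine (norm_add_le _ _).trans (add_le_add ((norm_ι_mul_le _ _).trans ?_) (norm_ι_mul_le _ _))
    exact mul_le_mul_of_nonneg_right (R.norm_le n p) (norm_nonneg _)

lemma tendsto_map_map (R : Regularization G H e g h) (x : Fock E) :
    Filter.Tendsto (fun n => fockMap (e n).toLinearMap (fockMap (e n).toLinearMap x))
      Filter.atTop (nhds x) := by
  rw [tendsto_iff_norm_sub_tendsto_zero]
  have h1 := tendsto_iff_norm_sub_tendsto_zero.mp (R.tendsto_map x)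
  refine squeeze_zero (fun _ => norm_nonneg _) (fun n => ?_) (by simpa using h1.add h1)
  rw [← sub_add_sub_cancel _ (fockMap (e n).toLinearMap x), ← map_sub]
  refine (norm_add_le _ _).trans (add_le_add_left (norm_fockMap_le (R.norm_map_le n) _) _)

lemma map_mem (R : Regularization G H e g h) (n : ℕ) (x : ExteriorAlgebra ℂ E) :
    AntiRel G (map (e n).toLinearMap x) (antiMap (g n).toLinearMap x) := by
  simpa using AntiRel.of_antiMap (G := G) (f := (e n).toLinearMap) (b := (g n).toLinearMap)
    (g := LinearMap.id) (R.mem n) x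

lemma dense (R : Regularization G H e g h) : Dense {x | ∃ y, (x, y) ∈ antiFock G} := by
  intro x
  refine mem_closure_of_tendsto (R.tendsto_map x) ?_ |> closure_closure.subset
  refine Filter.Eventually.of_forall fun n => ?_
  induction x using UniformSpace.Completion.induction_on with
  | hp => exact isClosed_closure.preimage (by fun_prop)
  | ih x =>
    rw [fockMap_coe (R.norm_map_le n)]
    exact subset_closure ⟨_, _, _, R.map_mem n x, rfl⟩

lemma unique (R : Regularization G H e g h) {x y y' : Fock E} (h1 : (x, y) ∈ closure (antiFock G))
    (h2 : (x, y') ∈ closure (antiFock G)) : y = y' :=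
  unique_of_subset_antiAdjoint (isSemilinear_antiFock G).closure
    (closure_minimal (antiFock_subset_antiAdjoint R.adjoint) (isClosed_antiAdjoint _)) R.swap.dense
    h1 h2

/-- A bounded operator of norm above one may have an unbounded second quantization. One positive
factor t makes all three operators contractions; on m particles it contributes t^m, which can be
divided out. -/
lemma exists_scale (e : ℕ → E →L[ℂ] E) (g h : ℕ → E →L⋆[ℂ] E) (n : ℕ) : ∃ t : ℝ, 0 < t ∧
    (∀ p, ‖(t : ℂ) • e n p‖ ≤ ‖p‖) ∧ (∀ p, ‖(t : ℂ) • g n p‖ ≤ ‖p‖) ∧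
    ∀ p, ‖(t : ℂ) • h n p‖ ≤ ‖p‖ := by
  have key : ∀ {σ : ℂ →+* ℂ} [RingHomIsometric σ] (f : E →SL[σ] E) (C : ℝ), ‖f‖ ≤ C → ∀ p,
      ‖(((1 + C)⁻¹ : ℝ) : ℂ) • f p‖ ≤ ‖p‖ := fun f C hC p => by
    have h0 : 0 < 1 + C := by linarith [norm_nonneg f]
    rw [norm_smul, Complex.norm_real, Real.norm_of_nonneg (by positivity), inv_mul_le_iff₀ h0]
    exact (f.le_opNorm p).trans (mul_le_mul_of_nonneg_right (by linarith) (norm_nonneg _))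
  have := norm_nonneg (e n)
  have := norm_nonneg (g n)
  have := norm_nonneg (h n)
  exact ⟨(1 + (‖e n‖ + ‖g n‖ + ‖h n‖))⁻¹, by positivity, key _ _ (by linarith),
    key _ _ (by linarith), key _ _ (by linarith)⟩

/-- The bounded operators obtained by second quantization of the scaled bounded operators. -/
structure Scaled (e₀ : E →ₗ[ℂ] E) (g₀ h₀ : E →ₗ⋆[ℂ] E) (G H : Set (E × E)) : Prop where
  symm : ∀ p q, ⟪e₀ p, q⟫_ℂ = ⟪p, e₀ q⟫_ℂ
  norm_le : ∀ p, ‖e₀ p‖ ≤ ‖p‖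
  norm_le_left : ∀ p, ‖g₀ p‖ ≤ ‖p‖
  norm_le_right : ∀ p, ‖h₀ p‖ ≤ ‖p‖
  inner_eq : ∀ p q, ⟪g₀ p, q⟫_ℂ = ⟪h₀ q, p⟫_ℂ
  mem : ∀ p, (e₀ p, g₀ p) ∈ G
  mem' : ∀ p, (e₀ p, h₀ p) ∈ H
  comm : ∀ p, h₀ (e₀ p) = e₀ (h₀ p)

lemma scaled (R : Regularization G H e g h) (n : ℕ) {t : ℝ}
    (h1 : ∀ p, ‖(t : ℂ) • e n p‖ ≤ ‖p‖) (h2 : ∀ p, ‖(t : ℂ) • g n p‖ ≤ ‖p‖)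
    (h3 : ∀ p, ‖(t : ℂ) • h n p‖ ≤ ‖p‖) :
    Scaled ((t : ℂ) • (e n).toLinearMap) ((t : ℂ) • (g n).toLinearMap)
      ((t : ℂ) • (h n).toLinearMap) G H where
  symm p q := by
    simp [R.symm n p q]
  norm_le := h1
  norm_le_left := h2
  norm_le_right := h3
  inner_eq p q := by simp [R.inner_eq n p q]
  mem p := by simpa using R.linear.smul_mem (t : ℂ) (R.mem n p)
  mem' p := by simpa using R.linear'.smul_mem (t : ℂ) (R.mem' n p)
  comm p := by
    change (t : ℂ) • h n ((t : ℂ) • e n p) = (t : ℂ) • e n ((t : ℂ) • h n p)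
    rw [map_smulₛₗ, map_smul, Complex.conj_ofReal, R.swap.apply_eq n (R.mem' n p)]

section

variable {e₀ : E →ₗ[ℂ] E} {g₀ h₀ : E →ₗ⋆[ℂ] E}

lemma Scaled.map_coe (R : Scaled e₀ g₀ h₀ G H) (x : ExteriorAlgebra ℂ E) :
    fockMap e₀ (x : Fock E) = (map e₀ x : ExteriorAlgebra ℂ E) :=
  fockMap_coe (fun x => FermiFock.norm_map_le R.symm R.norm_le x) x

lemma Scaled.left_coe (R : Scaled e₀ g₀ h₀ G H) (x : ExteriorAlgebra ℂ E) :
    fockAntiMap g₀ (x : Fock E) = (antiMap g₀ x : ExteriorAlgebra ℂ E) :=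
  fockAntiMap_coe (fun x => norm_antiMap_le R.inner_eq R.norm_le_left R.norm_le_right x) x

lemma Scaled.right_coe (R : Scaled e₀ g₀ h₀ G H) (x : ExteriorAlgebra ℂ E) :
    fockAntiMap h₀ (x : Fock E) = (antiMap h₀ x : ExteriorAlgebra ℂ E) :=
  fockAntiMap_coe (fun x => norm_antiMap_le (fun p q => (R.inner_eq q p).symm) R.norm_le_right
    R.norm_le_left x) x

lemma Scaled.mem_closure (R : Scaled e₀ g₀ h₀ G H) (x : Fock E) :
    (fockMap e₀ x, fockAntiMap g₀ x) ∈ closure (antiFock G) := by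
  induction x using UniformSpace.Completion.induction_on with
  | hp => exact isClosed_closure.preimage (by fun_prop)
  | ih x =>
    rw [R.map_coe, R.left_coe]
    refine subset_closure ⟨_, _, ?_, rfl⟩
    simpa using AntiRel.of_antiMap (G := G) (f := e₀) (b := g₀) (g := LinearMap.id) R.mem x

lemma Scaled.mem_closure' (R : Scaled e₀ g₀ h₀ G H) (x : Fock E) :
    (fockMap e₀ x, fockAntiMap h₀ x) ∈ closure (antiFock H) := by
  induction x using UniformSpace.Completion.induction_on with
  | hp => exact isClosed_closure.preimage (by fun_prop)
  | ih x =>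
    rw [R.map_coe, R.right_coe]
    refine subset_closure ⟨_, _, ?_, rfl⟩
    simpa using AntiRel.of_antiMap (G := H) (f := e₀) (b := h₀) (g := LinearMap.id) R.mem' x

lemma Scaled.inner_map (R : Scaled e₀ g₀ h₀ G H) (x y : Fock E) :
    ⟪fockMap e₀ x, y⟫_ℂ = ⟪x, fockMap e₀ y⟫_ℂ := by
  induction x, y using UniformSpace.Completion.induction_on₂ with
  | hp => exact isClosed_eq (by fun_prop) (by fun_prop)
  | ih x y =>
    rw [R.map_coe, R.map_coe, UniformSpace.Completion.inner_coe, UniformSpace.Completion.inner_coe]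
    exact form_map R.symm x y

lemma Scaled.inner_antiMap (R : Scaled e₀ g₀ h₀ G H) (x y : Fock E) :
    ⟪fockAntiMap g₀ x, y⟫_ℂ = ⟪fockAntiMap h₀ y, x⟫_ℂ := by
  induction x, y using UniformSpace.Completion.induction_on₂ with
  | hp => exact isClosed_eq (by fun_prop) (by fun_prop)
  | ih x y =>
    rw [R.left_coe, R.right_coe, UniformSpace.Completion.inner_coe, UniformSpace.Completion.inner_coe]
    have h1 : ∀ (c : E →ₗ⋆[ℂ] E) (z : ExteriorAlgebra ℂ E),
        AntiRel {w : E × E | w.2 = c w.1} z (antiMap c z) := fun c z => by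
      simpa using AntiRel.of_antiMap (G := {w : E × E | w.2 = c w.1}) (f := LinearMap.id)
        (g := LinearMap.id) (b := c) (fun _ => rfl) z
    refine (h1 g₀ x).form_eq (fun p p' r r' hp hr => ?_) (h1 h₀ y)
    rw [show p' = g₀ p from hp, show r' = h₀ r from hr, R.inner_eq]

/-- The Fock space counterpart of `Regularization.apply_eq`, valid on the whole adjoint of `antiFock
H`. This is what brings an arbitrary pair of the adjoint into the closure of `antiFock G`. -/
lemma Scaled.apply_eq (R : Scaled e₀ g₀ h₀ G H) {x y : Fock E}
    (hxy : (x, y) ∈ antiAdjoint (antiFock H)) :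
    fockAntiMap g₀ x = fockMap e₀ y := by
  refine ext_inner_right ℂ fun v => ?_
  rw [R.inner_antiMap, R.inner_map]
  rw [← antiAdjoint_closure] at hxy
  exact hxy _ (R.mem_closure' v)

lemma Scaled.comm_apply (R : Scaled e₀ g₀ h₀ G H) (x : Fock E) :
    fockAntiMap h₀ (fockMap e₀ x) =
      fockMap e₀ (fockAntiMap h₀ x) := by
  induction x using UniformSpace.Completion.induction_on with
  | hp => exact isClosed_eq (by fun_prop) (by fun_prop)
  | ih x =>
    rw [R.map_coe, R.right_coe, R.right_coe, R.map_coe]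
    congr 1
    induction x using left_induction with
    | one => simp [antiMap_one]
    | smul c x hx => simp only [map_smul, LinearMap.map_smulₛₗ, hx]
    | add x y hx hy => simp only [map_add, hx, hy]
    | mul p x hx => rw [map_ι_mul, antiMap_ι_mul, antiMap_ι_mul, map_mul, map_apply_ι, hx, R.comm]

end

lemma map_scale (R : Regularization G H e g h) (n : ℕ) {t : ℝ} (h1 : ∀ p, ‖(t : ℂ) • e n p‖ ≤ ‖p‖)
    {m : ℕ} {x : Fock E} (hx : x ∈ nParticle E m) :
    fockMap ((t : ℂ) • (e n).toLinearMap) x =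
      (t : ℂ) ^ m • fockMap (e n).toLinearMap x := by
  refine nParticle_induction (C := fun x => fockMap ((t : ℂ) • (e n).toLinearMap) x =
      (t : ℂ) ^ m • fockMap (e n).toLinearMap x)
    (isClosed_eq (fockMap _).continuous ((continuous_const_smul ((t : ℂ) ^ m)).comp
      (fockMap (e n).toLinearMap).continuous))
    (fun x y hx hy => ?_) (fun c x hx => ?_) (fun p => ?_) hx
  · rw [map_add, map_add, hx, hy, smul_add]
  · rw [map_smul, map_smul, hx, smul_comm]
  · rw [fockMap_wedge (R.norm_map_le n), fockMap_wedge, ← wedge_smul]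
    · rfl
    · refine FermiFock.norm_map_le (fun p q => ?_) h1
      simp [R.symm n p q]

lemma map_mem_nParticle (R : Regularization G H e g h) (n : ℕ) {m : ℕ} {x : Fock E}
    (hx : x ∈ nParticle E m) : fockMap (e n).toLinearMap x ∈ nParticle E m :=
  mapsTo_nParticle (fun p => by
    rw [fockMap_wedge (R.norm_map_le n)]; exact wedge_mem_nParticle _) hx

/-- The scaled cutoff moves the pair into the closure of `antiFock G`. Both components have degree
m, so the same factor t^m cancels from them, and the unscaled cutoffs converge to the pair. -/
lemma mem_closure_of_nParticle (R : Regularization G H e g h) {m : ℕ} {x y : Fock E}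
    (hx : x ∈ nParticle E m) (hy : y ∈ nParticle E m) (hxy : (x, y) ∈ antiAdjoint (antiFock H)) :
    (x, y) ∈ closure (antiFock G) := by
  refine isClosed_closure.mem_of_tendsto ((R.tendsto_map x).prodMk_nhds (R.tendsto_map y))
    (Filter.Eventually.of_forall fun n => ?_)
  obtain ⟨t, ht, h1, h2, h3⟩ := exists_scale e g h n
  have h4 := (R.scaled n h1 h2 h3).mem_closure x
  rw [(R.scaled n h1 h2 h3).apply_eq hxy, R.map_scale n h1 hx, R.map_scale n h1 hy] at h4
  have h5 := (isSemilinear_antiFock G).closure.smul_mem ((t : ℂ) ^ m)⁻¹ h4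
  have ht' : (t : ℂ) ^ m ≠ 0 := pow_ne_zero _ (by exact_mod_cast ht.ne')
  rw [inv_smul_smul₀ ht'] at h5
  have h6 : starRingEnd ℂ ((t : ℂ) ^ m)⁻¹ = ((t : ℂ) ^ m)⁻¹ := by simp
  rwa [h6, inv_smul_smul₀ ht'] at h5

/-- The adjoint of the second quantization is the closure of the second quantization of the formal
adjoint. -/
theorem antiAdjoint_eq (R : Regularization G H e g h) :
    antiAdjoint (antiFock H) = closure (antiFock G) := by
  refine Set.Subset.antisymm ?_
    (closure_minimal (antiFock_subset_antiAdjoint R.adjoint) (isClosed_antiAdjoint _))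
  rintro ⟨x, y⟩ hxy
  -- The factor t^m depends on the degree, so the pair is cut down to finitely many particle
  -- numbers, where each component can be treated separately.
  refine isClosed_closure.mem_of_tendsto
    ((tendsto_sum_starProjection x).prodMk_nhds (tendsto_sum_starProjection y))
    (Filter.Eventually.of_forall fun N => ?_)
  induction N with
  | zero =>
    simpa using (isSemilinear_antiFock G).closure.zero_mem ((antiFock_nonempty G).mono subset_closure)
  | succ N ih =>
    rw [Finset.sum_range_succ, Finset.sum_range_succ]
    refine (isSemilinear_antiFock G).closure.add_mem ih (R.mem_closure_of_nParticle
      (starProjection_nParticle_mem _ _) (starProjection_nParticle_mem _ _)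
      ((antiFock_restrictsTo H N).antiAdjoint _ _ hxy))

/-! #### The composition of the two second quantized operators -/

lemma comp_eq (R : Regularization G H e g h) :
    comp (closure (antiFock H)) (closure (antiFock G)) =
      comp (antiAdjoint (closure (antiFock G))) (closure (antiFock G)) := by
  rw [antiAdjoint_closure, R.swap.antiAdjoint_eq]

lemma isDenselyDefined (R : Regularization G H e g h) :
    IsDenselyDefined (starRingEnd ℂ) (closure (antiFock G)) where
  add_mem := (isSemilinear_antiFock G).closure.add_mem
  smul_mem := (isSemilinear_antiFock G).closure.smul_mem
  unique := R.unique
  dense := R.dense.mono fun x hx => hx.imp fun y hy => subset_closure hy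

lemma isDenselyDefined_comp (R : Regularization G H e g h) :
    IsDenselyDefined (RingHom.id ℂ) (comp (closure (antiFock H)) (closure (antiFock G))) where
  add_mem := (isSemilinear_comp (isSemilinear_antiFock G).closure
    (isSemilinear_antiFock H).closure).add_mem
  smul_mem := (isSemilinear_comp (isSemilinear_antiFock G).closure
    (isSemilinear_antiFock H).closure).smul_mem
  unique {_ _ _} := by
    rintro ⟨z, h1, h2⟩ ⟨z', h1', h2'⟩
    rw [R.unique h1 h1'] at h2
    exact R.swap.unique h2 h2'
  dense := by
    -- One cutoff is spent on each operator: the first operator sends e e x to g e x = e g x, which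
    -- lies in the domain of the second and is sent to h g x.
    have key : ∀ n (x : ExteriorAlgebra ℂ E), ∃ y : Fock E, (((map (e n).toLinearMap
        (map (e n).toLinearMap x) : ExteriorAlgebra ℂ E) : Fock E), y) ∈
        comp (closure (antiFock H)) (closure (antiFock G)) := fun n x => by
      have hH : AntiRel H (antiMap (g n).toLinearMap (map (e n).toLinearMap x))
          (antiMap (h n).toLinearMap (antiMap (g n).toLinearMap x)) := by
        rw [(R.map_mem n x).antiMap_eq (f := (e n).toLinearMap) fun p p' hp => R.apply_eq n hp]
        exact R.swap.map_mem n _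
      exact ⟨((antiMap (h n).toLinearMap (antiMap (g n).toLinearMap x) : ExteriorAlgebra ℂ E) :
        Fock E), _, subset_closure ⟨_, _, R.map_mem n _, rfl⟩, subset_closure ⟨_, _, hH, rfl⟩⟩
    intro x
    refine mem_closure_of_tendsto (R.tendsto_map_map x) ?_ |> closure_closure.subset
    refine Filter.Eventually.of_forall fun n => ?_
    induction x using UniformSpace.Completion.induction_on with
    | hp => exact isClosed_closure.preimage (by fun_prop)
    | ih x =>
      rw [fockMap_coe (R.norm_map_le n),
        fockMap_coe (R.norm_map_le n)]
      exact subset_closure (key n x)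

lemma wedge_mem_comp {n : ℕ} {p p' : Fin n → E} (hp : ∀ i, (p i, p' i) ∈ comp H G) :
    (wedge p, wedge p') ∈ comp (closure (antiFock H)) (closure (antiFock G)) := by
  choose z hz hz' using hp
  refine ⟨_, subset_closure (wedge_mem_antiFock hz), subset_closure ?_⟩
  simpa using wedge_mem_antiFock (G := H) (p := fun i => z i.rev) (p' := fun i => p' i.rev)
    fun i => hz' i.rev

/-- The linear span of the pairs `(p₁ ∧ … ∧ pₙ, p₁' ∧ … ∧ pₙ')` with `(pᵢ, pᵢ')` in `D`. -/
abbrev _root_.FermiFock.wedgeSpan (D : Set (E × E)) (n : ℕ) : Submodule ℂ (Fock E × Fock E) :=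
  Submodule.span ℂ {w | ∃ p p' : Fin n → E, (∀ i, (p i, p' i) ∈ D) ∧ w = (wedge p, wedge p')}

/-- The doubly cut off pair coincides, up to scaling, with (e e x, h g x). This is bounded in x, so
membership in the closed span can be checked on wedge products, where it is a one-particle
statement. -/
lemma mem_closure_wedgeSpan (R : Regularization G H e g h) {m : ℕ} {x y : Fock E}
    (hx : x ∈ nParticle E m) (hy : y ∈ nParticle E m)
    (hxy : (x, y) ∈ comp (closure (antiFock H)) (closure (antiFock G))) :
    (x, y) ∈ closure (wedgeSpan (comp H G) m : Set (Fock E × Fock E)) := by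
  obtain ⟨z, hz, hz'⟩ := hxy
  simp only at hz hz'
  let D := (wedgeSpan (comp H G) m).topologicalClosure
  have key : ∀ n, (fockMap (e n).toLinearMap
      (fockMap (e n).toLinearMap x), fockMap (e n).toLinearMap
      (fockMap (e n).toLinearMap y)) ∈ D := fun n => by
    obtain ⟨t, ht, h1, h2, h3⟩ := exists_scale e g h n
    have S := R.scaled n h1 h2 h3
    have S' := R.swap.scaled n h1 h3 h2
    have h4 : ∀ u ∈ nParticle E m,
        (fockMap ((t : ℂ) • (e n).toLinearMap)
          (fockMap ((t : ℂ) • (e n).toLinearMap) u),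
        fockAntiMap ((t : ℂ) • (h n).toLinearMap)
          (fockAntiMap ((t : ℂ) • (g n).toLinearMap) u)) ∈ D := fun u hu => by
      refine nParticle_induction (C := fun u => (fockMap ((t : ℂ) • (e n).toLinearMap)
          (fockMap ((t : ℂ) • (e n).toLinearMap) u),
        fockAntiMap ((t : ℂ) • (h n).toLinearMap)
          (fockAntiMap ((t : ℂ) • (g n).toLinearMap) u)) ∈ D) ?_ ?_ ?_ ?_ hu
      · exact (Submodule.isClosed_topologicalClosure _).preimage (by fun_prop)
      · intro u v hu hv
        simp only [map_add]
        exact add_mem hu hv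
      · intro c u hu
        have := D.smul_mem c hu
        simpa only [map_smul, map_smulₛₗ, RingHomCompTriple.comp_apply, RingHom.id_apply,
          Prod.smul_mk, Complex.conj_conj] using this
      · intro p
        have hE : ∀ x : ExteriorAlgebra ℂ E, ‖map ((t : ℂ) • (e n).toLinearMap) x‖ ≤ ‖x‖ :=
          fun x => FermiFock.norm_map_le S.symm S.norm_le x
        rw [fockMap_wedge hE, fockMap_wedge hE,
          fockAntiMap_wedge (fun x => norm_antiMap_le S.inner_eq S.norm_le_left S.norm_le_right x),
          fockAntiMap_wedge (fun x => norm_antiMap_le S'.inner_eq S'.norm_le_left S'.norm_le_right x)]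
        refine Submodule.le_topologicalClosure _ (Submodule.subset_span ⟨_, _, fun i => ?_, rfl⟩)
        rw [Fin.rev_rev]
        refine ⟨((t : ℂ) • (g n).toLinearMap) (((t : ℂ) • (e n).toLinearMap) (p i)), S.mem _, ?_⟩
        simp only
        rw [S'.comm]
        exact S'.mem _
    have h5 := h4 x hx
    have hz1 : (x, z) ∈ antiAdjoint (antiFock H) := by rwa [R.antiAdjoint_eq]
    have hz2 : (z, y) ∈ antiAdjoint (antiFock G) := by rwa [R.swap.antiAdjoint_eq]
    -- On Fock space h g x = h e z = e h z = e e y, where z is the intermediate vector and e, g, h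
    -- stand for the scaled second quantizations.
    rw [S.apply_eq hz1, S.comm_apply, S'.apply_eq hz2] at h5
    have h6 : ∀ u ∈ nParticle E m, fockMap ((t : ℂ) • (e n).toLinearMap)
        (fockMap ((t : ℂ) • (e n).toLinearMap) u) = (t : ℂ) ^ m • (t : ℂ) ^ m •
        fockMap (e n).toLinearMap (fockMap (e n).toLinearMap u) :=
      fun u hu => by
        rw [R.map_scale n h1 hu, map_smul, R.map_scale n h1 (R.map_mem_nParticle n hu)]
    rw [h6 x hx, h6 y hy, ← Prod.smul_mk, ← Prod.smul_mk] at h5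
    have ht' : (t : ℂ) ^ m ≠ 0 := pow_ne_zero _ (by exact_mod_cast ht.ne')
    rwa [Submodule.smul_mem_iff _ ht', Submodule.smul_mem_iff _ ht'] at h5
  exact (Submodule.isClosed_topologicalClosure _).mem_of_tendsto
    ((R.tendsto_map_map x).prodMk_nhds (R.tendsto_map_map y)) (Filter.Eventually.of_forall key)

lemma restrict_comp_eq (R : Regularization G H e g h) [CompleteSpace E] (m : ℕ) :
    restrict (comp (closure (antiFock H)) (closure (antiFock G))) (nParticle E m) =
      closure (wedgeSpan (comp H G) m) := by
  have hrestr : RestrictsTo (comp (closure (antiFock H)) (closure (antiFock G))) (nParticle E m) :=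
    (antiFock_restrictsTo G m).closure.comp (antiFock_restrictsTo H m).closure
  refine Set.Subset.antisymm ?_ ?_
  · rintro ⟨x, y⟩ ⟨hxy, hx⟩
    refine R.mem_closure_wedgeSpan hx ?_ hxy
    have h1 := hrestr _ _ hxy
    rw [starProjection_nParticle_self hx] at h1
    rw [R.isDenselyDefined_comp.unique hxy h1]
    exact starProjection_nParticle_mem _ _
  · refine closure_minimal (fun w hw => ?_) ?_
    · have hs := R.isDenselyDefined_comp
      refine Submodule.span_induction (p := fun w _ =>
        w ∈ restrict (comp (closure (antiFock H)) (closure (antiFock G))) (nParticle E m))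
        ?_ ?_ ?_ ?_ hw
      · rintro _ ⟨p, p', hp, rfl⟩
        exact ⟨wedge_mem_comp hp, wedge_mem_nParticle p⟩
      · refine ⟨?_, zero_mem (nParticle E m)⟩
        obtain ⟨x, y, hxy⟩ := hs.dense.nonempty
        have := hs.smul_mem 0 hxy
        rwa [map_zero, zero_smul, zero_smul] at this
      · rintro x y _ _ hx hy
        exact ⟨hs.add_mem hx.1 hy.1, add_mem (S := Submodule ℂ (Fock E)) hx.2 hy.2⟩
      · rintro c x _ hx
        exact ⟨hs.smul_mem c hx.1, Submodule.smul_mem (nParticle E m) c hx.2⟩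
    -- Written as S^*S, the composition is closed, so the closure of the wedge pairs stays inside
    -- it.
    · rw [R.comp_eq]
      exact (isClosed_comp_antiAdjoint isClosed_closure (isSemilinear_antiFock G).closure).inter
        ((isClosed_nParticle m).preimage continuous_fst)

end Regularization

end

end FermiFock

end

noncomputable section

namespace OpGraph

/-! ### Uniqueness of the polar decomposition -/

section

variable {E : Type*} [NormedAddCommGroup E] [InnerProductSpace ℂ E]

/-- A total, bounded and linear relation is the graph of a bounded operator. -/
lemma exists_clm_of_relation {F : Type*} [NormedAddCommGroup F] [NormedSpace ℂ F]
    (ρ : Submodule ℂ (E × F)) (htot : ∀ x, ∃ y, (x, y) ∈ ρ)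
    (hb : ∀ x y, (x, y) ∈ ρ → ‖y‖ ≤ ‖x‖) : ∃ T : E →L[ℂ] F, ∀ x, (x, T x) ∈ ρ := by
  choose T hT using htot
  have hu : ∀ {x y y'}, (x, y) ∈ ρ → (x, y') ∈ ρ → y = y' := fun {x y y'} h h' => by
    have h1 := ρ.sub_mem h h'
    have h2 := hb _ _ h1
    rw [sub_self, norm_zero] at h2
    exact sub_eq_zero.mp (norm_le_zero_iff.mp h2)
  refine ⟨LinearMap.mkContinuous
    { toFun := T
      map_add' := fun x y => hu (hT _) (ρ.add_mem (hT x) (hT y))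
      map_smul' := fun c x => hu (hT _) (ρ.smul_mem c (hT x)) } 1
    fun x => by simpa using hb _ _ (hT x), hT⟩

/-- The graph of a positive self-adjoint operator. -/
structure IsPositiveGraph (g : Submodule ℂ (E × E)) : Prop where
  mem_iff : ∀ x y, (x, y) ∈ g ↔ ∀ a b, (a, b) ∈ g → ⟪b, x⟫_ℂ = ⟪a, y⟫_ℂ
  nonneg : ∀ x y, (x, y) ∈ g → 0 ≤ (⟪x, y⟫_ℂ).re
  unique : ∀ y, (0, y) ∈ g → y = 0

lemma isPositiveGraph_graph [CompleteSpace E] {R : E →ₗ.[ℂ] E} (hR : IsSelfAdjoint R)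
    (hR' : ∀ x : R.domain, 0 ≤ (⟪(x : E), R x⟫_ℂ).re) : IsPositiveGraph R.graph where
  mem_iff x y := by
    have h := LinearPMap.adjoint_graph_eq_graph_adjoint hR.dense_domain
    rw [LinearPMap.isSelfAdjoint_def.mp hR] at h
    conv_lhs => rw [h]
    simp [Submodule.mem_adjoint_iff, sub_eq_zero]
  nonneg x y h := by
    obtain ⟨z, rfl, rfl⟩ := (LinearPMap.mem_graph_iff _).mp h
    exact hR' z
  unique y h := LinearPMap.graph_fst_eq_zero_snd R h rfl

namespace IsPositiveGraph

variable {g g' : Submodule ℂ (E × E)}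

lemma isClosed (hg : IsPositiveGraph g) : IsClosed (g : Set (E × E)) := by
  have h : (g : Set (E × E)) = {w | ∀ v ∈ g, ⟪v.2, w.1⟫_ℂ = ⟪v.1, w.2⟫_ℂ} := by
    ext ⟨x, y⟩
    exact (hg.mem_iff x y).trans ⟨fun h v hv => h _ _ hv, fun h a b hab => h _ hab⟩
  rw [h]
  simp only [Set.ofPred_forall]
  exact isClosed_biInter fun v _ => isClosed_eq (by fun_prop) (by fun_prop)

/-- Von Neumann's argument: split (x, 0) orthogonally along the closed graph as (u, v) + (x - u,
-v). Orthogonality of the second term to the graph says, by self-adjointness, that v is in the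
domain and is mapped to x - u. -/
lemma exists_add [CompleteSpace E] (hg : IsPositiveGraph g) (x : E) :
    ∃ u v, (u, v) ∈ g ∧ (v, x - u) ∈ g := by
  let L := (WithLp.linearEquiv 2 ℂ (E × E)).symm
  let k : Submodule ℂ (WithLp 2 (E × E)) := g.map L.toLinearMap
  have hk : IsClosed (k : Set (WithLp 2 (E × E))) := by
    have h1 : (k : Set (WithLp 2 (E × E))) = WithLp.ofLp ⁻¹' (g : Set (E × E)) := by
      ext w
      constructor
      · rintro ⟨v, hv, rfl⟩; exact hv
      · intro hw; exact ⟨w.ofLp, hw, rfl⟩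
    rw [h1]
    exact hg.isClosed.preimage (WithLp.prod_continuous_ofLp 2 E E)
  have : CompleteSpace k := hk.completeSpace_coe
  obtain ⟨p, hp, q, hq, hpq⟩ := k.exists_add_mem_mem_orthogonal (WithLp.toLp 2 (x, 0))
  obtain ⟨⟨u, v⟩, huv, rfl⟩ := hp
  refine ⟨u, v, huv, (hg.mem_iff _ _).mpr fun a b hab => ?_⟩
  have h1 := (Submodule.mem_orthogonal _ _).mp hq _ ⟨(a, b), hab, rfl⟩
  have h2 : q = WithLp.toLp 2 (x - u, -v) := by
    have : q = WithLp.toLp 2 (x, 0) - L (u, v) := by rw [hpq]; exact (add_sub_cancel_left _ _).symm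
    rw [this]
    change WithLp.toLp 2 (x, 0) - WithLp.toLp 2 (u, v) = _
    rw [← WithLp.toLp_sub]; simp
  rw [h2] at h1
  have h3 : ⟪a, x - u⟫_ℂ + ⟪b, -v⟫_ℂ = 0 := h1
  rw [inner_neg_right, ← sub_eq_add_neg, sub_eq_zero] at h3
  exact h3.symm

/-- With w = Rv and v = Ru, symmetry gives ⟪u, u + w⟫ = ‖u‖² + ‖v‖²; Cauchy–Schwarz does the rest.
-/
lemma norm_le (hg : IsPositiveGraph g) {u v w : E} (h1 : (u, v) ∈ g) (h2 : (v, w) ∈ g) :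
    ‖u‖ ≤ ‖u + w‖ ∧ ‖v‖ ≤ ‖u + w‖ := by
  have h3 : ⟪u, u + w⟫_ℂ = ⟪u, u⟫_ℂ + ⟪v, v⟫_ℂ := by
    rw [inner_add_right, ← (hg.mem_iff _ _).mp h2 _ _ h1]
  have h4 := norm_inner_le_norm (𝕜 := ℂ) u (u + w)
  rw [h3, inner_self_eq_norm_sq_to_K, inner_self_eq_norm_sq_to_K] at h4
  have h5 : ‖u‖ ^ 2 + ‖v‖ ^ 2 ≤ ‖u‖ * ‖u + w‖ := by
    have h6 : ‖((‖u‖ : ℂ) ^ 2 + (‖v‖ : ℂ) ^ 2)‖ = ‖u‖ ^ 2 + ‖v‖ ^ 2 := by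
      rw [← Complex.ofReal_pow, ← Complex.ofReal_pow, ← Complex.ofReal_add, Complex.norm_real,
        Real.norm_of_nonneg (by positivity)]
    rw [← h6]; exact h4
  have h7 : ‖u‖ ≤ ‖u + w‖ := by
    by_contra! hlt
    nlinarith [norm_nonneg (u + w), sq_nonneg ‖v‖]
  refine ⟨h7, le_of_sq_le_sq ?_ (norm_nonneg _)⟩
  nlinarith [norm_nonneg (u + w), sq_nonneg ‖u‖]

/-- The operators `(1 + R²)⁻¹` and `R (1 + R²)⁻¹` are everywhere defined and bounded. -/
lemma exists_resolvent [CompleteSpace E] (hg : IsPositiveGraph g) :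
    ∃ C B : E →L[ℂ] E, ∀ x, (C x, B x) ∈ g ∧ (B x, x - C x) ∈ g := by
  let ρ : Submodule ℂ (E × (E × E)) :=
    { carrier := {w | (w.2.1, w.2.2) ∈ g ∧ (w.2.2, w.1 - w.2.1) ∈ g}
      add_mem' := by
        rintro ⟨x, u, v⟩ ⟨x', u', v'⟩ ⟨h1, h2⟩ ⟨h1', h2'⟩
        refine ⟨g.add_mem h1 h1', ?_⟩
        have := g.add_mem h2 h2'
        simp only [Prod.mk_add_mk] at this ⊢
        rwa [add_sub_add_comm]
      zero_mem' := by simp [← Prod.zero_eq_mk]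
      smul_mem' := by
        rintro c ⟨x, u, v⟩ ⟨h1, h2⟩
        refine ⟨g.smul_mem c h1, ?_⟩
        have := g.smul_mem c h2
        simp only [Prod.smul_mk] at this ⊢
        rwa [← smul_sub] }
  obtain ⟨T, hT⟩ := exists_clm_of_relation ρ
    (fun x => by obtain ⟨u, v, h1, h2⟩ := hg.exists_add x; exact ⟨(u, v), h1, h2⟩)
    (fun x y hxy => by
      have := hg.norm_le hxy.1 hxy.2
      rw [add_sub_cancel] at this
      exact max_le this.1 this.2)
  exact ⟨(ContinuousLinearMap.fst ℂ E E).comp T, (ContinuousLinearMap.snd ℂ E E).comp T, hT⟩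

lemma resolvent_eq (hg : IsPositiveGraph g) {C B : E →L[ℂ] E}
    (h : ∀ x, (C x, B x) ∈ g ∧ (B x, x - C x) ∈ g) {u v w : E} (h1 : (u, v) ∈ g)
    (h2 : (v, w) ∈ g) : C (u + w) = u ∧ B (u + w) = v := by
  have h3 := hg.norm_le (g.sub_mem (h (u + w)).1 h1) (g.sub_mem (h (u + w)).2 h2)
  rw [show C (u + w) - u + (u + w - C (u + w) - w) = 0 by abel, norm_zero] at h3
  exact ⟨sub_eq_zero.mp (norm_le_zero_iff.mp h3.1), sub_eq_zero.mp (norm_le_zero_iff.mp h3.2)⟩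

/-- Both (Cx, Bx) and (Bx, x - Cx) lie on the positive graph, and the two resulting nonnegative
quantities add up to the real part of ⟪Bx, x⟫. -/
lemma isPositive_resolvent (hg : IsPositiveGraph g) {C B : E →L[ℂ] E}
    (h : ∀ x, (C x, B x) ∈ g ∧ (B x, x - C x) ∈ g) : B.IsPositive := by
  refine ContinuousLinearMap.isPositive_def.mpr ⟨fun x y => ?_, fun x => ?_⟩
  · change ⟪B x, y⟫_ℂ = ⟪x, B y⟫_ℂ
    have h1 := (hg.mem_iff _ _).mp (h y).1 _ _ (h x).1
    have h2 := (hg.mem_iff _ _).mp (h y).2 _ _ (h x).2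
    rw [inner_sub_left, inner_sub_right, h1] at h2
    linear_combination -h2
  · change 0 ≤ (⟪B x, x⟫_ℂ).re
    have h1 := hg.nonneg _ _ (h x).1
    have h2 := hg.nonneg _ _ (h x).2
    rw [← inner_conj_symm, Complex.conj_re] at h1
    rw [inner_sub_right, Complex.sub_re] at h2
    linarith

lemma resolvent_mul_self (hg : IsPositiveGraph g) {C B : E →L[ℂ] E}
    (h : ∀ x, (C x, B x) ∈ g ∧ (B x, x - C x) ∈ g) : B * B = C - C * C := by
  ext x
  have h1 := hg.resolvent_eq h (h (C x)).2 (g.sub_mem (h x).1 (h (C x)).1)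
  rw [add_sub_cancel] at h1
  exact h1.2

/-- C = (1 + R²)⁻¹ depends on R² alone, and B is the positive square root of C - C². This yields
uniqueness of the positive root without a spectral theorem for unbounded operators. -/
lemma resolvent_unique [CompleteSpace E] (hg : IsPositiveGraph g) (hg' : IsPositiveGraph g')
    (hc : comp (g : Set (E × E)) (g : Set (E × E)) = comp (g' : Set (E × E)) (g' : Set (E × E)))
    {C B C' B' : E →L[ℂ] E}
    (h : ∀ x, (C x, B x) ∈ g ∧ (B x, x - C x) ∈ g)
    (h' : ∀ x, (C' x, B' x) ∈ g' ∧ (B' x, x - C' x) ∈ g') : C = C' ∧ B = B' := by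
  have hC : C = C' := by
    ext x
    have h1 : (C x, x - C x) ∈ comp (g : Set (E × E)) g := ⟨B x, (h x).1, (h x).2⟩
    rw [hc] at h1
    obtain ⟨v, hv, hv'⟩ := h1
    have := (hg'.resolvent_eq h' hv hv').1
    rwa [add_sub_cancel, eq_comm] at this
  have h1 := hg.resolvent_mul_self h
  rw [hC, ← hg'.resolvent_mul_self h'] at h1
  exact ⟨hC, (CFC.mul_self_eq_mul_self_iff B B'
    ((ContinuousLinearMap.nonneg_iff_isPositive B).mpr (hg.isPositive_resolvent h))
    ((ContinuousLinearMap.nonneg_iff_isPositive B').mpr (hg'.isPositive_resolvent h'))).mp h1⟩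

lemma dense_range_resolvent [CompleteSpace E] (hg : IsPositiveGraph g) (hinj : ∀ x, (x, 0) ∈ g → x = 0)
    {C B : E →L[ℂ] E} (h : ∀ x, (C x, B x) ∈ g ∧ (B x, x - C x) ∈ g) : DenseRange B := by
  have h0 : ∀ y, B y = 0 → y = 0 := fun y hy => by
    have h1 := h y
    rw [hy] at h1
    have h2 := h1.2
    rw [hinj _ h1.1, sub_zero] at h2
    exact hg.unique _ h2
  have h1 : (LinearMap.range B.toLinearMap).topologicalClosure = ⊤ := by
    rw [Submodule.topologicalClosure_eq_top_iff, Submodule.eq_bot_iff]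
    intro y hy
    refine h0 y (ext_inner_left ℂ fun x => ?_)
    rw [inner_zero_right, ← (hg.isPositive_resolvent h).inner_left_eq_inner_right x y]
    exact (Submodule.mem_orthogonal _ _).mp hy _ ⟨x, rfl⟩
  rw [Submodule.dense_iff_topologicalClosure_eq_top.symm] at h1
  exact h1

end IsPositiveGraph

/-- The polar decomposition of an injective operator is unique. -/
theorem IsPolarDecomposition.unique [CompleteSpace E] {S : Set (E × E)} {J J' : E →L⋆[ℂ] E}
    {R R' : E →ₗ.[ℂ] E}
    (h : IsPolarDecomposition S J R) (h' : IsPolarDecomposition S J' R')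
    (hinj : ∀ x, (x, 0) ∈ S → x = 0) : J = J' := by
  have hg := isPositiveGraph_graph h.selfAdjoint h.nonneg
  have hg' := isPositiveGraph_graph h'.selfAdjoint h'.nonneg
  obtain ⟨C, B, hB⟩ := hg.exists_resolvent
  obtain ⟨C', B', hB'⟩ := hg'.exists_resolvent
  obtain ⟨rfl, rfl⟩ := hg.resolvent_unique hg' (h.sq_eq.trans h'.sq_eq.symm) hB hB'
  have hS : ∀ x y, (x, y) ∈ R.graph → (x, J y) ∈ S := fun x y hxy => by
    obtain ⟨z, rfl, rfl⟩ := (LinearPMap.mem_graph_iff _).mp hxy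
    rw [h.eq_comp]; exact ⟨z, rfl⟩
  have hdense := hg.dense_range_resolvent (fun x hx => hinj x (by simpa using hS _ _ hx)) hB
  -- J(Bx) and J'(Bx) both equal S(Cx), and injectivity of S makes the range of B dense.
  refine ContinuousLinearMap.coeFn_injective (hdense.equalizer J.continuous J'.continuous
    (funext fun x => ?_))
  have h1 := hS _ _ (hB x).1
  rw [h'.eq_comp] at h1
  obtain ⟨z, hz⟩ := h1
  simp only [Prod.mk.injEq] at hz
  have h2 : R' z = B x := LinearPMap.mem_graph_snd_inj R' (R'.mem_graph z) (hB' x).1 hz.1.symm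
  change J (B x) = J' (B x)
  rw [hz.2, h2]

end

end OpGraph

end

/-! ### From positive graphs to positive self-adjoint operators. -/

noncomputable section

namespace OpGraph

section

variable {E : Type*} [NormedAddCommGroup E] [InnerProductSpace ℂ E] [CompleteSpace E]

lemma IsPositiveGraph.exists_linearPMap {g : Submodule ℂ (E × E)} (hg : IsPositiveGraph g)
    (hd : Dense {x | ∃ y, (x, y) ∈ g}) : ∃ R : E →ₗ.[ℂ] E, R.graph = g ∧ IsSelfAdjoint R ∧
      ∀ x : R.domain, 0 ≤ (⟪(x : E), R x⟫_ℂ).re := by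
  have hgr : g.toLinearPMap.graph = g :=
    Submodule.toLinearPMap_graph_eq g fun w hw h => hg.unique _ (by
      rw [← h]; exact hw)
  have hdom : Dense (g.toLinearPMap.domain : Set E) := by
    refine hd.mono ?_
    rintro x ⟨y, hxy⟩
    rw [← hgr] at hxy
    exact LinearPMap.mem_domain_of_mem_graph hxy
  refine ⟨g.toLinearPMap, hgr, ?_, fun x => ?_⟩
  · rw [LinearPMap.isSelfAdjoint_def]
    refine LinearPMap.eq_of_eq_graph ?_
    rw [LinearPMap.adjoint_graph_eq_graph_adjoint hdom, hgr]
    ext ⟨x, y⟩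
    rw [hg.mem_iff]
    simp [Submodule.mem_adjoint_iff, sub_eq_zero]
  · refine hg.nonneg _ _ ?_
    have := g.toLinearPMap.mem_graph x
    rwa [hgr] at this

end

end OpGraph

/-! ### Antiunitary conjugations and the polar decomposition on the Fock space. -/

namespace FermiFock

open ExteriorAlgebra OpGraph

section

variable {E : Type*} [NormedAddCommGroup E] [InnerProductSpace ℂ E]

/-- An antiunitary involution `j` that intertwines the antilinear operators with graphs `G` and `H`
and whose composition with the first is positive. -/
structure IsConjugation (G H : Set (E × E)) (j : E →L⋆[ℂ] E) : Prop where
  involutive : ∀ p, j (j p) = p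
  inner_map : ∀ p q, ⟪j p, j q⟫_ℂ = ⟪q, p⟫_ℂ
  mem : ∀ {p p'}, (p, p') ∈ G → (j p, j p') ∈ H
  mem' : ∀ {p p'}, (p, p') ∈ H → (j p, j p') ∈ G
  nonneg : ∀ {p p'}, (p, p') ∈ G → 0 ≤ (⟪p, j p'⟫_ℂ).re

namespace IsConjugation

variable {G H : Set (E × E)} {j : E →L⋆[ℂ] E}

lemma inner_left (hj : IsConjugation G H j) (p q : E) : ⟪j p, q⟫_ℂ = ⟪j q, p⟫_ℂ := by
  rw [← hj.inner_map, hj.involutive]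

lemma norm_map (hj : IsConjugation G H j) (p : E) : ‖j p‖ = ‖p‖ := by
  have := hj.inner_map p p
  rw [inner_self_eq_norm_sq_to_K, inner_self_eq_norm_sq_to_K] at this
  have h2 : ‖j p‖ ^ 2 = ‖p‖ ^ 2 := by exact_mod_cast this
  exact (sq_eq_sq₀ (norm_nonneg _) (norm_nonneg _)).mp h2

lemma norm_antiMap_le (hj : IsConjugation G H j) (x : ExteriorAlgebra ℂ E) :
    ‖antiMap j.toLinearMap x‖ ≤ ‖x‖ :=
  FermiFock.norm_antiMap_le hj.inner_left (fun p => (hj.norm_map p).le)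
    (fun p => (hj.norm_map p).le) x

lemma coe_apply (hj : IsConjugation G H j) (x : ExteriorAlgebra ℂ E) :
    fockAntiMap j.toLinearMap (x : Fock E) = (antiMap j.toLinearMap x : ExteriorAlgebra ℂ E) :=
  fockAntiMap_coe hj.norm_antiMap_le x

lemma fock_wedge (hj : IsConjugation G H j) {n : ℕ} (p : Fin n → E) :
    fockAntiMap j.toLinearMap (wedge p) = wedge fun i => j (p i.rev) :=
  fockAntiMap_wedge hj.norm_antiMap_le p

lemma fock_involutive (hj : IsConjugation G H j) (x : Fock E) :
    fockAntiMap j.toLinearMap (fockAntiMap j.toLinearMap x) = x := by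
  induction x using UniformSpace.Completion.induction_on with
  | hp => exact isClosed_eq (by fun_prop) (by fun_prop)
  | ih x =>
    rw [hj.coe_apply, hj.coe_apply, antiMap_antiMap _ _ LinearMap.id hj.involutive]
    simp

lemma fock_inner_left (hj : IsConjugation G H j) (x y : Fock E) :
    ⟪fockAntiMap j.toLinearMap x, y⟫_ℂ = ⟪fockAntiMap j.toLinearMap y, x⟫_ℂ := by
  induction x, y using UniformSpace.Completion.induction_on₂ with
  | hp => exact isClosed_eq (by fun_prop) (by fun_prop)
  | ih x y =>
    rw [hj.coe_apply, hj.coe_apply, UniformSpace.Completion.inner_coe,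
      UniformSpace.Completion.inner_coe]
    have h1 : ∀ z : ExteriorAlgebra ℂ E,
        AntiRel {w : E × E | w.2 = j w.1} z (antiMap j.toLinearMap z) := fun z => by
      simpa using AntiRel.of_antiMap (G := {w : E × E | w.2 = j w.1}) (f := LinearMap.id)
        (g := LinearMap.id) (b := j.toLinearMap) (fun _ => rfl) z
    refine (h1 x).form_eq (fun p p' r r' hp hr => ?_) (h1 y)
    rw [show p' = j p from hp, show r' = j r from hr, hj.inner_left]

lemma fock_inner_map (hj : IsConjugation G H j) (x y : Fock E) :
    ⟪fockAntiMap j.toLinearMap x, fockAntiMap j.toLinearMap y⟫_ℂ = ⟪y, x⟫_ℂ := by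
  rw [hj.fock_inner_left, hj.fock_involutive]

lemma fock_norm_map (hj : IsConjugation G H j) (x : Fock E) :
    ‖fockAntiMap j.toLinearMap x‖ = ‖x‖ := by
  have := hj.fock_inner_map x x
  rw [inner_self_eq_norm_sq_to_K, inner_self_eq_norm_sq_to_K] at this
  have h2 : ‖fockAntiMap j.toLinearMap x‖ ^ 2 = ‖x‖ ^ 2 := by exact_mod_cast this
  exact (sq_eq_sq₀ (norm_nonneg _) (norm_nonneg _)).mp h2

lemma fock_mem (hj : IsConjugation G H j) {x y : Fock E} (h : (x, y) ∈ closure (antiFock G)) :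
    (fockAntiMap j.toLinearMap x, fockAntiMap j.toLinearMap y) ∈ closure (antiFock H) := by
  refine map_mem_closure (f := fun w : Fock E × Fock E =>
    (fockAntiMap j.toLinearMap w.1, fockAntiMap j.toLinearMap w.2)) (by fun_prop) h ?_
  rintro _ ⟨x, y, hxy, rfl⟩
  exact ⟨_, _, hxy.conj (j := j.toLinearMap) fun _ _ h => hj.mem h, by simp only [hj.coe_apply]⟩

lemma fock_mem' (hj : IsConjugation G H j) {x y : Fock E} (h : (x, y) ∈ closure (antiFock H)) :
    (fockAntiMap j.toLinearMap x, fockAntiMap j.toLinearMap y) ∈ closure (antiFock G) := by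
  refine map_mem_closure (f := fun w : Fock E × Fock E =>
    (fockAntiMap j.toLinearMap w.1, fockAntiMap j.toLinearMap w.2)) (by fun_prop) h ?_
  rintro _ ⟨x, y, hxy, rfl⟩
  exact ⟨_, _, hxy.conj (j := j.toLinearMap) fun _ _ h => hj.mem' h, by simp only [hj.coe_apply]⟩

lemma fock_restrictsTo (hj : IsConjugation G H j) (n : ℕ) :
    RestrictsTo {w : Fock E × Fock E | w.2 = fockAntiMap j.toLinearMap w.1} (nParticle E n) := by
  intro x y hxy
  obtain rfl : y = fockAntiMap j.toLinearMap x := hxy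
  refine starProjection_comm _ (fun n x hx => mapsTo_nParticle (fun p => ?_) hx) n x
  rw [hj.fock_wedge]
  exact wedge_mem_nParticle _

variable [CompleteSpace E] {e : ℕ → E →L[ℂ] E} {g h : ℕ → E →L⋆[ℂ] E}

/-- Symmetry of e j g holds because j carries (e q, g q) into H, so that h j e = e j g; positivity
is that of jG at the vector e p. A square root is taken because squares remain visibly positive
after second quantization. -/
lemma exists_sqrt (hj : IsConjugation G H j) (R : Regularization G H e g h) (n : ℕ) :
    ∃ k : E →L[ℂ] E, (∀ p q, ⟪k p, q⟫_ℂ = ⟪p, k q⟫_ℂ) ∧ ∀ p, k (k p) = e n (j (g n p)) := by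
  let A : E →L[ℂ] E := (e n).comp (j.comp (g n))
  have hA : 0 ≤ A := by
    rw [ContinuousLinearMap.nonneg_iff_isPositive, ContinuousLinearMap.isPositive_def]
    refine ⟨fun p q => ?_, fun p => ?_⟩
    · change ⟪e n (j (g n p)), q⟫_ℂ = ⟪p, e n (j (g n q))⟫_ℂ
      rw [← R.swap.apply_eq n (hj.mem (R.mem n q)), R.symm, hj.inner_left,
        ← inner_conj_symm, R.inner_eq, inner_conj_symm]
    · change 0 ≤ (⟪e n (j (g n p)), p⟫_ℂ).re
      rw [R.symm, ← inner_conj_symm, Complex.conj_re]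
      exact hj.nonneg (R.mem n p)
  refine ⟨CFC.sqrt A, fun p q => ?_, fun p => ?_⟩
  · exact ((ContinuousLinearMap.nonneg_iff_isPositive _).mp
      (CFC.sqrt_nonneg A)).inner_left_eq_inner_right p q
  · exact congrArg (fun T : E →L[ℂ] E => T p) (CFC.sqrt_mul_sqrt_self A hA)

lemma fock_nonneg (hj : IsConjugation G H j) (R : Regularization G H e g h) {x y : Fock E}
    (hxy : (x, y) ∈ closure (antiFock G)) : 0 ≤ (⟪x, fockAntiMap j.toLinearMap y⟫_ℂ).re := by
  refine closure_minimal (t := {w : Fock E × Fock E |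
    0 ≤ (⟪w.1, fockAntiMap j.toLinearMap w.2⟫_ℂ).re}) ?_
    (isClosed_le continuous_const (Complex.continuous_re.comp (by fun_prop))) hxy
  rintro _ ⟨x, y, hxy, rfl⟩
  have h1 : Continuous fun w : Fock E × Fock E =>
      (⟪w.1, fockAntiMap j.toLinearMap w.2⟫_ℂ).re := Complex.continuous_re.comp (by fun_prop)
  refine ge_of_tendsto ((h1.tendsto ((x : Fock E), (y : Fock E))).comp
    ((R.tendsto_map (x : Fock E)).prodMk_nhds (R.tendsto_map (y : Fock E))))
    (Filter.Eventually.of_forall fun n => ?_)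
  obtain ⟨k, hk, hk'⟩ := hj.exists_sqrt R n
  -- The cutoff of y is the image of x under g, and two order reversals cancel, so the form becomes
  -- the expectation of the second quantized e j g at x, that is the squared norm of the second
  -- quantized k at x.
  simp only [Function.comp_apply]
  rw [fockMap_coe (R.norm_map_le n), fockMap_coe (R.norm_map_le n), hj.coe_apply,
    UniformSpace.Completion.inner_coe,
    ← hxy.antiMap_eq (f := (e n).toLinearMap) (b := (g n).toLinearMap) fun p p' hp => R.apply_eq n hp,
    antiMap_antiMap _ _ ((j.comp (g n)).toLinearMap) fun p => rfl, inner_def,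
    form_map (B := (e n).toLinearMap) (R.symm n), ← inner_def]
  have h3 : map (e n).toLinearMap (map (j.comp (g n)).toLinearMap x) =
      map k.toLinearMap (map k.toLinearMap x) := by
    rw [← AlgHom.comp_apply, ← AlgHom.comp_apply, map_comp_map, map_comp_map]
    congr 2
    ext p
    exact (hk' p).symm
  rw [h3, inner_def, ← form_map (A := k.toLinearMap) hk, ← inner_def]
  exact inner_self_nonneg (𝕜 := ℂ) (x := map k.toLinearMap x)

/-- The polar decomposition of the closed second quantization of `G`. -/
theorem exists_isPolarDecomposition (hj : IsConjugation G H j) (R : Regularization G H e g h)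
    (hG : ∀ p p', (p, p') ∈ G → (p', p) ∈ G) :
    ∃ T, IsPolarDecomposition (closure (antiFock G)) (fockAntiMap j.toLinearMap) T := by
  have hl := (isSemilinear_antiFock G).closure
  have hne := (antiFock_nonempty G).mono (subset_closure (s := antiFock G))
  have hadj : antiAdjoint (closure (antiFock G)) = closure (antiFock H) := by
    rw [antiAdjoint_closure, R.swap.antiAdjoint_eq]
  have hadj' : antiAdjoint (closure (antiFock H)) = closure (antiFock G) := by
    rw [antiAdjoint_closure, R.antiAdjoint_eq]
  -- The candidate for the positive part of S is JS, with J the second quantized j; since J is an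
  -- involution, S = J(JS).
  let ρ : Submodule ℂ (Fock E × Fock E) :=
    { carrier := {w | (w.1, fockAntiMap j.toLinearMap w.2) ∈ closure (antiFock G)}
      add_mem' := fun {a b} ha hb => by
        have := hl.add_mem ha hb
        simpa using this
      zero_mem' := by simpa using hl.zero_mem hne
      smul_mem' := fun c a ha => by
        have := hl.smul_mem c ha
        simpa using this }
  have hρ : ∀ x y, (x, y) ∈ ρ ↔ (x, fockAntiMap j.toLinearMap y) ∈ closure (antiFock G) :=
    fun _ _ => Iff.rfl
  have hpos : IsPositiveGraph ρ :=
    { mem_iff := fun x y => by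
        -- From JSJ = S^* follows JS = S^*J, and the latter is the adjoint of JS.
        have h1 : (x, y) ∈ ρ ↔ (fockAntiMap j.toLinearMap x, y) ∈ closure (antiFock H) := by
          rw [hρ]
          refine ⟨fun h => ?_, fun h => ?_⟩
          · simpa [hj.fock_involutive] using hj.fock_mem h
          · simpa [hj.fock_involutive] using hj.fock_mem' h
        rw [h1, ← hadj]
        refine ⟨fun h a b hab => ?_, fun h v hv => ?_⟩
        · have h2 := h _ ((hρ _ _).mp hab)
          simp only at h2
          rw [hj.fock_inner_map] at h2
          rw [← inner_conj_symm, h2, inner_conj_symm]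
        · have h2 := h v.1 (fockAntiMap j.toLinearMap v.2)
            ((hρ _ _).mpr (by rw [hj.fock_involutive]; exact hv))
          simp only
          rw [← inner_conj_symm y, ← h2, inner_conj_symm, ← hj.fock_inner_map, hj.fock_involutive]
      nonneg := fun x y hxy => by
        simpa [hj.fock_involutive] using hj.fock_nonneg R hxy
      unique := fun y hy => by
        have h1 := R.unique ((hρ _ _).mp hy) (hl.zero_mem hne)
        rw [← hj.fock_involutive y, h1, map_zero] }
  obtain ⟨T, hT, hsa, hnn⟩ := hpos.exists_linearPMap (R.isDenselyDefined.dense.mono (by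
    rintro x ⟨y, hy⟩
    exact ⟨fockAntiMap j.toLinearMap y, (hρ _ _).mpr (by rwa [hj.fock_involutive])⟩))
  -- The relation is symmetric, so S is its own inverse, and single-valuedness of S gives
  -- injectivity.
  have hinj : ∀ y, (y, 0) ∈ closure (antiFock G) → y = 0 := fun y hy => by
    have h1 : (0, y) ∈ closure (antiFock G) := by
      refine map_mem_closure (f := Prod.swap) continuous_swap hy ?_
      rintro _ ⟨x, y, hxy, rfl⟩
      exact ⟨_, _, hxy.swap hG, rfl⟩
    exact R.unique h1 (hl.zero_mem hne)
  refine ⟨T, hsa, hnn, ?_, fun y _ => hj.fock_norm_map y, fun y hy => ?_, ?_⟩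
  · rw [hT, hadj]
    ext ⟨x, y⟩
    constructor
    · rintro ⟨z, hz, hz'⟩
      refine ⟨fockAntiMap j.toLinearMap z, hz, ?_⟩
      simpa [hj.fock_involutive] using hj.fock_mem hz'
    · rintro ⟨z, hz, hz'⟩
      refine ⟨fockAntiMap j.toLinearMap z, ?_, ?_⟩
      · change (x, _) ∈ ρ
        rw [hρ, hj.fock_involutive]; exact hz
      · exact hj.fock_mem' hz'
  · have h1 : (y, 0) ∈ ρ := (hpos.mem_iff _ _).mpr fun a b hab => by
      rw [← hT] at hab
      obtain ⟨z, rfl, rfl⟩ := (LinearPMap.mem_graph_iff _).mp hab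
      rw [hy, inner_zero_right]
    rw [hinj y (by simpa using (hρ _ _).mp h1), map_zero]
  · ext ⟨x, y⟩
    constructor
    · intro h
      have h1 : (x, fockAntiMap j.toLinearMap y) ∈ T.graph := by
        rw [hT, hρ, hj.fock_involutive]; exact h
      obtain ⟨z, hz, hz'⟩ := (LinearPMap.mem_graph_iff _).mp h1
      refine ⟨z, ?_⟩
      simp only at hz hz'
      rw [hz', hj.fock_involutive, hz]
    · rintro ⟨z, hz⟩
      rw [hz]
      have := T.mem_graph z
      rw [hT] at this
      exact this

/-- Every polar decomposition of the closed second quantization of `G` has the second quantization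
of `j` as its antiunitary part. -/
theorem eq_of_isPolarDecomposition (hj : IsConjugation G H j) (R : Regularization G H e g h)
    (hG : ∀ p p', (p, p') ∈ G → (p', p) ∈ G) {J : Fock E →L⋆[ℂ] Fock E} {T : Fock E →ₗ.[ℂ] Fock E}
    (h : IsPolarDecomposition (closure (antiFock G)) J T) : J = fockAntiMap j.toLinearMap := by
  obtain ⟨T', h'⟩ := hj.exists_isPolarDecomposition R hG
  refine h.unique h' fun y hy => ?_
  have h1 : (0, y) ∈ closure (antiFock G) := by
    refine map_mem_closure (f := Prod.swap) continuous_swap hy ?_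
    rintro _ ⟨x, y, hxy, rfl⟩
    exact ⟨_, _, hxy.swap hG, rfl⟩
  exact R.unique h1 ((isSemilinear_antiFock G).closure.zero_mem
    ((antiFock_nonempty G).mono subset_closure))

end IsConjugation

end

end FermiFock

end

/-! ### Bounded one-particle data: cutoffs and the conjugation j. -/

noncomputable section

namespace FermiFock

open OpGraph

section

variable {E : Type*} [NormedAddCommGroup E] [InnerProductSpace ℂ E]

/-- A pair of antilinear operators with graphs `G` and `H` that contain the pairs `(D p, b p)` and
`(p - D p, b p)`, respectively. -/
structure IsModularPair (D : E →L[ℂ] E) (b : E →L⋆[ℂ] E) (G H : Set (E × E)) : Prop where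
  linear : IsSemilinear (starRingEnd ℂ) G
  linear' : IsSemilinear (starRingEnd ℂ) H
  adjoint : G ⊆ antiAdjoint H
  isClosed : IsClosed G
  isClosed' : IsClosed H
  mem : ∀ p, (D p, b p) ∈ G
  mem' : ∀ p, (p - D p, b p) ∈ H
  symm : ∀ p q, ⟪D p, q⟫_ℂ = ⟪p, D q⟫_ℂ
  nonneg : ∀ p, 0 ≤ (⟪D p, p⟫_ℂ).re
  inner_eq : ∀ p q, ⟪b p, q⟫_ℂ = ⟪b q, p⟫_ℂ
  sq_eq : ∀ p, b (b p) = D p - D (D p)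
  comm : ∀ p, b (D p) = b p - D (b p)
  injective : ∀ p, b p = 0 → p = 0

lemma _root_.DenseRange.eq_of_forall {X Y Z : Type*} [TopologicalSpace X] [TopologicalSpace Y]
    [T2Space Y] {k : Z → X} (hk : DenseRange k) {f g : X → Y} (hf : Continuous f)
    (hg : Continuous g) (h : ∀ z, f (k z) = g (k z)) (x : X) : f x = g x :=
  congrFun (hk.equalizer hf hg (funext h)) x

namespace IsModularPair

variable {D : E →L[ℂ] E} {b : E →L⋆[ℂ] E} {G H : Set (E × E)}

lemma inner_sq (M : IsModularPair D b G H) (p : E) : ⟪D p - D (D p), p⟫_ℂ = (‖b p‖ : ℂ) ^ 2 := by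
  rw [← M.sq_eq, M.inner_eq, inner_self_eq_norm_sq_to_K]; rfl

lemma comm_sq (M : IsModularPair D b G H) (p : E) :
    b (D p - D (D p)) = D (b p) - D (D (b p)) := by
  rw [map_sub, M.comm (D p), M.comm p, map_sub]; abel

variable [CompleteSpace E]

lemma denseRange (M : IsModularPair D b G H) : DenseRange b := by
  have h1 : (LinearMap.range b.toLinearMap).topologicalClosure = ⊤ := by
    rw [Submodule.topologicalClosure_eq_top_iff, Submodule.eq_bot_iff]
    intro y hy
    refine M.injective y (ext_inner_right ℂ fun x => ?_)
    rw [inner_zero_left, M.inner_eq]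
    exact (Submodule.mem_orthogonal _ _).mp hy _ ⟨x, rfl⟩
  rw [Submodule.dense_iff_topologicalClosure_eq_top.symm] at h1
  exact h1

lemma denseRange_sq (M : IsModularPair D b G H) : DenseRange fun p => D p - D (D p) := by
  have := M.denseRange.comp M.denseRange b.continuous
  convert this using 2 with p
  exact (M.sq_eq p).symm

/-- The resolvent `(D - D² + ε)⁻¹`. -/
lemma exists_resolvent (M : IsModularPair D b G H) {ε : ℝ} (hε : 0 < ε) : ∃ r : E →L[ℂ] E,
    (∀ p, D (r p) - D (D (r p)) + (ε : ℂ) • r p = p) ∧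
      ∀ p, r (D p - D (D p) + (ε : ℂ) • p) = p := by
  have hu : IsUnit (D - D * D + (ε : ℂ) • (1 : E →L[ℂ] E)) := by
    -- Coercivity: the quadratic form at x is ‖bx‖² + ε‖x‖².
    refine ContinuousLinearMap.isUnit_of_forall_le_norm_inner_map _ (c := ⟨ε, hε.le⟩) hε fun x => ?_
    have h1 : ⟪(D - D * D + (ε : ℂ) • (1 : E →L[ℂ] E)) x, x⟫_ℂ =
        ((‖b x‖ ^ 2 + ε * ‖x‖ ^ 2 : ℝ) : ℂ) := by
      change ⟪D x - D (D x) + (ε : ℂ) • x, x⟫_ℂ = _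
      rw [inner_add_left, M.inner_sq, inner_smul_left, inner_self_eq_norm_sq_to_K]
      simp
    rw [h1, Complex.norm_real, Real.norm_of_nonneg (by positivity)]
    change ‖x‖ ^ 2 * ε ≤ _
    nlinarith [sq_nonneg ‖b x‖]
  obtain ⟨u, hu⟩ := hu
  refine ⟨(↑u⁻¹ : E →L[ℂ] E), fun p => ?_, fun p => ?_⟩
  · have := congrArg (fun T : E →L[ℂ] E => T p) u.mul_inv
    rw [hu] at this
    exact this
  · have := congrArg (fun T : E →L[ℂ] E => T p) u.inv_mul
    rw [hu] at this
    exact this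

/-- A choice of the resolvents `(D - D² + 1 / (n + 1))⁻¹`. -/
def resolvent (M : IsModularPair D b G H) (n : ℕ) : E →L[ℂ] E :=
  (M.exists_resolvent (ε := 1 / ((n : ℝ) + 1)) (by positivity)).choose

section

variable (M : IsModularPair D b G H) (n : ℕ)

lemma apply_resolvent (p : E) : D (M.resolvent n p) - D (D (M.resolvent n p)) +
    ((1 / ((n : ℝ) + 1) : ℝ) : ℂ) • M.resolvent n p = p :=
  (M.exists_resolvent (ε := 1 / ((n : ℝ) + 1)) (by positivity)).choose_spec.1 p

lemma resolvent_apply (p : E) : M.resolvent n (D p - D (D p) +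
    ((1 / ((n : ℝ) + 1) : ℝ) : ℂ) • p) = p :=
  (M.exists_resolvent (ε := 1 / ((n : ℝ) + 1)) (by positivity)).choose_spec.2 p

lemma resolvent_symm (p q : E) : ⟪M.resolvent n p, q⟫_ℂ = ⟪p, M.resolvent n q⟫_ℂ := by
  conv_lhs => rw [← M.apply_resolvent n q]
  conv_rhs => rw [← M.apply_resolvent n p]
  simp only [inner_add_left, inner_add_right, inner_sub_left, inner_sub_right, inner_smul_left,
    inner_smul_right, Complex.conj_ofReal, M.symm]

lemma resolvent_comm (p : E) : M.resolvent n (D p) = D (M.resolvent n p) := by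
  conv_lhs => rw [← M.apply_resolvent n p]
  rw [map_add, map_sub, map_smul, M.resolvent_apply]

lemma resolvent_antiComm (p : E) : M.resolvent n (b p) = b (M.resolvent n p) := by
  conv_lhs => rw [← M.apply_resolvent n p]
  rw [map_add, M.comm_sq, map_smulₛₗ, Complex.conj_ofReal, M.resolvent_apply]

/-- The approximate identity `(D - D²) (D - D² + 1 / (n + 1))⁻¹`. -/
def cutoff : E →L[ℂ] E := (D - D * D) * M.resolvent n

lemma cutoff_apply (p : E) :
    M.cutoff n p = D (M.resolvent n p) - D (D (M.resolvent n p)) := rfl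

lemma norm_cutoff_le (p : E) : ‖M.cutoff n p‖ ≤ ‖p‖ := by
  rw [cutoff_apply]
  set u := M.resolvent n p with hu
  set ε : ℝ := 1 / ((n : ℝ) + 1) with hε
  have hε0 : 0 < ε := by positivity
  have h1 : D u - D (D u) + (ε : ℂ) • u = p := M.apply_resolvent n p
  refine le_of_sq_le_sq ?_ (norm_nonneg _)
  -- With K = D - D², p = Ku + εu and the cross term is a positive multiple of ‖bu‖², so ‖Ku‖ ≤ ‖p‖.
  rw [← h1, norm_add_sq (𝕜 := ℂ), inner_smul_right, M.inner_sq]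
  have h2 : RCLike.re ((ε : ℂ) * (‖b u‖ : ℂ) ^ 2) = ε * ‖b u‖ ^ 2 := by
    rw [← Complex.ofReal_pow, ← Complex.ofReal_mul]; exact Complex.ofReal_re _
  rw [h2]
  have h3 : 0 ≤ ε * ‖b u‖ ^ 2 := by positivity
  nlinarith [sq_nonneg ‖(ε : ℂ) • u‖]

lemma tendsto_cutoff (p : E) :
    Filter.Tendsto (fun n => M.cutoff n p) Filter.atTop (nhds p) := by
  refine tendsto_of_dense M.norm_cutoff_le M.denseRange_sq ?_ p
  rintro _ ⟨x, rfl⟩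
  rw [tendsto_iff_norm_sub_tendsto_zero]
  refine squeeze_zero (g := fun n : ℕ => (1 / ((n : ℝ) + 1)) * ‖x‖) (fun _ => norm_nonneg _)
    (fun n => ?_) (by simpa using tendsto_one_div_add_atTop_nhds_zero_nat.mul_const ‖x‖)
  -- On the dense range of D - D² the error is exactly -1/(n+1) times the cutoff of x.
  have h1 : M.cutoff n (D x - D (D x)) - (D x - D (D x)) =
      -(((1 / ((n : ℝ) + 1) : ℝ) : ℂ) • M.cutoff n x) := by
    conv_lhs => enter [2]; rw [← M.apply_resolvent n (D x - D (D x))]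
    rw [cutoff_apply, cutoff_apply, map_sub (M.resolvent n), M.resolvent_comm, M.resolvent_comm,
      M.resolvent_comm]
    abel
  simp only
  rw [h1, norm_neg, norm_smul, Complex.norm_real, Real.norm_of_nonneg (by positivity)]
  exact mul_le_mul_of_nonneg_left (M.norm_cutoff_le n x) (by positivity)

/-- The composition of the first operator with the cutoff. -/
def cutoffLeft : E →L⋆[ℂ] E := b.comp (M.resolvent n - D * M.resolvent n)

/-- The composition of the second operator with the cutoff. -/
def cutoffRight : E →L⋆[ℂ] E := b.comp (D * M.resolvent n)

lemma cutoffLeft_apply (p : E) :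
    M.cutoffLeft n p = b (M.resolvent n p - D (M.resolvent n p)) := rfl

lemma cutoffRight_apply (p : E) : M.cutoffRight n p = b (D (M.resolvent n p)) := rfl

end

/-- With r the resolvent, the cutoff reads both as D applied to (1 - D)r, which is in the domain of
G, and as 1 - D applied to Dr, which is in the domain of H. -/
lemma regularization (M : IsModularPair D b G H) :
    Regularization G H M.cutoff M.cutoffLeft M.cutoffRight where
  linear := M.linear
  linear' := M.linear'
  adjoint := M.adjoint
  symm n p q := by
    simp only [cutoff_apply, inner_sub_left, inner_sub_right, M.symm, ← M.resolvent_comm,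
      M.resolvent_symm]
  norm_le := M.norm_cutoff_le
  tendsto := M.tendsto_cutoff
  mem n p := by
    have := M.mem (M.resolvent n p - D (M.resolvent n p))
    rwa [map_sub] at this
  mem' n p := M.mem' (D (M.resolvent n p))
  inner_eq n p q := by
    rw [cutoffLeft_apply, cutoffRight_apply, M.inner_eq, M.comm, inner_sub_right, inner_sub_left,
      ← M.resolvent_antiComm, M.symm, M.resolvent_symm, ← M.resolvent_comm,
      ← M.resolvent_symm, ← M.resolvent_symm]

/-! #### The antiunitary part -/

lemma exists_sqrt (M : IsModularPair D b G H) : ∃ k : E →L[ℂ] E, 0 ≤ k ∧ k * k = D - D * D ∧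
    k * D = D * k := by
  have hK : 0 ≤ D - D * D := by
    rw [ContinuousLinearMap.nonneg_iff_isPositive, ContinuousLinearMap.isPositive_def]
    refine ⟨fun p q => ?_, fun p => ?_⟩
    · change ⟪D p - D (D p), q⟫_ℂ = ⟪p, D q - D (D q)⟫_ℂ
      simp only [inner_sub_left, inner_sub_right, M.symm]
    · change 0 ≤ (⟪D p - D (D p), p⟫_ℂ).re
      rw [M.inner_sq, ← Complex.ofReal_pow, Complex.ofReal_re]
      positivity
  refine ⟨CFC.sqrt (D - D * D), CFC.sqrt_nonneg _, CFC.sqrt_mul_sqrt_self _ hK, ?_⟩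
  have hc : Commute (D - D * D) D :=
    (Commute.refl D).sub_left ((Commute.refl D).mul_left (Commute.refl D))
  exact hc.cfcₙ_nnreal _

/-- A conjugation which commutes with `b` and intertwines `D` with `1 - D`. -/
lemma exists_conjugation (M : IsModularPair D b G H) :
    ∃ j : E →L⋆[ℂ] E, (∀ p, j (j p) = p) ∧ (∀ p q, ⟪j p, j q⟫_ℂ = ⟪q, p⟫_ℂ) ∧
      (∀ p, j (b p) = b (j p)) ∧ (∀ p, j (D p) = j p - D (j p)) ∧
      ∀ p, 0 ≤ (⟪D p, j (b p)⟫_ℂ).re := by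
  obtain ⟨k, hk, hkk, hkD⟩ := M.exists_sqrt
  have hkk' : ∀ p, k (k p) = D p - D (D p) := fun p => congrArg (fun T : E →L[ℂ] E => T p) hkk
  have hkD' : ∀ p, k (D p) = D (k p) := fun p => congrArg (fun T : E →L[ℂ] E => T p) hkD
  have hkp := (ContinuousLinearMap.nonneg_iff_isPositive k).mp hk
  have hks : ∀ p q, ⟪k p, q⟫_ℂ = ⟪p, k q⟫_ℂ := hkp.inner_left_eq_inner_right
  have hdk2 : DenseRange fun p => k (k p) := by
    simp only [hkk']; exact M.denseRange_sq
  have hdk : DenseRange k := hdk2.mono (by rintro _ ⟨p, rfl⟩; exact ⟨k p, rfl⟩)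
  have hnorm : ∀ p, ‖b p‖ = ‖k p‖ := fun p => by
    have h1 := M.inner_sq p
    rw [← hkk', hks, inner_self_eq_norm_sq_to_K] at h1
    have h2 : ‖k p‖ ^ 2 = ‖b p‖ ^ 2 := Complex.ofReal_injective (by push_cast; exact h1)
    exact ((sq_eq_sq₀ (norm_nonneg _) (norm_nonneg _)).mp h2).symm
  -- The polar decomposition b = jk: since ‖bp‖ = ‖kp‖ and k has dense range, kp ↦ bp extends to an
  -- antilinear isometry.
  let j : E →L⋆[ℂ] E := b.toLinearMap.extendOfNorm k.toLinearMap
  have hjk : ∀ p, j (k p) = b p := fun p =>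
    LinearMap.extendOfNorm_eq hdk ⟨1, fun x => by simpa using (hnorm x).le⟩ p
  have hjn : ∀ p, ‖j p‖ = ‖p‖ := hdk.eq_of_forall (by fun_prop) (by fun_prop) fun p => by
    rw [hjk, hnorm]
  have hji : ∀ p q, ⟪j p, j q⟫_ℂ = ⟪q, p⟫_ℂ := fun p q => by
    refine hdk.eq_of_forall (f := fun p => ⟪j p, j q⟫_ℂ) (g := fun p => ⟪q, p⟫_ℂ)
      (by fun_prop) (by fun_prop) (fun p => ?_) p
    refine hdk.eq_of_forall (f := fun q => ⟪j (k p), j q⟫_ℂ) (g := fun q => ⟪q, k p⟫_ℂ)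
      (by fun_prop) (by fun_prop) (fun q => ?_) q
    rw [hjk, hjk, M.inner_eq, M.sq_eq, ← hkk', hks]
  have hjK : ∀ p, j (k (k p)) = k (k (j p)) :=
    hdk.eq_of_forall (by fun_prop) (by fun_prop) fun p => by
      rw [hjk, hjk, hkk', hkk', M.comm_sq]
  let l : E →ₛₗᵢ[starRingEnd ℂ] E := ⟨j.toLinearMap, hjn⟩
  have hl : Function.Surjective l := by
    rw [← Set.range_eq_univ, ← l.isometry.isClosedEmbedding.isClosed_range.closure_eq]
    refine (M.denseRange.mono ?_).closure_eq
    rintro _ ⟨p, rfl⟩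
    exact ⟨k p, hjk p⟩
  let L := LinearIsometryEquiv.ofSurjective l hl
  let i : E →L⋆[ℂ] E := L.symm.toContinuousLinearEquiv
  have hjj : ∀ p, j (i p) = p := fun p => L.apply_symm_apply p
  have hij : ∀ p, i (j p) = p := fun p => L.symm_apply_apply p
  let k' : E →L[ℂ] E := (j.comp k).comp i
  have hk' : 0 ≤ k' := by
    rw [ContinuousLinearMap.nonneg_iff_isPositive, ContinuousLinearMap.isPositive_def]
    have h1 : ∀ p q, ⟪k' p, q⟫_ℂ = ⟪i q, k (i p)⟫_ℂ := fun p q => by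
      rw [← hji (k (i p)), hjj]; rfl
    refine ⟨fun p q => ?_, fun p => ?_⟩
    · change ⟪k' p, q⟫_ℂ = ⟪p, k' q⟫_ℂ
      rw [← inner_conj_symm p, h1, h1, inner_conj_symm, hks]
    · change 0 ≤ (⟪k' p, p⟫_ℂ).re
      rw [h1]
      exact hkp.re_inner_nonneg_right _
  -- Because j commutes with D - D², both k and jkj⁻¹ are positive square roots of D - D², hence
  -- equal.
  have hk'k : k' = k := by
    refine (CFC.mul_self_eq_mul_self_iff k' k hk' hk).mp (ContinuousLinearMap.ext fun p => ?_)
    change j (k (i (j (k (i p))))) = k (k p)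
    rw [hij, hjK, hjj]
  have hcomm : ∀ p, j (k p) = k (j p) := fun p => by
    have h1 : k' (j p) = k (j p) := by rw [hk'k]
    rw [← h1]
    change _ = j (k (i (j p)))
    rw [hij]
  -- On the dense range of k², j²k² = (jk)² = b² = k².
  have hinv : ∀ p, j (j p) = p := hdk2.eq_of_forall (by fun_prop) (by fun_prop) fun p => by
    rw [hcomm, hcomm, hcomm, hcomm, ← hcomm, ← hcomm, hjk, ← hcomm, hjk, M.sq_eq, hkk']
  have hjb : ∀ p, j (b p) = k p := fun p => by rw [← hjk, hinv]
  refine ⟨j, hinv, hji, fun p => ?_, ?_, fun p => ?_⟩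
  · rw [hjb, ← hjk, hcomm, hinv]
  -- On the range of k: jDk = jkD = bD = (1 - D)b = (1 - D)jk.
  · refine hdk.eq_of_forall (by fun_prop) (by fun_prop) fun p => ?_
    rw [← hkD', hjk, hjk, M.comm]
  · rw [hjb, ← hks]
    have hD : 0 ≤ D := by
      rw [ContinuousLinearMap.nonneg_iff_isPositive, ContinuousLinearMap.isPositive_def]
      exact ⟨M.symm, M.nonneg⟩
    exact ((ContinuousLinearMap.nonneg_iff_isPositive _).mp
      (Commute.mul_nonneg hk hD hkD)).re_inner_nonneg_left p

/-- The cutoff of any pair of G has the form (Dq, bq), and of any pair of H the form (q - Dq, bq).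
These are therefore cores, on which the claims reduce to the algebra of j, D and b. -/
lemma exists_isConjugation (M : IsModularPair D b G H) : ∃ j, IsConjugation G H j := by
  obtain ⟨j, h1, h2, h3, h4, h5⟩ := M.exists_conjugation
  have hcore : ∀ n {p p'}, (p, p') ∈ G → ∃ q, M.cutoff n p = D q ∧ M.cutoff n p' = b q :=
    fun n p p' hp => ⟨M.resolvent n p - D (M.resolvent n p), by rw [map_sub]; rfl, by
      rw [← M.regularization.apply_eq n hp]; rfl⟩
  have hcore' : ∀ n {p p'}, (p, p') ∈ H → ∃ q, M.cutoff n p = q - D q ∧ M.cutoff n p' = b q :=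
    fun n p p' hp => ⟨D (M.resolvent n p), rfl, by
      rw [← M.regularization.swap.apply_eq n hp]; rfl⟩
  have htend : ∀ p p', Filter.Tendsto (fun n => (M.cutoff n p, M.cutoff n p')) Filter.atTop
      (nhds (p, p')) := fun p p' => (M.tendsto_cutoff p).prodMk_nhds (M.tendsto_cutoff p')
  have hj2 : Continuous fun w : E × E => (j w.1, j w.2) := by fun_prop
  refine ⟨j, h1, h2, fun {p p'} hp => ?_, fun {p p'} hp => ?_, fun {p p'} hp => ?_⟩
  · refine M.isClosed'.mem_of_tendsto ((hj2.tendsto _).comp (htend p p'))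
      (Filter.Eventually.of_forall fun n => ?_)
    obtain ⟨q, hq, hq'⟩ := hcore n hp
    simp only [Function.comp_apply, hq, hq', h3, h4]
    exact M.mem' _
  · refine M.isClosed.mem_of_tendsto ((hj2.tendsto _).comp (htend p p'))
      (Filter.Eventually.of_forall fun n => ?_)
    obtain ⟨q, hq, hq'⟩ := hcore' n hp
    simp only [Function.comp_apply, hq, hq', h3, map_sub, h4, sub_sub_cancel]
    exact M.mem _
  · have hc : Continuous fun w : E × E => (⟪w.1, j w.2⟫_ℂ).re :=
      Complex.continuous_re.comp (by fun_prop)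
    refine ge_of_tendsto ((hc.tendsto _).comp (htend p p')) (Filter.Eventually.of_forall fun n => ?_)
    obtain ⟨q, hq, hq'⟩ := hcore n hp
    simp only [Function.comp_apply, hq, hq']
    exact h5 q

end IsModularPair

end

end FermiFock

end

/-! ### Left and right field operators on the exterior algebra of 𝔥. -/

noncomputable section

namespace FermiFock

variable {V : Type*} [AddCommGroup V] [Module ℂ V]

lemma lcontr_comm (d d' : Module.Dual ℂ V) (x : ExteriorAlgebra ℂ V) :
    lcontr d (lcontr d' x) = -lcontr d' (lcontr d x) :=
  CliffordAlgebra.contractLeft_comm (Q := (0 : QuadraticForm ℂ V)) d d' x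

lemma rcontr_comm (d d' : Module.Dual ℂ V) (x : ExteriorAlgebra ℂ V) :
    rcontr d (rcontr d' x) = -rcontr d' (rcontr d x) :=
  CliffordAlgebra.contractRight_comm (Q := (0 : QuadraticForm ℂ V)) d' d x

end FermiFock

namespace SelfDualCAR

open ExteriorAlgebra FermiFock OpGraph

variable {𝔥 : Type*} [NormedAddCommGroup 𝔥] [InnerProductSpace ℂ 𝔥]
variable {Γ : 𝔥 →ₗ⋆[ℂ] 𝔥} {𝔭 𝔮 : Submodule ℂ 𝔥} [𝔭.HasOrthogonalProjection]

section

lemma IsAntiunitaryInvolution.inner_left (hΓ : IsAntiunitaryInvolution Γ) (f g : 𝔥) :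
    ⟪Γ f, g⟫_ℂ = ⟪Γ g, f⟫_ℂ := by
  rw [← hΓ.inner_map, hΓ.involutive]

variable (Γ 𝔭)

/-- The functional `g ↦ ⟪P Γ f, P g⟫`. -/
def leftFunctional (f : 𝔥) : Module.Dual ℂ 𝔥 := innerₛₗ ℂ (𝔭.starProjection (Γ f))

/-- The functional `g ↦ ⟪P Γ g, P f⟫`. -/
def rightFunctional (f : 𝔥) : Module.Dual ℂ 𝔥 := innerₛₗ ℂ (Γ (𝔭.starProjection f))

/-- The field operator of `f`, acting from the left on the exterior algebra of `𝔥`. -/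
def leftField (f : 𝔥) : Module.End ℂ (ExteriorAlgebra ℂ 𝔥) :=
  LinearMap.mulLeft ℂ (ι ℂ f) + lcontr (leftFunctional Γ 𝔭 f)

/-- The field operator of `f`, acting from the right on the exterior algebra of `𝔥`. -/
def rightField (f : 𝔥) : Module.End ℂ (ExteriorAlgebra ℂ 𝔥) :=
  LinearMap.mulRight ℂ (ι ℂ f) + rcontr (rightFunctional Γ 𝔭 f)

lemma leftField_apply (f : 𝔥) (x : ExteriorAlgebra ℂ 𝔥) :
    leftField Γ 𝔭 f x = ι ℂ f * x + lcontr (leftFunctional Γ 𝔭 f) x := rfl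

lemma rightField_apply (f : 𝔥) (x : ExteriorAlgebra ℂ 𝔥) :
    rightField Γ 𝔭 f x = x * ι ℂ f + rcontr (rightFunctional Γ 𝔭 f) x := rfl

variable {Γ}

lemma leftFunctional_apply (hΓ : IsAntiunitaryInvolution Γ) (f g : 𝔥) :
    leftFunctional Γ 𝔭 f g = rightFunctional Γ 𝔭 g f := by
  change ⟪𝔭.starProjection (Γ f), g⟫_ℂ = ⟪Γ (𝔭.starProjection g), f⟫_ℂ
  rw [hΓ.inner_left, 𝔭.inner_starProjection_left_eq_right]

/-- Both orders produce one parity term, with coefficient the left functional of f at g in one case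
and the right functional of g at f in the other. The functionals are chosen so that these agree. -/
lemma leftField_rightField (hΓ : IsAntiunitaryInvolution Γ) (f g : 𝔥) :
    Commute (rightField Γ 𝔭 g) (leftField Γ 𝔭 f) := by
  refine LinearMap.ext fun x => ?_
  change rightField Γ 𝔭 g (leftField Γ 𝔭 f x) = leftField Γ 𝔭 f (rightField Γ 𝔭 g x)
  simp only [leftField_apply, rightField_apply, map_add, lcontr_mul_ι, rcontr_ι_mul,
    rcontr_lcontr, leftFunctional_apply 𝔭 hΓ, mul_assoc]
  abel

/-- A right field and the left field of the same vector agree on 1, and right fields pass through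
left fields. Converting them one at a time reverses the order, as taking the adjoint of a product
does. -/
lemma rightField_list (hΓ : IsAntiunitaryInvolution Γ) (σ : ℂ) (l : List 𝔥) :
    (l.map fun f => σ • rightField Γ 𝔭 (Γ f)).prod 1 =
      σ ^ l.length • (l.reverse.map fun f => leftField Γ 𝔭 (Γ f)).prod 1 := by
  induction l with
  | nil => simp
  | cons f l ih =>
    have hc : Commute (rightField Γ 𝔭 (Γ f)) (l.reverse.map fun f => leftField Γ 𝔭 (Γ f)).prod :=
      Commute.list_prod_right _ _ fun T hT => by
        obtain ⟨g, _, rfl⟩ := List.mem_map.mp hT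
        exact leftField_rightField 𝔭 hΓ _ _
    have h1 : rightField Γ 𝔭 (Γ f) 1 = leftField Γ 𝔭 (Γ f) 1 := by
      rw [leftField_apply, rightField_apply, lcontr_one, rcontr_one, one_mul, mul_one]
    rw [List.map_cons, List.prod_cons, Module.End.mul_apply, ih, LinearMap.smul_apply, map_smul,
      ← Module.End.mul_apply, hc.eq, Module.End.mul_apply, h1, smul_smul, List.reverse_cons,
      List.map_append, List.prod_append, List.length_cons, pow_succ']
    simp

variable (Γ)

/-- The antilinear relation generated by left field operators `φ(f)` in the first and `σ` times the
right field operators `φ(Γ f)` in the second component, with `f ∈ 𝔯`. -/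
inductive FieldRel (σ : ℂ) (𝔯 : Submodule ℂ 𝔥) : ExteriorAlgebra ℂ 𝔥 → ExteriorAlgebra ℂ 𝔥 → Prop
  | one : FieldRel σ 𝔯 1 1
  | add {x y x' y'} : FieldRel σ 𝔯 x y → FieldRel σ 𝔯 x' y' → FieldRel σ 𝔯 (x + x') (y + y')
  | smul (c : ℂ) {x y} : FieldRel σ 𝔯 x y → FieldRel σ 𝔯 (c • x) (star c • y)
  | mul {f x y} : f ∈ 𝔯 → FieldRel σ 𝔯 x y →
      FieldRel σ 𝔯 (leftField Γ 𝔭 f x) (σ • rightField Γ 𝔭 (Γ f) y)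

/-- The graph of `σ Γ` on `𝔯`. -/
def conjGraph (σ : ℂ) (𝔯 : Submodule ℂ 𝔥) : Set (𝔥 × 𝔥) := {w | w.1 ∈ 𝔯 ∧ w.2 = σ • Γ w.1}

variable {Γ}

lemma star_leftFunctional (hΓ : IsAntiunitaryInvolution Γ) {σ : ℂ} (hσ : σ * σ = 1) {𝔯 : Submodule ℂ 𝔥}
    (f p p' : 𝔥) (hp : (p, p') ∈ conjGraph Γ σ 𝔯) :
    star (leftFunctional Γ 𝔭 f p) = (σ • rightFunctional Γ 𝔭 (Γ f)) p' := by
  obtain rfl : p' = σ • Γ p := hp.2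
  rw [LinearMap.smul_apply, map_smul, smul_smul, hσ, one_smul]
  change (starRingEnd ℂ) ⟪𝔭.starProjection (Γ f), p⟫_ℂ = ⟪Γ (𝔭.starProjection (Γ f)), Γ p⟫_ℂ
  rw [inner_conj_symm, hΓ.inner_map]

/-- One half of the comparison of field monomials with wedge products: a field is a multiplication
plus a contraction, and the wedge relation is stable under both. The condition σ² = 1 matches the
two contractions. -/
lemma antiRel_field (hΓ : IsAntiunitaryInvolution Γ) {σ : ℂ} (hσ : σ * σ = 1) {𝔯 : Submodule ℂ 𝔥}
    {f : 𝔥} (hf : f ∈ 𝔯) {x y : ExteriorAlgebra ℂ 𝔥} (h : AntiRel (conjGraph Γ σ 𝔯) x y) :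
    AntiRel (conjGraph Γ σ 𝔯) (leftField Γ 𝔭 f x) (σ • rightField Γ 𝔭 (Γ f) y) := by
  have h1 := AntiRel.mul (p := f) (p' := σ • Γ f) (G := conjGraph Γ σ 𝔯) ⟨hf, rfl⟩ h
  have h2 := h.contr (star_leftFunctional 𝔭 hΓ hσ f)
  convert h1.add h2 using 1
  · rfl
  rw [rightField_apply, rcontr_smul, map_smul, mul_smul_comm, smul_add]

namespace FieldRel

variable {σ : ℂ} {𝔯 : Submodule ℂ 𝔥} {x y : ExteriorAlgebra ℂ 𝔥} {𝔭}

lemma sub {x' y'} (h : FieldRel Γ 𝔭 σ 𝔯 x y) (h' : FieldRel Γ 𝔭 σ 𝔯 x' y') :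
    FieldRel Γ 𝔭 σ 𝔯 (x - x') (y - y') := by
  simpa [sub_eq_add_neg] using h.add (h'.smul (-1))

/-- Contractions anticommute among themselves and with multiplications up to scalars, so a
contraction moves through a field monomial, leaving shorter ones. -/
lemma contr {d d' : Module.Dual ℂ 𝔥}
    (hd : ∀ p p', (p, p') ∈ conjGraph Γ σ 𝔯 → star (d p) = d' p') (h : FieldRel Γ 𝔭 σ 𝔯 x y) :
    FieldRel Γ 𝔭 σ 𝔯 (lcontr d x) (rcontr d' y) := by
  induction h with
  | one => rw [lcontr_one, rcontr_one]; simpa using FieldRel.smul 0 (FieldRel.one (Γ := Γ))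
  | add _ _ h1 h2 => simp only [map_add]; exact h1.add h2
  | smul c _ h => simp only [map_smul]; exact h.smul c
  | @mul f x y hf h ih =>
    have h1 : lcontr d (leftField Γ 𝔭 f x) = d f • x - leftField Γ 𝔭 f (lcontr d x) := by
      have h3 : lcontr d (lcontr (leftFunctional Γ 𝔭 f) x) =
          -lcontr (leftFunctional Γ 𝔭 f) (lcontr d x) :=
        lcontr_comm _ _ x
      rw [leftField_apply, leftField_apply, map_add, lcontr_ι_mul, h3]
      abel
    have h2 : rcontr d' (σ • rightField Γ 𝔭 (Γ f) y) =
        star (d f) • y - σ • rightField Γ 𝔭 (Γ f) (rcontr d' y) := by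
      have h3 : rcontr d' (rcontr (rightFunctional Γ 𝔭 (Γ f)) y) =
          -rcontr (rightFunctional Γ 𝔭 (Γ f)) (rcontr d' y) :=
        rcontr_comm _ _ y
      rw [hd f (σ • Γ f) ⟨hf, rfl⟩, map_smul d', smul_eq_mul, mul_smul, ← smul_sub, map_smul,
        rightField_apply, rightField_apply, map_add, rcontr_mul_ι, h3]
      congr 1
      abel
    rw [h1, h2]
    exact (h.smul _).sub (ih.mul hf)

/-- The other half, Wick ordering: p ∧ x is the field of p applied to x minus a contraction of x,
and the field relation is stable under contractions. -/
lemma of_antiRel (hΓ : IsAntiunitaryInvolution Γ) (hσ : σ * σ = 1)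
    (h : AntiRel (conjGraph Γ σ 𝔯) x y) : FieldRel Γ 𝔭 σ 𝔯 x y := by
  induction h with
  | one => exact .one
  | add _ _ h1 h2 => exact h1.add h2
  | smul c _ h => exact h.smul c
  | @mul p p' x y hp _ h =>
    have h2 := (h.mul hp.1).sub (h.contr (star_leftFunctional 𝔭 hΓ hσ p))
    convert h2 using 1
    · rw [leftField_apply, add_sub_cancel_right]
    · rw [show p' = σ • Γ p from hp.2, rightField_apply, rcontr_smul, map_smul, mul_smul_comm,
        smul_add, add_sub_cancel_right]

lemma list_induction {N : ExteriorAlgebra ℂ 𝔥 → ExteriorAlgebra ℂ 𝔥 → Prop}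
    (add : ∀ x y x' y', N x y → N x' y' → N (x + x') (y + y'))
    (smul : ∀ (c : ℂ) x y, N x y → N (c • x) (star c • y))
    (list : ∀ l : List 𝔥, (∀ f ∈ l, f ∈ 𝔯) → N ((l.map (leftField Γ 𝔭)).prod 1)
      ((l.map fun f => σ • rightField Γ 𝔭 (Γ f)).prod 1))
    (h : FieldRel Γ 𝔭 σ 𝔯 x y) : N x y := by
  suffices ∀ l : List 𝔥, (∀ f ∈ l, f ∈ 𝔯) → N ((l.map (leftField Γ 𝔭)).prod x)
      ((l.map fun f => σ • rightField Γ 𝔭 (Γ f)).prod y) by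
    simpa using this [] (by simp)
  induction h with
  | one => exact list
  | add _ _ h1 h2 =>
    intro l hl; rw [map_add, map_add]; exact add _ _ _ _ (h1 l hl) (h2 l hl)
  | smul c _ h => intro l hl; rw [map_smul, map_smul]; exact smul c _ _ (h l hl)
  | @mul f x y hf _ h =>
    intro l hl
    have := h (l ++ [f]) (by simpa [or_imp, forall_and] using ⟨hl, hf⟩)
    simpa using this

end FieldRel

end

end SelfDualCAR

end

/-! ### Fields and parity on the Fock space over 𝔭. -/

noncomputable section

namespace FermiFock

open ExteriorAlgebra

section

variable {E : Type*} [NormedAddCommGroup E] [InnerProductSpace ℂ E]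

lemma create_coe (p : E) (x : ExteriorAlgebra ℂ E) :
    create p (x : Fock E) = ((ι ℂ p * x : ExteriorAlgebra ℂ E) : Fock E) :=
  ContinuousLinearMap.completion_apply_coe _ x

lemma annihilate_coe (p : E) (x : ExteriorAlgebra ℂ E) :
    annihilate p (x : Fock E) = (contr p x : ExteriorAlgebra ℂ E) :=
  ContinuousLinearMap.completion_apply_coe _ x

lemma inner_create_left (p : E) (x y : Fock E) : ⟪create p x, y⟫_ℂ = ⟪x, annihilate p y⟫_ℂ := by
  induction x, y using UniformSpace.Completion.induction_on₂ with
  | hp => exact isClosed_eq (by fun_prop) (by fun_prop)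
  | ih x y =>
    rw [create_coe, annihilate_coe, UniformSpace.Completion.inner_coe,
      UniformSpace.Completion.inner_coe]
    exact form_ι_mul_left p x y

variable (E) in
/-- The parity operator on the Fock space. -/
def fockParity : Fock E →L[ℂ] Fock E := fockMap (-LinearMap.id)

lemma fockParity_coe (x : ExteriorAlgebra ℂ E) :
    fockParity E (x : Fock E) = (parity x : ExteriorAlgebra ℂ E) :=
  fockMap_coe (fun x => norm_map_le (by simp) (by simp) x) x

lemma fockParity_vacuum : fockParity E vacuum = vacuum := by
  rw [vacuum, fockParity_coe, map_one]

lemma inner_fockParity_left (x y : Fock E) :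
    ⟪fockParity E x, y⟫_ℂ = ⟪x, fockParity E y⟫_ℂ := by
  induction x, y using UniformSpace.Completion.induction_on₂ with
  | hp => exact isClosed_eq (by fun_prop) (by fun_prop)
  | ih x y =>
    rw [fockParity_coe, fockParity_coe, UniformSpace.Completion.inner_coe,
      UniformSpace.Completion.inner_coe]
    exact form_map (by simp) x y

lemma adjoint_fockParity : ContinuousLinearMap.adjoint (fockParity E) = fockParity E :=
  ((ContinuousLinearMap.eq_adjoint_iff _ _).mpr inner_fockParity_left).symm

lemma fockParity_pow_vacuum (k : ℕ) : (fockParity E ^ k) vacuum = vacuum := by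
  induction k with
  | zero => rfl
  | succ k ih => rw [pow_succ, mul_apply_eq_comp, fockParity_vacuum, ih]

lemma fockParity_create (p : E) (x : Fock E) :
    fockParity E (create p x) = -create p (fockParity E x) := by
  refine eq_of_coe (f := fun x => fockParity E (create p x))
    (g := fun x => -create p (fockParity E x)) (by fun_prop) (by fun_prop) (fun x => ?_) x
  simp only [create_coe, fockParity_coe, parity_ι_mul, UniformSpace.Completion.coe_neg]

lemma fockParity_annihilate (p : E) (x : Fock E) :
    fockParity E (annihilate p x) = -annihilate p (fockParity E x) := by
  refine eq_of_coe (f := fun x => fockParity E (annihilate p x))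
    (g := fun x => -annihilate p (fockParity E x)) (by fun_prop) (by fun_prop) (fun x => ?_) x
  simp only [annihilate_coe, fockParity_coe, contr_eq_lcontr, lcontr_parity,
    UniformSpace.Completion.coe_neg, neg_neg]

end

end FermiFock

namespace SelfDualCAR

open ExteriorAlgebra FermiFock OpGraph

variable {𝔥 : Type*} [NormedAddCommGroup 𝔥] [InnerProductSpace ℂ 𝔥]
variable {Γ : 𝔥 →ₗ⋆[ℂ] 𝔥} {𝔭 𝔮 : Submodule ℂ 𝔥} [𝔭.HasOrthogonalProjection]

section

lemma a_coe (f : 𝔥) (x : ExteriorAlgebra ℂ 𝔭) : a Γ 𝔭 f (x : Fock 𝔭) =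
    ((ι ℂ (proj 𝔭 (Γ f)) * x + contr (proj 𝔭 f) x : ExteriorAlgebra ℂ 𝔭) : Fock 𝔭) := by
  rw [UniformSpace.Completion.coe_add, ← create_coe, ← annihilate_coe]; rfl

lemma fockParity_mul_a (f : 𝔥) : fockParity 𝔭 * a Γ 𝔭 f = (-1 : ℂ) • (a Γ 𝔭 f * fockParity 𝔭) := by
  refine ContinuousLinearMap.ext fun x => ?_
  change fockParity 𝔭 (create _ x + annihilate _ x) =
    (-1 : ℂ) • (create _ (fockParity 𝔭 x) + annihilate _ (fockParity 𝔭 x))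
  rw [map_add, fockParity_create, fockParity_annihilate, smul_add, neg_one_smul, neg_one_smul]

lemma adjoint_a (hΓ : IsAntiunitaryInvolution Γ) (f : 𝔥) :
    ContinuousLinearMap.adjoint (a Γ 𝔭 f) = a Γ 𝔭 (Γ f) := by
  refine ((ContinuousLinearMap.eq_adjoint_iff _ _).mpr fun x y => ?_).symm
  change ⟪create (proj 𝔭 (Γ (Γ f))) x + annihilate (proj 𝔭 (Γ f)) x, y⟫_ℂ =
    ⟪x, create (proj 𝔭 (Γ f)) y + annihilate (proj 𝔭 f) y⟫_ℂ
  rw [hΓ.involutive, inner_add_left, inner_add_right, inner_create_left, add_comm,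
    ← inner_conj_symm, ← inner_create_left, inner_conj_symm]

lemma inner_proj_conj (hΓ : IsAntiunitaryInvolution Γ) (hP : IsBasisProjection Γ 𝔭) (f g : 𝔥) :
    ⟪proj 𝔭 f, proj 𝔭 (Γ g)⟫_ℂ + ⟪proj 𝔭 g, proj 𝔭 (Γ f)⟫_ℂ = ⟪f, Γ g⟫_ℂ := by
  have h1 : ⟪proj 𝔭 g, proj 𝔭 (Γ f)⟫_ℂ = ⟪Γ (𝔭.starProjection (Γ f)), Γ g⟫_ℂ := by
    rw [hΓ.inner_map, Submodule.inner_orthogonalProjectionOnto_eq_of_mem_right]; rfl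
  rw [h1, Submodule.inner_orthogonalProjectionOnto_eq_of_mem_left]
  change ⟪𝔭.starProjection f, Γ g⟫_ℂ + _ = _
  rw [← inner_add_left, hP]

/-- The anticommutation relation of two fields with vanishing anticommutator. -/
lemma a_mul_a (hΓ : IsAntiunitaryInvolution Γ) (hP : IsBasisProjection Γ 𝔭) {f g : 𝔥}
    (h : ⟪f, Γ g⟫_ℂ = 0) : a Γ 𝔭 f * a Γ 𝔭 g = (-1 : ℂ) • (a Γ 𝔭 g * a Γ 𝔭 f) := by
  refine ContinuousLinearMap.ext (eq_of_coe (ContinuousLinearMap.continuous _)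
    (ContinuousLinearMap.continuous _) fun x => ?_)
  rw [smul_apply, mul_apply_eq_comp, mul_apply_eq_comp, a_coe, a_coe, a_coe, a_coe,
    ← UniformSpace.Completion.coe_smul]
  congr 1
  have h1 := inner_proj_conj hΓ hP f g
  rw [h] at h1
  have h2 : ι ℂ (proj 𝔭 (Γ f)) * (ι ℂ (proj 𝔭 (Γ g)) * x) =
      -(ι ℂ (proj 𝔭 (Γ g)) * (ι ℂ (proj 𝔭 (Γ f)) * x)) := by
    rw [← mul_assoc, ← mul_assoc, ← neg_mul]
    congr 1
    exact eq_neg_of_add_eq_zero_left (ι_add_mul_swap _ _)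
  have h3 : contr (proj 𝔭 f) (contr (proj 𝔭 g) x) = -contr (proj 𝔭 g) (contr (proj 𝔭 f) x) :=
    lcontr_comm _ _ x
  simp only [map_add, mul_add, contr_ι_mul, neg_one_smul]
  rw [h2, h3, eq_neg_of_add_eq_zero_left h1, neg_smul]
  abel

/-- The map of exterior algebras induced by the orthogonal projection onto `𝔭`, followed by the
embedding into the Fock space. -/
def projFock (𝔭 : Submodule ℂ 𝔥) [𝔭.HasOrthogonalProjection] :
    ExteriorAlgebra ℂ 𝔥 →ₗ[ℂ] Fock 𝔭 :=
  (UniformSpace.Completion.toComplL (𝕜 := ℂ) (E := ExteriorAlgebra ℂ 𝔭)).toLinearMap ∘ₗ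
    (map 𝔭.orthogonalProjectionOnto.toLinearMap).toLinearMap

lemma projFock_apply (x : ExteriorAlgebra ℂ 𝔥) :
    projFock 𝔭 x = (map 𝔭.orthogonalProjectionOnto.toLinearMap x : ExteriorAlgebra ℂ 𝔭) := rfl

lemma projFock_leftField (hΓ : IsAntiunitaryInvolution Γ) (f : 𝔥) (x : ExteriorAlgebra ℂ 𝔥) :
    projFock 𝔭 (leftField Γ 𝔭 f x) = a Γ 𝔭 (Γ f) (projFock 𝔭 x) := by
  have h1 : map 𝔭.orthogonalProjectionOnto.toLinearMap (lcontr (leftFunctional Γ 𝔭 f) x) =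
      contr (proj 𝔭 (Γ f)) (map 𝔭.orthogonalProjectionOnto.toLinearMap x) := by
    induction x using left_induction with
    | one => rw [lcontr_one, map_one, contr_one, map_zero]
    | smul c x h => simp only [map_smul, h]
    | add x y hx hy => simp only [map_add, hx, hy]
    | mul q x h =>
      rw [lcontr_ι_mul, map_sub, map_smul, map_ι_mul, map_ι_mul, contr_ι_mul, h]
      congr 2
      exact (Submodule.inner_orthogonalProjectionOnto_eq_of_mem_left _ _).symm
  rw [projFock_apply, projFock_apply, leftField_apply, a_coe, hΓ.involutive, map_add, h1, map_ι_mul]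
  rfl

lemma projFock_list (hΓ : IsAntiunitaryInvolution Γ) (l : List 𝔥) :
    projFock 𝔭 ((l.map (leftField Γ 𝔭)).prod 1) = (l.map fun f => a Γ 𝔭 (Γ f)).prod vacuum := by
  induction l with
  | nil => simp [projFock_apply, vacuum]
  | cons f l ih =>
    simp only [List.map_cons, List.prod_cons, Module.End.mul_apply, mul_apply_eq_comp]
    rw [projFock_leftField hΓ, ih]

variable (Γ 𝔭) in
/-- The graph of the antilinear operator `P f ↦ σ P Γ f`, for `f ∈ 𝔯`. -/
def fieldGraph (σ : ℂ) (𝔯 : Submodule ℂ 𝔥) : Set (𝔭 × 𝔭) :=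
  {w | ∃ f ∈ 𝔯, w = (proj 𝔭 f, σ • proj 𝔭 (Γ f))}

lemma projFock_rightField_list (hΓ : IsAntiunitaryInvolution Γ) (σ : ℂ) (l : List 𝔥) :
    projFock 𝔭 ((l.map fun f => σ • rightField Γ 𝔭 (Γ f)).prod 1) =
      σ ^ l.length • (l.reverse.map (a Γ 𝔭)).prod vacuum := by
  have h1 := projFock_list (𝔭 := 𝔭) hΓ (l.reverse.map Γ)
  simp only [List.map_map, Function.comp_def, hΓ.involutive] at h1
  rw [rightField_list 𝔭 hΓ, map_smul, h1]

lemma list_mem_antiFock (hΓ : IsAntiunitaryInvolution Γ) {σ : ℂ} (hσ : σ * σ = 1)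
    {𝔯 : Submodule ℂ 𝔥} (l : List 𝔥) (hl : ∀ f ∈ l, f ∈ 𝔯) :
    ((l.map fun f => a Γ 𝔭 (Γ f)).prod vacuum,
      σ ^ l.length • (l.reverse.map (a Γ 𝔭)).prod vacuum) ∈ antiFock (fieldGraph Γ 𝔭 σ 𝔯) := by
  have h1 : AntiRel (conjGraph Γ σ 𝔯) ((l.map (leftField Γ 𝔭)).prod 1)
      ((l.map fun f => σ • rightField Γ 𝔭 (Γ f)).prod 1) := by
    induction l with
    | nil => simpa using AntiRel.one
    | cons f l ih =>
      simp only [List.mem_cons, forall_eq_or_imp] at hl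
      exact antiRel_field 𝔭 hΓ hσ hl.1 (ih hl.2)
  rw [← projFock_list hΓ, ← projFock_rightField_list hΓ]
  refine ⟨_, _, h1.map (f := 𝔭.orthogonalProjectionOnto.toLinearMap)
    (g := 𝔭.orthogonalProjectionOnto.toLinearMap) (H := fieldGraph Γ 𝔭 σ 𝔯) ?_, rfl⟩
  intro p p' hp
  refine ⟨p, hp.1, ?_⟩
  rw [show p' = σ • Γ p from hp.2, map_smul]; rfl

/-- Lifted to the exterior algebra of 𝔥, every pair built from wedge products becomes a combination
of pairs of field monomials, where membership in S or S^* can be tested. -/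
lemma antiFock_fieldGraph_induction (hΓ : IsAntiunitaryInvolution Γ) {σ : ℂ} (hσ : σ * σ = 1)
    {𝔯 : Submodule ℂ 𝔥} {N : Fock 𝔭 → Fock 𝔭 → Prop}
    (add : ∀ x y x' y', N x y → N x' y' → N (x + x') (y + y'))
    (smul : ∀ (c : ℂ) x y, N x y → N (c • x) (star c • y))
    (list : ∀ l : List 𝔥, (∀ f ∈ l, f ∈ 𝔯) → N ((l.map fun f => a Γ 𝔭 (Γ f)).prod vacuum)
      (σ ^ l.length • (l.reverse.map (a Γ 𝔭)).prod vacuum)) {x y : Fock 𝔭}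
    (h : (x, y) ∈ antiFock (fieldGraph Γ 𝔭 σ 𝔯)) : N x y := by
  obtain ⟨x, y, hxy, hw⟩ := h
  obtain ⟨rfl, rfl⟩ := Prod.mk.injEq .. ▸ hw
  obtain ⟨x, y, h, rfl, rfl⟩ := hxy.exists_of_map (G := conjGraph Γ σ 𝔯)
    (f := 𝔭.orthogonalProjectionOnto.toLinearMap) (fun p p' hp => by
      obtain ⟨f, hf, hw⟩ := hp
      obtain ⟨rfl, rfl⟩ := Prod.mk.injEq .. ▸ hw
      exact ⟨f, σ • Γ f, ⟨hf, rfl⟩, rfl, by rw [map_smul]; rfl⟩)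
  refine (FieldRel.of_antiRel (𝔭 := 𝔭) hΓ hσ h).list_induction
    (N := fun x y => N (projFock 𝔭 x) (projFock 𝔭 y)) (fun x y x' y' h h' => ?_)
    (fun c x y h => ?_) (fun l hl => ?_)
  · rw [map_add, map_add]; exact add _ _ _ _ h h'
  · rw [map_smul, map_smul]; exact smul _ _ _ h
  · rw [projFock_list hΓ, projFock_rightField_list hΓ]; exact list l hl

end

/-! ### The Tomita operator as a second quantized operator -/

section

lemma mul_list_prod {A ι : Type*} [Ring A] [Algebra ℂ A] {T : A} {F : ι → A} (l : List ι)
    (h : ∀ i ∈ l, T * F i = (-1 : ℂ) • (F i * T)) :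
    T * (l.map F).prod = (-1 : ℂ) ^ l.length • ((l.map F).prod * T) := by
  induction l with
  | nil => simp
  | cons i l ih =>
    simp only [List.mem_cons, forall_eq_or_imp] at h
    rw [List.map_cons, List.prod_cons, ← mul_assoc, h.1, smul_mul_assoc, mul_assoc, ih h.2,
      mul_smul_comm, smul_smul, List.length_cons, pow_succ', mul_assoc]

lemma mul_pow_of_anticomm {A : Type*} [Ring A] [Algebra ℂ A] {T U : A}
    (h : T * U = (-1 : ℂ) • (U * T)) (k : ℕ) : T * U ^ k = (-1 : ℂ) ^ k • (U ^ k * T) := by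
  simpa using mul_list_prod (T := T) (F := fun _ : Unit => U) (List.replicate k ()) fun _ _ => h

lemma mul_comm_of_anticomm {A : Type*} [Ring A] [Algebra ℂ A] {T C W : A} {s : ℂ} (hs : s * s = 1)
    (h : T * C = s • (C * T)) (h' : T * W = s • (W * T)) : T * (C * W) = C * W * T := by
  rw [← mul_assoc, h, smul_mul_assoc, mul_assoc, h', mul_smul_comm, smul_smul, hs, one_smul,
    mul_assoc]

lemma adjoint_list (hΓ : IsAntiunitaryInvolution Γ) (l : List 𝔥) :
    ContinuousLinearMap.adjoint (l.map fun f => a Γ 𝔭 (Γ f)).prod =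
      (l.reverse.map (a Γ 𝔭)).prod := by
  induction l with
  | nil => simp [← ContinuousLinearMap.star_eq_adjoint]
  | cons f l ih =>
    rw [← ContinuousLinearMap.star_eq_adjoint] at ih ⊢
    rw [List.map_cons, List.prod_cons, star_mul, ih, ContinuousLinearMap.star_eq_adjoint,
      adjoint_a hΓ, hΓ.involutive]
    simp

lemma a_mem_M {q : 𝔥} (hq : q ∈ 𝔮) : a Γ 𝔭 q ∈ M Γ 𝔭 𝔮 :=
  Set.subset_centralizer_centralizer ⟨q, hq, rfl⟩

lemma list_mem_M (l : List 𝔥) (hl : ∀ f ∈ l, a Γ 𝔭 (Γ f) ∈ M Γ 𝔭 𝔮) :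
    (l.map fun f => a Γ 𝔭 (Γ f)).prod ∈ M Γ 𝔭 𝔮 := by
  induction l with
  | nil => exact Set.one_mem_centralizer
  | cons f l ih =>
    simp only [List.mem_cons, forall_eq_or_imp] at hl
    exact Set.mul_mem_centralizer hl.1 (ih hl.2)

lemma antiFock_subset_tomita (hΓ : IsAntiunitaryInvolution Γ) (hQ : ∀ q ∈ 𝔮, Γ q ∈ 𝔮) :
    antiFock (fieldGraph Γ 𝔭 1 𝔮) ⊆ tomita Γ 𝔭 𝔮 := by
  rintro ⟨x, y⟩ h
  refine subset_closure (antiFock_fieldGraph_induction (N := fun x y => (x, y) ∈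
    {w | ∃ A ∈ M Γ 𝔭 𝔮, w = (A vacuum, ContinuousLinearMap.adjoint A vacuum)}) hΓ (one_mul 1)
    ?_ ?_ ?_ h)
  · rintro x y x' y' ⟨A, hA, hw⟩ ⟨A', hA', hw'⟩
    refine ⟨A + A', Set.add_mem_centralizer hA hA', ?_⟩
    rw [map_add]
    simpa using congrArg₂ (· + ·) hw hw'
  · rintro c x y ⟨A, hA, hw⟩
    refine ⟨c • A, Set.smul_mem_centralizer c hA, ?_⟩
    obtain ⟨rfl, rfl⟩ := Prod.mk.injEq .. ▸ hw
    rw [LinearIsometryEquiv.map_smulₛₗ]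
    rfl
  · intro l hl
    refine ⟨_, list_mem_M l fun f hf => a_mem_M (hQ f (hl f hf)), ?_⟩
    rw [adjoint_list hΓ, one_pow, one_smul]

/-- Fields of 𝔮 anticommute with the factors of the monomial and also with the parity, so as many
parities as factors cancel the sign. -/
lemma list_mem_centralizer (hΓ : IsAntiunitaryInvolution Γ) (hP : IsBasisProjection Γ 𝔭) (l : List 𝔥)
    (hl : ∀ f ∈ l, f ∈ 𝔮ᗮ) : (l.map fun f => a Γ 𝔭 (Γ f)).prod * fockParity 𝔭 ^ l.length ∈
      Set.centralizer {A | ∃ q ∈ 𝔮, A = a Γ 𝔭 q} := by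
  rintro _ ⟨q, hq, rfl⟩
  have h1 := mul_list_prod (T := a Γ 𝔭 q) (F := fun f => a Γ 𝔭 (Γ f)) l fun f hf =>
    a_mul_a hΓ hP (by rw [hΓ.involutive]; exact (Submodule.mem_orthogonal _ _).mp (hl f hf) q hq)
  have h2 : a Γ 𝔭 q * fockParity 𝔭 = (-1 : ℂ) • (fockParity 𝔭 * a Γ 𝔭 q) := by
    rw [fockParity_mul_a, smul_smul]; simp
  refine mul_comm_of_anticomm ?_ h1 (mul_pow_of_anticomm h2 l.length)
  rw [← mul_pow]
  simp

lemma fockParity_pow_list (l : List 𝔥) : (fockParity 𝔭 ^ l.length) ((l.map (a Γ 𝔭)).prod vacuum) =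
    (-1 : ℂ) ^ l.length • (l.map (a Γ 𝔭)).prod vacuum := by
  have h1 : ∀ k : ℕ, (fockParity 𝔭 ^ k) ((l.map (a Γ 𝔭)).prod vacuum) =
      ((-1 : ℂ) ^ l.length) ^ k • (l.map (a Γ 𝔭)).prod vacuum := fun k => by
    induction k with
    | zero => simp
    | succ k ih =>
      have h2 := congrArg (fun T : Fock 𝔭 →L[ℂ] Fock 𝔭 => T vacuum)
        (mul_list_prod (T := fockParity 𝔭) (F := a Γ 𝔭) l fun f _ => fockParity_mul_a f)
      simp only [mul_apply_eq_comp, smul_apply,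
        fockParity_vacuum] at h2
      rw [pow_succ (fockParity 𝔭), mul_apply_eq_comp, h2, map_smul, ih, smul_smul,
        pow_succ' _ k]
  rw [h1]
  -- The exponents n² and n have the same parity.
  congr 1
  rcases Nat.even_or_odd l.length with h | h <;> simp [h.neg_one_pow]

/-- For a commutant element B, ⟪A^*Ω, BΩ⟫ = ⟪B^*Ω, AΩ⟫. With B a field monomial of 𝔮ᗮ times
parities, B^*Ω is the reversed monomial with the sign (-1)^n left by the parities; this is the
origin of the minus sign in α. -/
lemma antiFock_subset_tomitaAdj (hΓ : IsAntiunitaryInvolution Γ) (hP : IsBasisProjection Γ 𝔭) :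
    antiFock (fieldGraph Γ 𝔭 (-1) 𝔮ᗮ) ⊆ tomitaAdj Γ 𝔭 𝔮 := by
  rintro ⟨x, y⟩ h
  rw [tomitaAdj, tomita, antiAdjoint_closure]
  have hl := isSemilinear_antiAdjoint
    {w : Fock 𝔭 × Fock 𝔭 | ∃ A ∈ M Γ 𝔭 𝔮, w = (A vacuum, ContinuousLinearMap.adjoint A vacuum)}
  refine antiFock_fieldGraph_induction (N := fun x y => (x, y) ∈ antiAdjoint _) hΓ (by ring)
    (fun x y x' y' h h' => hl.add_mem h h') (fun c x y h => hl.smul_mem c h) ?_ h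
  rintro l hl _ ⟨A, hA, rfl⟩
  have h1 := hA _ (list_mem_centralizer hΓ hP l hl)
  have h2 := congrArg (fun T : Fock 𝔭 →L[ℂ] Fock 𝔭 => T vacuum) h1
  simp only [mul_apply_eq_comp, fockParity_pow_vacuum] at h2
  have h3 : ∀ k : ℕ, ContinuousLinearMap.adjoint (fockParity 𝔭 ^ k) = fockParity 𝔭 ^ k := fun k => by
    rw [← ContinuousLinearMap.star_eq_adjoint, star_pow, ContinuousLinearMap.star_eq_adjoint,
      adjoint_fockParity]
  have h4 := fockParity_pow_list (Γ := Γ) (𝔭 := 𝔭) l.reverse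
  rw [List.length_reverse] at h4
  change ⟪ContinuousLinearMap.adjoint A vacuum, (l.map fun f => a Γ 𝔭 (Γ f)).prod vacuum⟫_ℂ =
    ⟪(-1 : ℂ) ^ l.length • (l.reverse.map (a Γ 𝔭)).prod vacuum, A vacuum⟫_ℂ
  rw [ContinuousLinearMap.adjoint_inner_left, ← h2, ← h4, ← h3, ContinuousLinearMap.adjoint_inner_left,
    ← adjoint_list hΓ, ContinuousLinearMap.adjoint_inner_left, h3]

lemma mem_finDomain_of_mem_antiFock (hΓ : IsAntiunitaryInvolution Γ) {σ : ℂ} (hσ : σ * σ = 1)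
    {𝔯 : Submodule ℂ 𝔥} (hr : ∀ f ∈ 𝔯, Γ f ∈ 𝔯) {x y : Fock 𝔭}
    (h : (x, y) ∈ antiFock (fieldGraph Γ 𝔭 σ 𝔯)) : x ∈ finDomain Γ 𝔭 𝔯 := by
  refine antiFock_fieldGraph_induction (N := fun x _ => x ∈ finDomain Γ 𝔭 𝔯) hΓ hσ
    (fun _ _ _ _ h h' => add_mem h h') (fun c _ _ h => Submodule.smul_mem _ c h) (fun l hl => ?_) h
  refine Submodule.subset_span ⟨l.map Γ, fun f hf => ?_, by rw [List.map_map]; rfl⟩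
  obtain ⟨g, hg, rfl⟩ := List.mem_map.mp hf
  exact hr g (hl g hg)

lemma exists_mem_antiFock_of_mem_finDomain (hΓ : IsAntiunitaryInvolution Γ) {σ : ℂ} (hσ : σ * σ = 1)
    {𝔯 : Submodule ℂ 𝔥} (hr : ∀ f ∈ 𝔯, Γ f ∈ 𝔯) {x : Fock 𝔭} (hx : x ∈ finDomain Γ 𝔭 𝔯) :
    ∃ y, (x, y) ∈ antiFock (fieldGraph Γ 𝔭 σ 𝔯) := by
  have hs := isSemilinear_antiFock (fieldGraph Γ 𝔭 σ 𝔯)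
  induction hx using Submodule.span_induction with
  | mem x h =>
    obtain ⟨l, hl, rfl⟩ := h
    have h1 := list_mem_antiFock (𝔭 := 𝔭) hΓ hσ (l.map Γ) fun f hf => by
      obtain ⟨g, hg, rfl⟩ := List.mem_map.mp hf
      exact hr g (hl g hg)
    simp only [List.map_map, Function.comp_def, hΓ.involutive] at h1
    exact ⟨_, h1⟩
  | zero => exact ⟨0, hs.zero_mem (antiFock_nonempty _)⟩
  | add x x' _ _ h h' =>
    obtain ⟨y, hy⟩ := h
    obtain ⟨y', hy'⟩ := h'
    exact ⟨_, hs.add_mem hy hy'⟩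
  | smul c x _ h =>
    obtain ⟨y, hy⟩ := h
    exact ⟨_, hs.smul_mem c hy⟩

end

end SelfDualCAR

end

noncomputable section

namespace SelfDualCAR

open ExteriorAlgebra FermiFock OpGraph

variable {𝔥 : Type*} [NormedAddCommGroup 𝔥] [InnerProductSpace ℂ 𝔥]
variable {Γ : 𝔥 →ₗ⋆[ℂ] 𝔥} {𝔭 𝔮 : Submodule ℂ 𝔥} [𝔭.HasOrthogonalProjection]

/-! ### The one-particle operators -/

section

lemma proj_add (f g : 𝔥) : proj 𝔭 (f + g) = proj 𝔭 f + proj 𝔭 g := map_add _ f g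

lemma proj_sub (f g : 𝔥) : proj 𝔭 (f - g) = proj 𝔭 f - proj 𝔭 g := map_sub _ f g

lemma proj_smul (c : ℂ) (f : 𝔥) : proj 𝔭 (c • f) = c • proj 𝔭 f := map_smul _ c f

lemma proj_coe (p : 𝔭) : proj 𝔭 (p : 𝔥) = p :=
  Submodule.orthogonalProjectionOnto_mem_subspace_eq_self p

variable (Γ 𝔭) in
lemma isSemilinear_fieldGraph (σ : ℂ) (𝔯 : Submodule ℂ 𝔥) :
    IsSemilinear (starRingEnd ℂ) (fieldGraph Γ 𝔭 σ 𝔯) where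
  add_mem {x y x' y'} h h' := by
    obtain ⟨f, hf, hw⟩ := h
    obtain ⟨f', hf', hw'⟩ := h'
    simp only [Prod.mk.injEq] at hw hw'
    refine ⟨f + f', 𝔯.add_mem hf hf', ?_⟩
    rw [hw.1, hw.2, hw'.1, hw'.2, map_add Γ, proj_add, proj_add, smul_add]
  smul_mem c {x y} h := by
    obtain ⟨f, hf, hw⟩ := h
    simp only [Prod.mk.injEq] at hw
    refine ⟨c • f, 𝔯.smul_mem c hf, ?_⟩
    rw [hw.1, hw.2, Γ.map_smulₛₗ, proj_smul, proj_smul, smul_comm]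

lemma β_eq : β Γ 𝔭 𝔮 = fieldGraph Γ 𝔭 1 𝔮 := by simp [β, fieldGraph]

lemma α_eq : α Γ 𝔭 𝔮 = fieldGraph Γ 𝔭 (-1) 𝔮ᗮ := by simp [α, fieldGraph]

/-- `P Γ = Γ (1 - P)`. -/
lemma starProjection_conj (hΓ : IsAntiunitaryInvolution Γ) (hP : IsBasisProjection Γ 𝔭) (f : 𝔥) :
    𝔭.starProjection (Γ f) = Γ f - Γ (𝔭.starProjection f) := by
  have h1 := congrArg Γ (hP f)
  rw [map_add, hΓ.involutive] at h1
  exact eq_sub_of_add_eq' h1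

lemma starProjection_conj_of_mem (hΓ : IsAntiunitaryInvolution Γ) (hP : IsBasisProjection Γ 𝔭) {f : 𝔥}
    (hf : f ∈ 𝔭) : 𝔭.starProjection (Γ f) = 0 := by
  rw [starProjection_conj hΓ hP, Submodule.starProjection_eq_self_iff.mpr hf, sub_self]

lemma proj_conj_of_mem (hΓ : IsAntiunitaryInvolution Γ) (hP : IsBasisProjection Γ 𝔭) (p : 𝔭) :
    proj 𝔭 (Γ (p : 𝔥)) = 0 :=
  Subtype.ext (starProjection_conj_of_mem hΓ hP p.2)

lemma conj_mem_orthogonal (hΓ : IsAntiunitaryInvolution Γ) (hQ : ∀ q ∈ 𝔮, Γ q ∈ 𝔮) {f : 𝔥}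
    (hf : f ∈ 𝔮ᗮ) : Γ f ∈ 𝔮ᗮ := by
  refine (Submodule.mem_orthogonal _ _).mpr fun q hq => ?_
  rw [← inner_conj_symm, hΓ.inner_left, (Submodule.mem_orthogonal _ _).mp hf _ (hQ q hq), map_zero]

/-- The adjoint of `P f ↦ σ P Γ f`, `f ∈ 𝔯`, is `P f ↦ -σ P Γ f`, `f ∈ 𝔯ᗮ`. -/
lemma antiAdjoint_fieldGraph (hΓ : IsAntiunitaryInvolution Γ) (hP : IsBasisProjection Γ 𝔭) {σ : ℂ}
    (hσ : σ * σ = 1) (hσ' : star σ = σ) {𝔯 : Submodule ℂ 𝔥} (hr : ∀ f ∈ 𝔯, Γ f ∈ 𝔯) :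
    antiAdjoint (fieldGraph Γ 𝔭 σ 𝔯) = fieldGraph Γ 𝔭 (-σ) 𝔯ᗮ := by
  have hσ'' : (starRingEnd ℂ) σ = σ := hσ'
  refine Set.Subset.antisymm ?_ ?_
  · rintro ⟨y, z⟩ h
    -- The witness is forced: PΓ vanishes on 𝔭, so f = y - σΓz satisfies Pf = y and -σPΓf = z. The
    -- adjoint condition says exactly that f is orthogonal to 𝔯.
    have hmem : (y : 𝔥) - σ • Γ (z : 𝔥) ∈ 𝔯ᗮ := by
      refine (Submodule.mem_orthogonal _ _).mpr fun q hq => ?_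
      have h1 := h _ ⟨Γ q, hr q hq, rfl⟩
      simp only [hΓ.involutive] at h1
      rw [inner_smul_left, hσ'', Submodule.inner_orthogonalProjectionOnto_eq_of_mem_right,
        Submodule.inner_orthogonalProjectionOnto_eq_of_mem_left] at h1
      have h2 : ⟪q, Γ z⟫_ℂ = ⟪(z : 𝔥), Γ q⟫_ℂ := by
        rw [← inner_conj_symm, hΓ.inner_left, inner_conj_symm]
      rw [inner_sub_right, inner_smul_right, h2]
      linear_combination σ * h1 - ⟪q, (y : 𝔥)⟫_ℂ * hσ
    refine ⟨_, hmem, ?_⟩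
    rw [Prod.mk.injEq]
    constructor
    · rw [proj_sub, proj_smul, proj_conj_of_mem hΓ hP, smul_zero, sub_zero, proj_coe]
    · rw [map_sub Γ, Γ.map_smulₛₗ, hΓ.involutive, proj_sub, proj_smul, proj_conj_of_mem hΓ hP, hσ'',
        proj_coe, zero_sub, neg_smul_neg, smul_smul, hσ, one_smul]
  · rintro _ ⟨f, hf, rfl⟩ _ ⟨q, hq, rfl⟩
    simp only
    have h1 := inner_proj_conj hΓ hP q f
    have h2 : ⟪q, Γ f⟫_ℂ = 0 := (Submodule.mem_orthogonal _ _).mp (conj_mem_orthogonal hΓ hr hf) q hq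
    rw [h2] at h1
    rw [inner_smul_left, inner_smul_left, map_neg, hσ'']
    have h3 := congrArg (starRingEnd ℂ) h1
    rw [map_add, inner_conj_symm, inner_conj_symm, map_zero] at h3
    linear_combination σ * h3

variable (Γ) in
/-- An antiunitary involution as a continuous map. -/
def conjL (hΓ : IsAntiunitaryInvolution Γ) : 𝔥 →L⋆[ℂ] 𝔥 :=
  Γ.mkContinuous 1 fun f => by
    have := hΓ.inner_map f f
    rw [inner_self_eq_norm_sq_to_K, inner_self_eq_norm_sq_to_K] at this
    have h2 : ‖Γ f‖ ^ 2 = ‖f‖ ^ 2 := by exact_mod_cast this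
    rw [one_mul, (sq_eq_sq₀ (norm_nonneg _) (norm_nonneg _)).mp h2]

variable (𝔭 𝔮) in
/-- The compression `P Q P` of `Q` to `𝔭`. -/
def compression [𝔮.HasOrthogonalProjection] : 𝔭 →L[ℂ] 𝔭 :=
  𝔭.orthogonalProjectionOnto.comp (𝔮.starProjection.comp 𝔭.subtypeL)

variable (𝔭 𝔮) in
/-- The antilinear compression `P Γ Q P` to `𝔭`. -/
def conjCompression [𝔮.HasOrthogonalProjection] (hΓ : IsAntiunitaryInvolution Γ) : 𝔭 →L⋆[ℂ] 𝔭 :=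
  𝔭.orthogonalProjectionOnto.comp ((conjL Γ hΓ).comp (𝔮.starProjection.comp 𝔭.subtypeL))

variable [𝔮.HasOrthogonalProjection]

lemma compression_apply (p : 𝔭) :
    compression 𝔭 𝔮 p = proj 𝔭 (𝔮.starProjection (p : 𝔥)) := rfl

lemma conjCompression_apply (hΓ : IsAntiunitaryInvolution Γ) (p : 𝔭) :
    conjCompression 𝔭 𝔮 hΓ p = proj 𝔭 (Γ (𝔮.starProjection (p : 𝔥))) := rfl

/-- `Q Γ = Γ Q`. -/
lemma starProjection_conj_comm (hΓ : IsAntiunitaryInvolution Γ) (hQ : ∀ q ∈ 𝔮, Γ q ∈ 𝔮) (f : 𝔥) :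
    𝔮.starProjection (Γ f) = Γ (𝔮.starProjection f) := by
  refine Submodule.eq_starProjection_of_mem_orthogonal (hQ _ (𝔮.starProjection_apply_mem f)) ?_
  rw [← map_sub]
  exact conj_mem_orthogonal hΓ hQ (𝔮.sub_starProjection_mem_orthogonal f)

/-- The identities for D = PQP and b = PΓQP come from QΓ = ΓQ and PΓ = Γ(1 - P). Closedness holds
because each graph is the adjoint of the other. -/
lemma isModularPair (hΓ : IsAntiunitaryInvolution Γ) (hP : IsBasisProjection Γ 𝔭)
    (hQ : ∀ q ∈ 𝔮, Γ q ∈ 𝔮) (hgen : GenericPosition 𝔭 𝔮) [CompleteSpace 𝔥] :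
    IsModularPair (compression 𝔭 𝔮) (conjCompression 𝔭 𝔮 hΓ) (fieldGraph Γ 𝔭 1 𝔮)
      (fieldGraph Γ 𝔭 (-1) 𝔮ᗮ) := by
  have h1 := antiAdjoint_fieldGraph (σ := 1) hΓ hP (by simp) (by simp) hQ
  have h2 := antiAdjoint_fieldGraph (σ := -1) hΓ hP (by simp) (by simp)
    fun f hf => conj_mem_orthogonal hΓ hQ hf
  rw [neg_neg, Submodule.orthogonal_orthogonal] at h2
  have hQQ : ∀ f, 𝔮.starProjection (𝔮.starProjection f) = 𝔮.starProjection f := fun f =>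
    Submodule.starProjection_eq_self_iff.mpr (𝔮.starProjection_apply_mem f)
  have hQΓ := starProjection_conj_comm hΓ hQ
  have hb : ∀ p : 𝔭, (conjCompression 𝔭 𝔮 hΓ p : 𝔥) = Γ (𝔮.starProjection (p : 𝔥)) -
      Γ (𝔭.starProjection (𝔮.starProjection (p : 𝔥))) := fun p => starProjection_conj hΓ hP _
  refine
    { linear := isSemilinear_fieldGraph Γ 𝔭 1 𝔮
      linear' := isSemilinear_fieldGraph Γ 𝔭 (-1) 𝔮ᗮ
      adjoint := h2.ge
      isClosed := by rw [← h2]; exact isClosed_antiAdjoint _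
      isClosed' := by rw [← h1]; exact isClosed_antiAdjoint _
      mem := fun p => ⟨_, 𝔮.starProjection_apply_mem (p : 𝔥), by rw [one_smul]; rfl⟩
      mem' := fun p => ⟨_, 𝔮.sub_starProjection_mem_orthogonal (p : 𝔥), ?_⟩
      symm := fun p q => ?_
      nonneg := fun p => ?_
      inner_eq := fun p q => ?_
      sq_eq := fun p => ?_
      comm := fun p => ?_
      injective := fun p hp => ?_ }
  · rw [proj_sub, map_sub Γ, proj_sub, proj_conj_of_mem hΓ hP, zero_sub, neg_smul_neg, one_smul,
      proj_coe]
    rfl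
  · rw [compression_apply, compression_apply, Submodule.inner_orthogonalProjectionOnto_eq_of_mem_right,
      Submodule.inner_orthogonalProjectionOnto_eq_of_mem_left,
      Submodule.inner_starProjection_left_eq_right]
  · rw [compression_apply, Submodule.inner_orthogonalProjectionOnto_eq_of_mem_right]
    exact Submodule.re_inner_starProjection_nonneg 𝔮 (p : 𝔥)
  · rw [conjCompression_apply, conjCompression_apply,
      Submodule.inner_orthogonalProjectionOnto_eq_of_mem_right,
      Submodule.inner_orthogonalProjectionOnto_eq_of_mem_right, hΓ.inner_left,
      ← Submodule.inner_starProjection_left_eq_right, starProjection_conj_comm hΓ hQ]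
  · rw [conjCompression_apply, hb, map_sub, hQΓ, hQΓ, hQQ, ← map_sub Γ, hΓ.involutive, proj_sub]
    rfl
  · rw [compression_apply (conjCompression 𝔭 𝔮 hΓ p), hb, map_sub, hQΓ, hQΓ, hQQ, proj_sub,
      conjCompression_apply, conjCompression_apply, sub_sub_cancel]
    rfl
  · have h3 := hb p
    rw [hp, Submodule.coe_zero, eq_comm, sub_eq_zero] at h3
    have h4 := congrArg Γ h3
    rw [hΓ.involutive, hΓ.involutive] at h4
    -- If bp = 0 then PΓQp = 0, so Qp lies in 𝔭 ∩ 𝔮 and vanishes; then p lies in 𝔭 ∩ 𝔮ᗮ and vanishes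
    -- too.
    have h5 : 𝔮.starProjection (p : 𝔥) ∈ 𝔭 ⊓ 𝔮 :=
      ⟨Submodule.starProjection_eq_self_iff.mp h4.symm, 𝔮.starProjection_apply_mem _⟩
    rw [hgen.inf_left, Submodule.mem_bot, Submodule.starProjection_apply_eq_zero_iff] at h5
    have h6 : (p : 𝔥) ∈ 𝔭 ⊓ 𝔮ᗮ := ⟨p.2, h5⟩
    rw [hgen.inf_right, Submodule.mem_bot] at h6
    exact Subtype.ext h6

/-- The domain of the one-particle modular operator is `P Q 𝔭`. -/
lemma domain_oneModular (hΓ : IsAntiunitaryInvolution Γ) (hP : IsBasisProjection Γ 𝔭)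
    (hQ : ∀ q ∈ 𝔮, Γ q ∈ 𝔮) : {p | ∃ p', (p, p') ∈ oneModular Γ 𝔭 𝔮} =
      {p | ∃ p₀ : 𝔭, p = proj 𝔭 (𝔮.starProjection (p₀ : 𝔥))} := by
  rw [oneModular, β_eq, antiAdjoint_fieldGraph hΓ hP (one_mul 1) (star_one ℂ) hQ]
  ext p
  constructor
  · rintro ⟨p', y, ⟨q, hq, h⟩, ⟨q', hq', h'⟩⟩
    simp only [Prod.mk.injEq, one_smul] at h h'
    have h1 : 𝔭.starProjection (Γ q) = 𝔭.starProjection q' :=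
      congrArg (fun p : 𝔭 => (p : 𝔥)) (h.2.symm.trans h'.1)
    rw [starProjection_conj hΓ hP, sub_eq_iff_eq_add'] at h1
    have h2 := congrArg Γ h1
    have h3 := starProjection_conj hΓ hP q'
    rw [hΓ.involutive, map_add, hΓ.involutive] at h2
    -- Conjugating PΓq = Pq' gives (1 - P)q = (1 - P)Γq'. Hence q - Γq' is in 𝔭, and Q recovers q
    -- from it.
    have h4 : q - Γ q' ∈ 𝔭 := by
      rw [← Submodule.starProjection_eq_self_iff, map_sub, h3]
      nth_rw 2 [h2]
      abel
    refine ⟨⟨q - Γ q', h4⟩, ?_⟩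
    rw [map_sub, Submodule.starProjection_eq_self_iff.mpr hq,
      𝔮.starProjection_apply_eq_zero_iff.mpr (conj_mem_orthogonal hΓ hQ hq'), sub_zero, h.1]
  · rintro ⟨p₀, rfl⟩
    -- Take q = Qp₀ and q' = -Γ(1 - Q)p₀ in 𝔮ᗮ; since PΓp₀ = 0, Pq' = PΓQp₀, so α applies to βPq.
    refine ⟨_, proj 𝔭 (Γ (𝔮.starProjection (p₀ : 𝔥))), ⟨_, 𝔮.starProjection_apply_mem (p₀ : 𝔥), ?_⟩,
      ⟨_, conj_mem_orthogonal hΓ hQ (Submodule.neg_mem _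
        (𝔮.sub_starProjection_mem_orthogonal (p₀ : 𝔥))), Prod.ext ?_ rfl⟩⟩
    · rw [one_smul]
    · rw [neg_sub, map_sub Γ, proj_sub, proj_conj_of_mem hΓ hP, sub_zero]

end

end SelfDualCAR

end

/-! ### Identification of the modular objects. -/

noncomputable section

namespace FermiFock

open OpGraph

variable {E : Type*} [NormedAddCommGroup E] [InnerProductSpace ℂ E]

lemma oneParticle_injective : Function.Injective (oneParticle : E → Fock E) :=
  (oneParticleₗᵢ (E := E)).injective

/-- The one-particle part of a composition of operators. -/
lemma restrict_comp_one {A B : Set (Fock E × Fock E)} {G H : Set (E × E)}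
    (hA : restrict A (nParticle E 1) = (fun w : E × E => (oneParticle w.1, oneParticle w.2)) '' G)
    (hB : restrict B (nParticle E 1) = (fun w : E × E => (oneParticle w.1, oneParticle w.2)) '' H) :
    restrict (comp B A) (nParticle E 1) =
      (fun w : E × E => (oneParticle w.1, oneParticle w.2)) '' comp H G := by
  refine Set.Subset.antisymm ?_ ?_
  · rintro ⟨x, y⟩ ⟨⟨z, hz, hz'⟩, hx⟩
    have h1 : (x, z) ∈ restrict A (nParticle E 1) := ⟨hz, hx⟩
    rw [hA] at h1
    obtain ⟨⟨p, p'⟩, hp, h2⟩ := h1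
    obtain ⟨rfl, rfl⟩ := Prod.mk.injEq .. ▸ h2
    have h3 : (oneParticle p', y) ∈ restrict B (nParticle E 1) := ⟨hz', oneParticle_mem p'⟩
    rw [hB] at h3
    obtain ⟨⟨q, q'⟩, hq, h4⟩ := h3
    simp only [Prod.mk.injEq] at h4
    obtain rfl := oneParticle_injective h4.1
    exact ⟨(p, q'), ⟨_, hp, hq⟩, Prod.ext rfl h4.2⟩
  · rintro _ ⟨⟨p, p'⟩, ⟨q, hq, hq'⟩, rfl⟩
    have h1 : (oneParticle p, oneParticle q) ∈ restrict A (nParticle E 1) := by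
      rw [hA]; exact ⟨_, hq, rfl⟩
    have h2 : (oneParticle q, oneParticle p') ∈ restrict B (nParticle E 1) := by
      rw [hB]; exact ⟨_, hq', rfl⟩
    exact ⟨⟨_, h1.1, h2.1⟩, h1.2⟩

end FermiFock

namespace SelfDualCAR

open FermiFock OpGraph

variable {𝔥 : Type*} [NormedAddCommGroup 𝔥] [InnerProductSpace ℂ 𝔥]
variable {Γ : 𝔥 →ₗ⋆[ℂ] 𝔥} {𝔭 𝔮 : Submodule ℂ 𝔥} [𝔭.HasOrthogonalProjection]

section

variable {e : ℕ → 𝔭 →L[ℂ] 𝔭} {g h : ℕ → 𝔭 →L⋆[ℂ] 𝔭}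

/-- A sandwich: S contains the second quantized β, and is contained in the adjoint of the second
quantized α because S^* contains the latter. The regularization makes the two bounds coincide. -/
lemma tomita_eq (hΓ : IsAntiunitaryInvolution Γ) (hP : IsBasisProjection Γ 𝔭)
    (hQ : ∀ q ∈ 𝔮, Γ q ∈ 𝔮) (R : Regularization (fieldGraph Γ 𝔭 1 𝔮) (fieldGraph Γ 𝔭 (-1) 𝔮ᗮ) e g h) :
    tomita Γ 𝔭 𝔮 = closure (antiFock (fieldGraph Γ 𝔭 1 𝔮)) := by
  refine Set.Subset.antisymm ?_ (closure_minimal (antiFock_subset_tomita hΓ hQ) isClosed_closure)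
  rw [← R.antiAdjoint_eq]
  exact subset_antiAdjoint_comm (antiFock_subset_tomitaAdj hΓ hP)

lemma tomitaAdj_eq (hΓ : IsAntiunitaryInvolution Γ) (hP : IsBasisProjection Γ 𝔭)
    (hQ : ∀ q ∈ 𝔮, Γ q ∈ 𝔮) (R : Regularization (fieldGraph Γ 𝔭 1 𝔮) (fieldGraph Γ 𝔭 (-1) 𝔮ᗮ) e g h) :
    tomitaAdj Γ 𝔭 𝔮 = closure (antiFock (fieldGraph Γ 𝔭 (-1) 𝔮ᗮ)) := by
  rw [tomitaAdj, tomita_eq hΓ hP hQ R, antiAdjoint_closure, R.swap.antiAdjoint_eq]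

lemma finDomainN_subset (𝔯 : Submodule ℂ 𝔥) (n : ℕ) : finDomainN Γ 𝔭 𝔯 n ⊆ nParticle 𝔭 n := by
  rintro _ ⟨x, -, rfl⟩
  exact starProjection_nParticle_mem n x

lemma finDomainN_subset_domain (hΓ : IsAntiunitaryInvolution Γ) {σ : ℂ} (hσ : σ * σ = 1)
    {𝔯 : Submodule ℂ 𝔥} (hr : ∀ f ∈ 𝔯, Γ f ∈ 𝔯) (n : ℕ) :
    finDomainN Γ 𝔭 𝔯 n ⊆ {x | ∃ y, (x, y) ∈ closure (antiFock (fieldGraph Γ 𝔭 σ 𝔯))} := by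
  rintro _ ⟨x, hx, rfl⟩
  obtain ⟨y, hy⟩ := exists_mem_antiFock_of_mem_finDomain (σ := σ) hΓ hσ hr hx
  exact ⟨_, subset_closure (antiFock_restrictsTo _ n _ _ hy)⟩

lemma starProjection_mem_finDomainN (hΓ : IsAntiunitaryInvolution Γ) {σ : ℂ} (hσ : σ * σ = 1)
    {𝔯 : Submodule ℂ 𝔥} (hr : ∀ f ∈ 𝔯, Γ f ∈ 𝔯) (n : ℕ) (x y : Fock 𝔭)
    (h : (x, y) ∈ antiFock (fieldGraph Γ 𝔭 σ 𝔯)) :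
    (nParticle 𝔭 n).starProjection x ∈ finDomainN Γ 𝔭 𝔯 n :=
  ⟨x, mem_finDomain_of_mem_antiFock hΓ hσ hr h, rfl⟩

lemma swap_mem_fieldGraph (hΓ : IsAntiunitaryInvolution Γ) (hQ : ∀ q ∈ 𝔮, Γ q ∈ 𝔮) (p p' : 𝔭)
    (h : (p, p') ∈ fieldGraph Γ 𝔭 1 𝔮) : (p', p) ∈ fieldGraph Γ 𝔭 1 𝔮 := by
  obtain ⟨q, hq, hw⟩ := h
  simp only [Prod.mk.injEq, one_smul] at hw
  exact ⟨Γ q, hQ q hq, by rw [hΓ.involutive, one_smul, hw.1, hw.2]⟩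

end

end SelfDualCAR

end

open FermiFock OpGraph SelfDualCAR in
theorem proposition5p3 {𝔥 : Type*} [NormedAddCommGroup 𝔥] [InnerProductSpace ℂ 𝔥] [CompleteSpace 𝔥]
    (Γ : 𝔥 →ₗ⋆[ℂ] 𝔥) (hΓ : IsAntiunitaryInvolution Γ)
    (𝔭 𝔮 : Submodule ℂ 𝔥) [𝔭.HasOrthogonalProjection] [𝔮.HasOrthogonalProjection]
    (hP : IsBasisProjection Γ 𝔭) (hQ : ∀ q ∈ 𝔮, Γ q ∈ 𝔮) (hgen : GenericPosition 𝔭 𝔮) :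
    -- `S`, `S^*` and `Δ` are densely defined operators
    (IsDenselyDefined (starRingEnd ℂ) (tomita Γ 𝔭 𝔮) ∧
      IsDenselyDefined (starRingEnd ℂ) (tomitaAdj Γ 𝔭 𝔮) ∧
      IsDenselyDefined (RingHom.id ℂ) (modularOp Γ 𝔭 𝔮)) ∧
    -- `S` and `S^*` restrict to the `n`-particle subspaces
    (∀ n : ℕ,
      RestrictsTo (tomita Γ 𝔭 𝔮) (nParticle 𝔭 n) ∧
      RestrictsTo (tomitaAdj Γ 𝔭 𝔮) (nParticle 𝔭 n) ∧
      restrict (tomita Γ 𝔭 𝔮) (nParticle 𝔭 n) =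
        closure (restrict (tomita Γ 𝔭 𝔮) (finDomainN Γ 𝔭 𝔮 n)) ∧
      restrict (tomitaAdj Γ 𝔭 𝔮) (nParticle 𝔭 n) =
        closure (restrict (tomitaAdj Γ 𝔭 𝔮) (finDomainN Γ 𝔭 𝔮ᗮ n)) ∧
      finDomainN Γ 𝔭 𝔮 n ⊆ {x | ∃ y, (x, y) ∈ tomita Γ 𝔭 𝔮} ∧
      finDomainN Γ 𝔭 𝔮ᗮ n ⊆ {x | ∃ y, (x, y) ∈ tomitaAdj Γ 𝔭 𝔮}) ∧
    restrict (tomita Γ 𝔭 𝔮) (nParticle 𝔭 1) = embed 𝔭 (β Γ 𝔭 𝔮) ∧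
    restrict (tomitaAdj Γ 𝔭 𝔮) (nParticle 𝔭 1) = embed 𝔭 (α Γ 𝔭 𝔮) ∧
    -- the modular operator
    (∀ n : ℕ, RestrictsTo (modularOp Γ 𝔭 𝔮) (nParticle 𝔭 n)) ∧
    restrict (modularOp Γ 𝔭 𝔮) (nParticle 𝔭 1) = embed 𝔭 (oneModular Γ 𝔭 𝔮) ∧
    {p | ∃ p', (p, p') ∈ oneModular Γ 𝔭 𝔮} =
      {p | ∃ p₀ : 𝔭, p = proj 𝔭 (𝔮.starProjection (p₀ : 𝔥))} ∧
    (∀ (n : ℕ) (p p' : Fin n → 𝔭), (∀ i, (p i, p' i) ∈ oneModular Γ 𝔭 𝔮) →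
      (wedge p, wedge p') ∈ modularOp Γ 𝔭 𝔮) ∧
    (∀ n : ℕ, restrict (modularOp Γ 𝔭 𝔮) (nParticle 𝔭 n) =
      closure (Submodule.span ℂ {w | ∃ p p' : Fin n → 𝔭,
        (∀ i, (p i, p' i) ∈ oneModular Γ 𝔭 𝔮) ∧ w = (wedge p, wedge p')})) ∧
    -- the modular conjugation
    (∃ J R, IsPolarDecomposition (tomita Γ 𝔭 𝔮) J R) ∧
    (∀ J R, IsPolarDecomposition (tomita Γ 𝔭 𝔮) J R →
      (∀ n : ℕ, RestrictsTo {w | w.2 = J w.1} (nParticle 𝔭 n)) ∧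
      ∃ j : 𝔭 → 𝔭, (∀ p, J (oneParticle p) = oneParticle (j p)) ∧
        ∀ (n : ℕ) (p : Fin n → 𝔭), J (wedge p) = wedge fun i => j (p i.rev)) := by
  have hclosed : IsClosed (𝔭 : Set 𝔥) := by
    rw [← 𝔭.orthogonal_orthogonal]; exact Submodule.isClosed_orthogonal _
  have : CompleteSpace 𝔭 := hclosed.completeSpace_coe
  have hQ' : ∀ f ∈ 𝔮ᗮ, Γ f ∈ 𝔮ᗮ := fun f hf => conj_mem_orthogonal hΓ hQ hf
  have hone : (-1 : ℂ) * -1 = 1 := by norm_num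
  have M := isModularPair hΓ hP hQ hgen
  have R := M.regularization
  obtain ⟨j, hj⟩ := M.exists_isConjugation
  have hS := tomita_eq hΓ hP hQ R
  have hS' := tomitaAdj_eq hΓ hP hQ R
  have hΔ : oneModular Γ 𝔭 𝔮 = comp (fieldGraph Γ 𝔭 (-1) 𝔮ᗮ) (fieldGraph Γ 𝔭 1 𝔮) := by
    rw [oneModular, β_eq, antiAdjoint_fieldGraph hΓ hP (one_mul 1) (star_one ℂ) hQ]
  have hsw := swap_mem_fieldGraph (𝔭 := 𝔭) hΓ hQ
  have h1 := restrict_closure_antiFock_one M.isClosed M.linear ⟨_, M.mem 0⟩ R.unique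
  have h1' := restrict_closure_antiFock_one M.isClosed' M.linear' ⟨_, M.mem' 0⟩ R.swap.unique
  rw [hΔ, modularOp, hS, hS', β_eq, α_eq, ← hΔ, domain_oneModular hΓ hP hQ, hΔ]
  refine ⟨⟨R.isDenselyDefined, R.swap.isDenselyDefined, R.isDenselyDefined_comp⟩,
    fun n => ⟨(antiFock_restrictsTo _ n).closure, (antiFock_restrictsTo _ n).closure,
      restrict_closure_antiFock (finDomainN_subset 𝔮 n)
        (starProjection_mem_finDomainN hΓ (one_mul 1) hQ n) R.unique,
      restrict_closure_antiFock (finDomainN_subset 𝔮ᗮ n)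
        (starProjection_mem_finDomainN hΓ hone hQ' n) R.swap.unique,
      finDomainN_subset_domain hΓ (one_mul 1) hQ n, finDomainN_subset_domain hΓ hone hQ' n⟩,
    h1, h1', fun n => (antiFock_restrictsTo _ n).closure.comp (antiFock_restrictsTo _ n).closure,
    restrict_comp_one h1 h1', rfl, fun n p p' hp => Regularization.wedge_mem_comp hp, R.restrict_comp_eq,
    ⟨_, hj.exists_isPolarDecomposition R hsw⟩, fun J T hJ => ?_⟩
  obtain rfl := hj.eq_of_isPolarDecomposition R hsw hJ
  refine ⟨hj.fock_restrictsTo, j, fun p => ?_, fun n p => hj.fock_wedge p⟩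
  simpa only [wedge_one] using hj.fock_wedge fun _ : Fin 1 => p
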